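/- Write $u^r=-r\,\partial_z\psi_1$ and $u^z=2\psi_1+r\,\partial_r\psi_1$, and consider the axisymmetric 3D Euler system $$\partial_t u_1+u^r\partial_r u_1+u^z\partial_z u_1=2u_1\partial_z\psi_1,\qquad \partial_t\omega_1+u^r\partial_r\omega_1+u^z\partial_z\omega_1=\partial_z(u_1^2),\qquad -\Big(\partial_r^2+\frac3r\partial_r+\partial_z^2\Big)\psi_1=\omega_1 .$$ Let $0<\gamma<\infty$ and $T\in\mathbb R$, and let $S$ be one of the following sets of points $(r,z,t)$: (a) $\mathcal C_{\delta,T}=\{1-\delta<r<1,\ -\delta<z<\delta,\ T-\delta<t<T\}$ for some $0<\delta\le 1$; (b) $\mathcal W_{\delta(t)}=\{1-\delta(t)<r<1,\ -\delta(t)<z<\delta(t),\ T_0<t<T\}$ for some $T_0<T$ and some nonincreasing function $\delta:(T_0,T)\to(0,1]$ with $\lim_{t\to T_-}\delta(t)=0$ and $\limsup_{t\to T_-}(T-t)^{-\gamma}\delta(t)=\infty$. Let $(u_1,\omega_1,\psi_1)$ be real functions on $S$ which form a classical solution of the system in the interior of $S$ (that is, $u_1,\omega_1$ are $C^1$ in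 $(r,z,t)$, $\psi_1(\cdot,\cdot,t)$ is $C^2$ for every $t$, and the equations hold pointwise), and suppose that on $S$, with $R=\frac{r-1}{(T-t)^\gamma}$ and $Z=\frac{z}{(T-t)^\gamma}$, $$u_1=(T-t)^{-1+\frac\gamma2}\sum_{k=0}^\infty(T-t)^{k\gamma}U_k(R,Z),\quad \omega_1=(T-t)^{-1}\sum_{k=0}^\infty(T-t)^{k\gamma}\Omega_k(R,Z),\quad \psi_1=(T-t)^{-1+2\gamma}\sum_{k=0}^\infty(T-t)^{k\gamma}\Psi_k(R,Z),$$ where the series converge locally uniformly on $S$. Let $\overline{\mathcal D}=\{Y=(R,Z)\in\mathbb R^2: R\le 0\}$ and assume: 1. $U_k,\Omega_k,\Psi_k$ are $C^1$ on $\overline{\mathcal D}$ (up to the boundary) for all $k\ge0$; 2. $|U_k(Y)|+|\Omega_k(Y)|=o(1)$ and $|\nabla\Psi_k(Y)|=o(|Y|)$ as $|Y|\to\infty$ in $\overline{\mathcal D}$, for all $k\ge0$; 3. $\partial_Z\Psi_k=0$ on $\{R=0\}$ for all $k\ge0$; 4. for some positive even integer $p$, $$\lim_{\rho\to\infty}\int_{\{Y\in\overline{\mathcal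 D}:\ \rho<|Y|<2\rho\}}\big(U_k^p+\Omega_k^p\big)\,dY=0\quad\text{for all integers }0\le k\le 1/\gamma .$$ Then $u_1=\omega_1=0$ and $\nabla\psi_1=(\partial_r\psi_1,\partial_z\psi_1)=0$ on $S$. -/

import Mathlib

open Set Filter Topology MeasureTheory Asymptotics

noncomputable section

/-! Space-time points are triples `(r, z, t)`; profile variables are pairs `Y = (R, Z)`. -/

/-- Partial derivative in `r` of a function of `(r, z, t)`. -/
def dr (f : ℝ × ℝ × ℝ → ℝ) (x : ℝ × ℝ × ℝ) : ℝ :=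
  deriv (fun r => f (r, x.2.1, x.2.2)) x.1

/-- Partial derivative in `z` of a function of `(r, z, t)`. -/
def dz (f : ℝ × ℝ × ℝ → ℝ) (x : ℝ × ℝ × ℝ) : ℝ :=
  deriv (fun z => f (x.1, z, x.2.2)) x.2.1

/-- Partial derivative in `t` of a function of `(r, z, t)`. -/
def dt (f : ℝ × ℝ × ℝ → ℝ) (x : ℝ × ℝ × ℝ) : ℝ :=
  deriv (fun t => f (x.1, x.2.1, t)) x.2.2

/-- The radial velocity `u^r = - r ∂_z ψ₁`. -/
def radialVelocity (ψ₁ : ℝ × ℝ × ℝ → ℝ) (x : ℝ × ℝ × ℝ) : ℝ :=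
  -x.1 * dz ψ₁ x

/-- The axial velocity `u^z = 2 ψ₁ + r ∂_r ψ₁`. -/
def axialVelocity (ψ₁ : ℝ × ℝ × ℝ → ℝ) (x : ℝ × ℝ × ℝ) : ℝ :=
  2 * ψ₁ x + x.1 * dr ψ₁ x

/-- `(u₁, ω₁, ψ₁)` is a classical solution of the axisymmetric Euler system on the open set `G`
of points `(r, z, t)`: `u₁` and `ω₁` are `C¹` there, `ψ₁` is `C²` in `(r, z)` at each time, and
the three equations hold pointwise. -/
structure IsClassicalSolution (G : Set (ℝ × ℝ × ℝ)) (u₁ ω₁ ψ₁ : ℝ × ℝ × ℝ → ℝ) : Prop where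
  contDiffOn_u : ContDiffOn ℝ 1 u₁ G
  contDiffOn_ω : ContDiffOn ℝ 1 ω₁ G
  contDiffOn_ψ : ∀ t : ℝ, ContDiffOn ℝ 2 (fun y : ℝ × ℝ => ψ₁ (y.1, y.2, t))
    {y : ℝ × ℝ | (y.1, y.2, t) ∈ G}
  eq_u : ∀ x ∈ G, dt u₁ x + radialVelocity ψ₁ x * dr u₁ x + axialVelocity ψ₁ x * dz u₁ x
    = 2 * u₁ x * dz ψ₁ x
  eq_ω : ∀ x ∈ G, dt ω₁ x + radialVelocity ψ₁ x * dr ω₁ x + axialVelocity ψ₁ x * dz ω₁ x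
    = dz (fun y => u₁ y ^ 2) x
  eq_ψ : ∀ x ∈ G, -(dr (dr ψ₁) x + 3 / x.1 * dr ψ₁ x + dz (dz ψ₁) x) = ω₁ x

/-- The fixed space-time neighbourhood of the boundary circle. -/
def cylinderRegion (δ T : ℝ) : Set (ℝ × ℝ × ℝ) :=
  {x | 1 - δ < x.1 ∧ x.1 < 1 ∧ -δ < x.2.1 ∧ x.2.1 < δ ∧ T - δ < x.2.2 ∧ x.2.2 < T}

/-- The time-dependent window around the boundary circle. -/
def windowRegion (δ : ℝ → ℝ) (T₀ T : ℝ) : Set (ℝ × ℝ × ℝ) :=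
  {x | 1 - δ x.2.2 < x.1 ∧ x.1 < 1 ∧ -δ x.2.2 < x.2.1 ∧ x.2.1 < δ x.2.2 ∧
    T₀ < x.2.2 ∧ x.2.2 < T}

/-- The admissible regions: a fixed neighbourhood, or a window which shrinks to the boundary
circle, but along some sequence of times more slowly than `(T - t)^γ`. The bounds `δ ≤ 1` say that
the region lies in the cylinder `0 < r < 1`, where the system is posed. -/
def IsAdmissibleRegion (γ T : ℝ) (S : Set (ℝ × ℝ × ℝ)) : Prop :=
  (∃ δ : ℝ, 0 < δ ∧ δ ≤ 1 ∧ S = cylinderRegion δ T) ∨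
  (∃ (T₀ : ℝ) (δ : ℝ → ℝ), T₀ < T ∧ (∀ t ∈ Ioo T₀ T, 0 < δ t ∧ δ t ≤ 1) ∧
    AntitoneOn δ (Ioo T₀ T) ∧
    Tendsto δ (𝓝[<] T) (𝓝 0) ∧
    limsup (fun t => (((T - t) ^ (-γ) * δ t : ℝ) : EReal)) (𝓝[<] T) = ⊤ ∧
    S = windowRegion δ T₀ T)

/-- The similarity variables `Y = (R, Z) = ((r - 1) / (T - t)^γ, z / (T - t)^γ)`. -/
def similarityVar (γ T : ℝ) (x : ℝ × ℝ × ℝ) : ℝ × ℝ :=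
  ((x.1 - 1) / (T - x.2.2) ^ γ, x.2.1 / (T - x.2.2) ^ γ)

/-- The representation `f(r, z, t) = (T - t)^a ∑_{k ≥ 0} (T - t)^{kγ} F_k(R, Z)` on `S`, the series
converging locally uniformly on `S`. -/
def HasSelfSimilarSeries (γ T a : ℝ) (S : Set (ℝ × ℝ × ℝ)) (F : ℕ → ℝ × ℝ → ℝ)
    (f : ℝ × ℝ × ℝ → ℝ) : Prop :=
  TendstoLocallyUniformlyOn
    (fun (N : ℕ) (x : ℝ × ℝ × ℝ) => (T - x.2.2) ^ a *
      ∑ k ∈ Finset.range N, (T - x.2.2) ^ ((k : ℝ) * γ) * F k (similarityVar γ T x))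
    f atTop S

/-- The closed left half-plane `R ≤ 0`. -/
def leftHalfPlane : Set (ℝ × ℝ) := {Y | Y.1 ≤ 0}

/-- The Euclidean length of a vector of the plane. -/
def euclNorm (Y : ℝ × ℝ) : ℝ := Real.sqrt (Y.1 ^ 2 + Y.2 ^ 2)

/-- The gradient `(∂_R F, ∂_Z F)` on the closed left half-plane (one-sided in `R` on the boundary
line `R = 0`). -/
def profileGrad (F : ℝ × ℝ → ℝ) (Y : ℝ × ℝ) : ℝ × ℝ :=
  (fderivWithin ℝ F leftHalfPlane Y (1, 0), fderivWithin ℝ F leftHalfPlane Y (0, 1))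

/-- The filter "`|Y| → ∞` in the closed left half-plane". -/
def profileInfinity : Filter (ℝ × ℝ) := cocompact (ℝ × ℝ) ⊓ 𝓟 leftHalfPlane

/-- The half-annulus `ρ < |Y| < 2ρ` in the left half-plane. -/
def halfAnnulus (ρ : ℝ) : Set (ℝ × ℝ) :=
  {Y | Y ∈ leftHalfPlane ∧ ρ < euclNorm Y ∧ euclNorm Y < 2 * ρ}

end

/-! Take `x = (T - t)^γ` as small parameter and the similarity variables `Y = (R, Z)` as space
variables. The solution is then a power series in `x` whose coefficients are the profiles.

Transport. Let `V` be the first profile of `u₁` not yet known to vanish, of index `k`. The leading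
order of its equation is `(γ Y + (-∂_Z Ψ₀, ∂_R Ψ₀)) · ∇V = σ V` with `σ = a + γ k`, where `a` is the
exponent of the series; the stretching term carries an additional factor `x` and disappears. The
drift has constant divergence `2γ`, and `∂_Z Ψ₀ = 0` makes it tangent to the line `R = 0`.
Multiplying by `Φ'(V)` and integrating gives `∫ (σ V Φ'(V) + 2γ Φ(V)) = 0` as soon as `Φ(V)` has
bounded support, which the decay of `V` ensures if `Φ` vanishes near `0`. A truncated power of high
order gives the integrand a sign, so `V = 0` (`transport_liouville`). Induction on `k` yields `u₁ =
0` (`profiles_eq_zero`). The source of the vorticity equation is then zero, and the same argument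
yields `ω₁ = 0`.

Stream function. Without vorticity, if `Ψ_{k-1} = c R + const` and all earlier profiles are
constant, then `ΔΨ_k = -3c`. After addition of `(3c/2) R²` and subtraction of the boundary value,
odd reflection gives a harmonic function on the plane whose increments in `Z` grow sublinearly.
These increments are constant by Liouville's theorem and zero on the axis, so the function is linear
in `R`. Now `∂_R Ψ_k = A - 3cR` is sublinear only if `c = 0` (`elliptic_liouville`). A slope `A` is
compatible with the growth condition, and is removed only at the next order
(`stream_profiles_const`).

Limits. The series converge locally uniformly, which says nothing about derivatives in `Y`.
Caccioppoli's inequality bounds the gradient of the rescaled stream function in `L²` uniformly in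
`x`. The errors in the renormalized transport equation are at most `x` times `1 + |∇F|²` and vanish
in the limit; in the remaining flux the derivatives are moved off the stream function
(`StreamFamily.transport_weak_limit`). In a shrinking window a given box of similarity variables
fits only along some scales tending to zero, so all limits are taken along `scaleFilter`. -/

noncomputable section

/-! ### Partial derivatives on the plane. -/

/-- The partial derivative in the first variable of a function on the plane. -/
def partialR (f : ℝ × ℝ → ℝ) (Y : ℝ × ℝ) : ℝ := fderiv ℝ f Y (1, 0)

/-- The partial derivative in the second variable of a function on the plane. -/
def partialZ (f : ℝ × ℝ → ℝ) (Y : ℝ × ℝ) : ℝ := fderiv ℝ f Y (0, 1)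

lemma hasDerivAt_partialR {f : ℝ × ℝ → ℝ} {Y : ℝ × ℝ} (h : DifferentiableAt ℝ f Y) :
    HasDerivAt (fun s => f (s, Y.2)) (partialR f Y) Y.1 := by
  have h1 : HasDerivAt (fun s : ℝ => (s, Y.2)) ((1 : ℝ), (0 : ℝ)) Y.1 :=
    (hasDerivAt_id _).prodMk (hasDerivAt_const _ _)
  have h2 : HasFDerivAt f (fderiv ℝ f Y) ((fun s : ℝ => (s, Y.2)) Y.1) := h.hasFDerivAt
  exact HasFDerivAt.comp_hasDerivAt (f := fun s : ℝ => (s, Y.2)) Y.1 h2 h1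

lemma hasDerivAt_partialZ {f : ℝ × ℝ → ℝ} {Y : ℝ × ℝ} (h : DifferentiableAt ℝ f Y) :
    HasDerivAt (fun s => f (Y.1, s)) (partialZ f Y) Y.2 := by
  have h1 : HasDerivAt (fun s : ℝ => (Y.1, s)) ((0 : ℝ), (1 : ℝ)) Y.2 :=
    (hasDerivAt_const _ _).prodMk (hasDerivAt_id _)
  have h2 : HasFDerivAt f (fderiv ℝ f Y) ((fun s : ℝ => (Y.1, s)) Y.2) := h.hasFDerivAt
  exact h2.comp_hasDerivAt _ h1

lemma partialR_eq_of_hasDerivAt {f : ℝ × ℝ → ℝ} {Y : ℝ × ℝ} {d : ℝ} (h : DifferentiableAt ℝ f Y)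
    (hd : HasDerivAt (fun s => f (s, Y.2)) d Y.1) : partialR f Y = d :=
  (hasDerivAt_partialR h).unique hd

lemma partialZ_eq_of_hasDerivAt {f : ℝ × ℝ → ℝ} {Y : ℝ × ℝ} {d : ℝ} (h : DifferentiableAt ℝ f Y)
    (hd : HasDerivAt (fun s => f (Y.1, s)) d Y.2) : partialZ f Y = d :=
  (hasDerivAt_partialZ h).unique hd

lemma partialR_mul {f g : ℝ × ℝ → ℝ} {Y : ℝ × ℝ} (hf : DifferentiableAt ℝ f Y)
    (hg : DifferentiableAt ℝ g Y) :
    partialR (fun Y => f Y * g Y) Y = partialR f Y * g Y + f Y * partialR g Y :=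
  partialR_eq_of_hasDerivAt (hf.mul hg) ((hasDerivAt_partialR hf).mul (hasDerivAt_partialR hg))

lemma partialZ_mul {f g : ℝ × ℝ → ℝ} {Y : ℝ × ℝ} (hf : DifferentiableAt ℝ f Y)
    (hg : DifferentiableAt ℝ g Y) :
    partialZ (fun Y => f Y * g Y) Y = partialZ f Y * g Y + f Y * partialZ g Y :=
  partialZ_eq_of_hasDerivAt (hf.mul hg) ((hasDerivAt_partialZ hf).mul (hasDerivAt_partialZ hg))

lemma ContDiffOn.partialR {f : ℝ × ℝ → ℝ} {O : Set (ℝ × ℝ)} {n m : ℕ∞} (hO : IsOpen O)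
    (hf : ContDiffOn ℝ n f O) (hmn : m + 1 ≤ n) : ContDiffOn ℝ m (partialR f) O :=
  (hf.fderiv_of_isOpen hO (by exact_mod_cast hmn)).clm_apply contDiffOn_const

lemma ContDiffOn.partialZ {f : ℝ × ℝ → ℝ} {O : Set (ℝ × ℝ)} {n m : ℕ∞} (hO : IsOpen O)
    (hf : ContDiffOn ℝ n f O) (hmn : m + 1 ≤ n) : ContDiffOn ℝ m (partialZ f) O :=
  (hf.fderiv_of_isOpen hO (by exact_mod_cast hmn)).clm_apply contDiffOn_const

lemma ContDiffOn.continuousOn_partialR {f : ℝ × ℝ → ℝ} {O : Set (ℝ × ℝ)} (hO : IsOpen O)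
    (hf : ContDiffOn ℝ 1 f O) : ContinuousOn (_root_.partialR f) O :=
  (ContDiffOn.partialR (n := 1) (m := 0) hO hf (by norm_num)).continuousOn

lemma ContDiffOn.continuousOn_partialZ {f : ℝ × ℝ → ℝ} {O : Set (ℝ × ℝ)} (hO : IsOpen O)
    (hf : ContDiffOn ℝ 1 f O) : ContinuousOn (_root_.partialZ f) O :=
  (ContDiffOn.partialZ (n := 1) (m := 0) hO hf (by norm_num)).continuousOn

lemma ContDiff.continuous_partialR {f : ℝ × ℝ → ℝ} (hf : ContDiff ℝ 1 f) :
    Continuous (_root_.partialR f) :=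
  continuousOn_univ.1 (ContDiffOn.continuousOn_partialR isOpen_univ hf.contDiffOn)

lemma ContDiff.continuous_partialZ {f : ℝ × ℝ → ℝ} (hf : ContDiff ℝ 1 f) :
    Continuous (_root_.partialZ f) :=
  continuousOn_univ.1 (ContDiffOn.continuousOn_partialZ isOpen_univ hf.contDiffOn)

lemma ContDiff.partialR {f : ℝ × ℝ → ℝ} (n : ℕ) (hf : ContDiff ℝ (n + 1 : ℕ) f) :
    ContDiff ℝ n (_root_.partialR f) :=
  contDiffOn_univ.1 (ContDiffOn.partialR (n := (n + 1 : ℕ)) (m := n) isOpen_univ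
    (by exact_mod_cast hf.contDiffOn) (by norm_num))

lemma ContDiff.partialZ {f : ℝ × ℝ → ℝ} (n : ℕ) (hf : ContDiff ℝ (n + 1 : ℕ) f) :
    ContDiff ℝ n (_root_.partialZ f) :=
  contDiffOn_univ.1 (ContDiffOn.partialZ (n := (n + 1 : ℕ)) (m := n) isOpen_univ
    (by exact_mod_cast hf.contDiffOn) (by norm_num))

/-- The cancellation behind the incompressibility of the velocity field, and behind the
Cauchy-Riemann equations for the gradient of a harmonic function. -/
lemma partialR_partialZ_comm {f : ℝ × ℝ → ℝ} {Y : ℝ × ℝ} (hf : ContDiffAt ℝ 2 f Y) :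
    partialR (partialZ f) Y = partialZ (partialR f) Y := by
  have hs : IsSymmSndFDerivAt ℝ f Y := hf.isSymmSndFDerivAt (by simp)
  have hd : DifferentiableAt ℝ (fderiv ℝ f) Y :=
    (hf.fderiv_right (m := 1) (by norm_num)).differentiableAt (by norm_num)
  have h1 : ∀ v w : ℝ × ℝ, fderiv ℝ (fun y => fderiv ℝ f y v) Y w
      = fderiv ℝ (fderiv ℝ f) Y w v := by
    intro v w
    rw [fderiv_clm_apply hd (by fun_prop)]
    simp
  unfold partialR partialZ
  rw [h1, h1]
  exact hs _ _

/-! ### Products with a cutoff -/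

section cutoff

variable {χ G : ℝ × ℝ → ℝ} {O : Set (ℝ × ℝ)}

lemma cutoff_mul_eventuallyEq_zero {Y : ℝ × ℝ} (hY : Y ∉ tsupport χ) :
    (fun y => χ y * G y) =ᶠ[𝓝 Y] fun _ => 0 := by
  filter_upwards [notMem_tsupport_iff_eventuallyEq.1 hY] with y hy
  simp [hy]

/-- `G` is regular only on `O`, but off the support of `χ` the product vanishes in a neighbourhood,
so nothing is required of `G` there. -/
lemma contDiff_cutoff_mul {n : ℕ∞} (hO : IsOpen O) (hχ : ContDiff ℝ n χ)
    (hs : tsupport χ ⊆ O) (hG : ContDiffOn ℝ n G O) : ContDiff ℝ n (fun Y => χ Y * G Y) := by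
  rw [contDiff_iff_contDiffAt]
  intro Y
  by_cases hY : Y ∈ tsupport χ
  · exact hχ.contDiffAt.mul (hG.contDiffAt (hO.mem_nhds (hs hY)))
  · exact (contDiffAt_const (c := (0 : ℝ))).congr_of_eventuallyEq (cutoff_mul_eventuallyEq_zero hY)

lemma continuous_cutoff_mul (hO : IsOpen O) (hχ : Continuous χ)
    (hs : tsupport χ ⊆ O) (hG : ContinuousOn G O) : Continuous (fun Y => χ Y * G Y) := by
  rw [continuous_iff_continuousAt]
  intro Y
  by_cases hY : Y ∈ tsupport χ
  · exact hχ.continuousAt.mul (hG.continuousAt (hO.mem_nhds (hs hY)))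
  · exact continuousAt_const.congr (cutoff_mul_eventuallyEq_zero hY).symm

lemma partialR_eq_zero_of_notMem {Y : ℝ × ℝ} (hY : Y ∉ tsupport χ) : partialR χ Y = 0 := by
  unfold partialR
  rw [(notMem_tsupport_iff_eventuallyEq.1 hY).fderiv_eq]
  simp

lemma partialZ_eq_zero_of_notMem {Y : ℝ × ℝ} (hY : Y ∉ tsupport χ) : partialZ χ Y = 0 := by
  unfold partialZ
  rw [(notMem_tsupport_iff_eventuallyEq.1 hY).fderiv_eq]
  simp

lemma tsupport_partialR_subset : tsupport (partialR χ) ⊆ tsupport χ :=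
  closure_minimal (fun Y hY => by
    by_contra h
    exact hY (partialR_eq_zero_of_notMem h)) (isClosed_tsupport _)

lemma tsupport_partialZ_subset : tsupport (partialZ χ) ⊆ tsupport χ :=
  closure_minimal (fun Y hY => by
    by_contra h
    exact hY (partialZ_eq_zero_of_notMem h)) (isClosed_tsupport _)

/-- The product rule holds at every point of the plane, since both sides vanish off the support of
`χ`, whatever junk value the derivative of `G` takes there. -/
lemma partialR_cutoff_mul (hO : IsOpen O) (hχ : ContDiff ℝ 1 χ)
    (hs : tsupport χ ⊆ O) (hG : ContDiffOn ℝ 1 G O) (Y : ℝ × ℝ) :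
    partialR (fun Y => χ Y * G Y) Y = partialR χ Y * G Y + χ Y * partialR G Y := by
  by_cases hY : Y ∈ tsupport χ
  · exact partialR_mul (hχ.differentiable (by norm_num) Y)
      ((hG.contDiffAt (hO.mem_nhds (hs hY))).differentiableAt (by norm_num))
  · rw [partialR_eq_zero_of_notMem hY, image_eq_zero_of_notMem_tsupport hY]
    unfold partialR
    rw [(cutoff_mul_eventuallyEq_zero hY).fderiv_eq]
    simp

lemma partialZ_cutoff_mul (hO : IsOpen O) (hχ : ContDiff ℝ 1 χ)
    (hs : tsupport χ ⊆ O) (hG : ContDiffOn ℝ 1 G O) (Y : ℝ × ℝ) :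
    partialZ (fun Y => χ Y * G Y) Y = partialZ χ Y * G Y + χ Y * partialZ G Y := by
  by_cases hY : Y ∈ tsupport χ
  · exact partialZ_mul (hχ.differentiable (by norm_num) Y)
      ((hG.contDiffAt (hO.mem_nhds (hs hY))).differentiableAt (by norm_num))
  · rw [partialZ_eq_zero_of_notMem hY, image_eq_zero_of_notMem_tsupport hY]
    unfold partialZ
    rw [(cutoff_mul_eventuallyEq_zero hY).fderiv_eq]
    simp

end cutoff

/-! ### Integration by parts -/

/-- Integration by parts against the constant function `1`. -/
lemma integral_fderiv_eq_zero {η : ℝ × ℝ → ℝ} (hη : ContDiff ℝ 1 η) (hc : HasCompactSupport η)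
    (v : ℝ × ℝ) : ∫ Y, fderiv ℝ η Y v = 0 := by
  have hi : Integrable (fun Y => fderiv ℝ η Y v) :=
    ((hη.continuous_fderiv (by norm_num)).clm_apply continuous_const).integrable_of_hasCompactSupport
      (hc.fderiv_apply ℝ v)
  have h := integral_mul_fderiv_eq_neg_fderiv_mul_of_integrable (𝕜 := ℝ) (μ := volume)
    (f := fun _ : ℝ × ℝ => (1 : ℝ)) (g := η) (v := v) (by simp) (by simpa using hi)
    (by simpa using hη.continuous.integrable_of_hasCompactSupport hc)
    (fun _ _ => by fun_prop) (fun x _ => hη.differentiable (by norm_num) x)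
  simpa using h

lemma integral_partialR_eq_zero {η : ℝ × ℝ → ℝ} (hη : ContDiff ℝ 1 η)
    (hc : HasCompactSupport η) : ∫ Y, partialR η Y = 0 := integral_fderiv_eq_zero hη hc _

lemma integral_partialZ_eq_zero {η : ℝ × ℝ → ℝ} (hη : ContDiff ℝ 1 η)
    (hc : HasCompactSupport η) : ∫ Y, partialZ η Y = 0 := integral_fderiv_eq_zero hη hc _

lemma integrable_partialR {η : ℝ × ℝ → ℝ} (hη : ContDiff ℝ 1 η)
    (hc : HasCompactSupport η) : Integrable (partialR η) :=
  hη.continuous_partialR.integrable_of_hasCompactSupport (hc.mono' (by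
    exact (subset_tsupport _).trans tsupport_partialR_subset))

lemma integrable_partialZ {η : ℝ × ℝ → ℝ} (hη : ContDiff ℝ 1 η)
    (hc : HasCompactSupport η) : Integrable (partialZ η) :=
  hη.continuous_partialZ.integrable_of_hasCompactSupport (hc.mono' (by
    exact (subset_tsupport _).trans tsupport_partialZ_subset))

/-- The divergence of a compactly supported `C¹` field has integral zero. -/
lemma integral_divergence_eq_zero {η₁ η₂ : ℝ × ℝ → ℝ} (h₁ : ContDiff ℝ 1 η₁)
    (h₂ : ContDiff ℝ 1 η₂) (hc₁ : HasCompactSupport η₁) (hc₂ : HasCompactSupport η₂) :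
    ∫ Y, (partialR η₁ Y + partialZ η₂ Y) = 0 := by
  rw [integral_add (integrable_partialR h₁ hc₁) (integrable_partialZ h₂ hc₂),
    integral_partialR_eq_zero h₁ hc₁, integral_partialZ_eq_zero h₂ hc₂, add_zero]

/-- A smooth cutoff between a compact set and an open neighbourhood of it. -/
lemma exists_smooth_cutoff {K O : Set (ℝ × ℝ)} (hK : IsCompact K) (hO : IsOpen O) (hKO : K ⊆ O) :
    ∃ χ : ℝ × ℝ → ℝ, ContDiff ℝ (⊤ : ℕ∞) χ ∧ HasCompactSupport χ ∧ tsupport χ ⊆ O ∧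
      (∀ Y, 0 ≤ χ Y ∧ χ Y ≤ 1) ∧ ∀ᶠ Y in 𝓝ˢ K, χ Y = 1 := by
  obtain ⟨L, hL, hKL, hLO⟩ := exists_compact_between hK hO hKO
  obtain ⟨f, hf1, hf0, hf⟩ := exists_contMDiffMap_one_nhds_of_subset_interior
    (modelWithCornersSelf ℝ (ℝ × ℝ)) (n := (⊤ : ℕ∞)) hK.isClosed hKL
  have hs : tsupport f ⊆ L := closure_minimal (fun Y hY => by
    by_contra h
    exact hY (hf0 Y h)) hL.isClosed
  exact ⟨f, f.contMDiff.contDiff, hL.of_isClosed_subset (isClosed_tsupport _) hs, hs.trans hLO,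
    fun Y => hf Y, hf1⟩

/-! ### Power series with coefficients depending on a point of the plane -/

/-- The sum `∑ x^k U_k(Y)`. -/
def profileSeries (U : ℕ → ℝ × ℝ → ℝ) (x : ℝ) (Y : ℝ × ℝ) : ℝ := ∑' k, x ^ k * U k Y

/-- The Euler derivative `x ∂ₓ ∑ x^k U_k(Y)`. -/
def profileSeriesEuler (U : ℕ → ℝ × ℝ → ℝ) (x : ℝ) (Y : ℝ × ℝ) : ℝ :=
  ∑' k : ℕ, x ^ k * (k * U k Y)

lemma summable_linear_mul_geometric (m : ℕ) :
    Summable (fun j : ℕ => ((j : ℝ) + m) * (1 / 2 : ℝ) ^ j) := by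
  have h1 : Summable (fun j : ℕ => (j : ℝ) * (1 / 2 : ℝ) ^ j) := by
    simpa using summable_pow_mul_geometric_of_norm_lt_one 1 (r := (1 / 2 : ℝ)) (by norm_num)
  have h2 : Summable (fun j : ℕ => (m : ℝ) * (1 / 2 : ℝ) ^ j) :=
    (summable_geometric_of_lt_one (by norm_num) (by norm_num)).mul_left _
  exact (h1.add h2).congr fun j => by ring

/-- The remainder is `x^(k+1)` times a series dominated by a geometric one of ratio `1/2`, because
`x ≤ x₀ / 2`. Linear growth in `j` is allowed so that the estimate also covers the Euler derivative,
whose coefficients are multiplied by `j`. -/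
lemma tsum_sub_leading_le {c : ℕ → ℝ} {k : ℕ} {C x₀ x : ℝ} (hx₀ : 0 < x₀) (hx : 0 < x)
    (hxx : x ≤ x₀ / 2) (hc : ∀ j, |c j| * x₀ ^ j ≤ C * (j + 1)) (hz : ∀ j < k, c j = 0) :
    |(∑' j, x ^ j * c j) - x ^ k * c k| ≤
      (C * (∑' j : ℕ, ((j : ℝ) + (k + 2 : ℕ)) * (1 / 2 : ℝ) ^ j) / x₀ ^ (k + 1)) * x ^ (k + 1) := by
  have hC : 0 ≤ C := by
    have := (mul_nonneg (abs_nonneg (c 0)) (pow_nonneg hx₀.le 0)).trans (hc 0)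
    simpa using this
  have hb : ∀ n : ℕ, ∀ j : ℕ, ‖x ^ (j + n) * c (j + n)‖ ≤
      (C / x₀ ^ n * x ^ n) * (((j : ℝ) + (n + 1 : ℕ)) * (1 / 2 : ℝ) ^ j) := by
    intro n j
    have h1 : |c (j + n)| ≤ C * ((j + n : ℕ) + 1) / x₀ ^ (j + n) := by
      rw [le_div_iff₀ (by positivity)]; exact hc _
    have h2 : x ^ j ≤ (1 / 2) ^ j * x₀ ^ j := by
      rw [← mul_pow]; exact pow_le_pow_left₀ hx.le (by linarith) j
    rw [norm_mul, Real.norm_eq_abs, Real.norm_eq_abs, abs_of_nonneg (by positivity)]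
    calc x ^ (j + n) * |c (j + n)| ≤ x ^ (j + n) * (C * ((j + n : ℕ) + 1) / x₀ ^ (j + n)) := by
          gcongr
      _ = x ^ j * (x ^ n * (C * ((j + n : ℕ) + 1) / x₀ ^ (j + n))) := by rw [pow_add]; ring
      _ ≤ ((1 / 2) ^ j * x₀ ^ j) * (x ^ n * (C * ((j + n : ℕ) + 1) / x₀ ^ (j + n))) := by
          gcongr
      _ = _ := by
          rw [pow_add]; field_simp; push_cast; ring
  have hs : Summable (fun j => x ^ j * c j) :=
    Summable.of_norm_bounded ((summable_linear_mul_geometric 1).mul_left (C / x₀ ^ 0 * x ^ 0))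
      (fun j => by simpa using hb 0 j)
  have h0 : ∑ j ∈ Finset.range (k + 1), x ^ j * c j = x ^ k * c k := by
    rw [Finset.sum_range_succ, Finset.sum_eq_zero, zero_add]
    intro j hj
    rw [hz j (Finset.mem_range.1 hj), mul_zero]
  have h3 := hs.sum_add_tsum_nat_add (k + 1)
  rw [h0] at h3
  rw [← h3, add_sub_cancel_left, ← Real.norm_eq_abs]
  refine (tsum_of_norm_bounded ((summable_linear_mul_geometric (k + 2)).mul_left
    (C / x₀ ^ (k + 1) * x ^ (k + 1))).hasSum (fun j => hb (k + 1) j)).trans_eq ?_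
  rw [tsum_mul_left]; ring

lemma profileSeries_sub_leading_le {U : ℕ → ℝ × ℝ → ℝ} {K : Set (ℝ × ℝ)} {x₀ C : ℝ} (hx₀ : 0 < x₀)
    (h : ∀ k, ∀ Y ∈ K, |U k Y| * x₀ ^ k ≤ C) (k : ℕ) (hz : ∀ j < k, ∀ Y ∈ K, U j Y = 0) :
    ∃ C' : ℝ, ∀ x : ℝ, 0 < x → x ≤ x₀ / 2 → ∀ Y ∈ K,
      |profileSeries U x Y - x ^ k * U k Y| ≤ C' * x ^ (k + 1) ∧
      |profileSeriesEuler U x Y - x ^ k * (k * U k Y)| ≤ C' * x ^ (k + 1) := by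
  refine ⟨C * (∑' j : ℕ, ((j : ℝ) + (k + 2 : ℕ)) * (1 / 2 : ℝ) ^ j) / x₀ ^ (k + 1),
    fun x hx hxx Y hY => ⟨?_, ?_⟩⟩
  · refine tsum_sub_leading_le (c := fun j => U j Y) hx₀ hx hxx (fun j => ?_) (fun j hj => hz j hj Y hY)
    have h1 := h j Y hY
    have h2 : 0 ≤ |U j Y| * x₀ ^ j := by positivity
    nlinarith [(Nat.cast_nonneg j : (0 : ℝ) ≤ j)]
  · refine tsum_sub_leading_le (c := fun j => (j : ℝ) * U j Y) hx₀ hx hxx (fun j => ?_)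
      (fun j hj => by simp [hz j hj Y hY])
    have h1 := h j Y hY
    have h2 : 0 ≤ |U j Y| * x₀ ^ j := by positivity
    rw [abs_mul, abs_of_nonneg (Nat.cast_nonneg j : (0 : ℝ) ≤ j)]
    nlinarith [(Nat.cast_nonneg j : (0 : ℝ) ≤ j)]

/-- Termwise differentiation on an interval `(0, y)` with `x < y < x₀`, where the differentiated
terms are dominated by `n (y / x₀)^n`. -/
lemma hasDerivAt_tsum_pow {c : ℕ → ℝ} {C x₀ x : ℝ} (hx : 0 < x) (hxx : x < x₀)
    (hc : ∀ j, |c j| * x₀ ^ j ≤ C) :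
    HasDerivAt (fun s : ℝ => ∑' k, s ^ k * c k) (x⁻¹ * ∑' k : ℕ, x ^ k * (k * c k)) x := by
  obtain ⟨y, hxy, hyx⟩ := exists_between hxx
  have hx₀ : 0 < x₀ := hx.trans hxx
  have hy : 0 < y := hx.trans hxy
  have hcj : ∀ j, |c j| ≤ C / x₀ ^ j := fun j => by
    rw [le_div_iff₀ (by positivity)]; exact hc j
  have hr : ‖y / x₀‖ < 1 := by
    rw [Real.norm_eq_abs, abs_of_pos (by positivity), div_lt_one hx₀]; exact hyx
  have hu : Summable (fun n : ℕ => (C / y) * ((n : ℝ) * (y / x₀) ^ n)) := by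
    have := summable_pow_mul_geometric_of_norm_lt_one 1 hr
    exact (by simpa using this : Summable (fun n : ℕ => (n : ℝ) * (y / x₀) ^ n)).mul_left _
  have hd := hasDerivAt_tsum_of_isPreconnected (t := Ioo 0 y) (g := fun (n : ℕ) (s : ℝ) => s ^ n * c n)
    (g' := fun (n : ℕ) (s : ℝ) => ((n : ℝ) * s ^ (n - 1)) * c n) (y₀ := x) (y := x) hu isOpen_Ioo
    isPreconnected_Ioo (fun n s _ => (hasDerivAt_pow n s).mul_const _) ?_ ⟨hx, hxy⟩ ?_ ⟨hx, hxy⟩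
  · have e : x⁻¹ * ∑' k : ℕ, x ^ k * (k * c k) = ∑' n : ℕ, (n : ℝ) * x ^ (n - 1) * c n := by
      rw [← tsum_mul_left]
      refine tsum_congr fun n => ?_
      rcases n with _ | n
      · simp
      · simp only [Nat.add_sub_cancel, pow_succ]; field_simp
    rw [e]
    exact hd
  · intro n s hs
    rcases n with _ | n
    · simp
    · simp only [Nat.add_sub_cancel]
      rw [norm_mul, norm_mul, Real.norm_eq_abs, Real.norm_eq_abs, Real.norm_eq_abs,
        abs_of_nonneg (by positivity : (0 : ℝ) ≤ ((n + 1 : ℕ) : ℝ)),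
        abs_of_nonneg (pow_nonneg hs.1.le _)]
      have hp : s ^ n ≤ y ^ n := pow_le_pow_left₀ hs.1.le hs.2.le n
      have hC : 0 ≤ C / x₀ ^ (n + 1) := (abs_nonneg _).trans (hcj (n + 1))
      calc ((n + 1 : ℕ) : ℝ) * s ^ n * |c (n + 1)|
          ≤ ((n + 1 : ℕ) : ℝ) * y ^ n * (C / x₀ ^ (n + 1)) := by
            gcongr
            exact hcj _
        _ = _ := by rw [div_pow, pow_succ y]; field_simp
  · have hr' : ‖x / x₀‖ < 1 := by
      rw [Real.norm_eq_abs, abs_of_pos (by positivity), div_lt_one hx₀]; exact hxx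
    refine Summable.of_norm_bounded ((summable_geometric_of_norm_lt_one hr').mul_left C) fun n => ?_
    rw [norm_mul, Real.norm_eq_abs, Real.norm_eq_abs, abs_of_nonneg (by positivity), div_pow]
    calc x ^ n * |c n| ≤ x ^ n * (C / x₀ ^ n) := by gcongr; exact hcj n
      _ = _ := by ring

/-! ### Energy estimate for the rescaled stream function. -/

lemma HasCompactSupport.of_eq_zero {f g : ℝ × ℝ → ℝ} (hf : HasCompactSupport f)
    (h : ∀ Y, Y ∉ tsupport f → g Y = 0) : HasCompactSupport g :=
  hf.mono' fun Y hY => by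
    by_contra hn
    exact hY (h Y hn)

/-- Caccioppoli's inequality for the rescaled stream function equation. -/
lemma caccioppoli {O : Set (ℝ × ℝ)} (hO : IsOpen O) {κ F W : ℝ × ℝ → ℝ} {x A B D : ℝ}
    (hκ : ContDiff ℝ 1 κ) (hκc : HasCompactSupport κ) (hκO : tsupport κ ⊆ O)
    (hF : ContDiffOn ℝ 2 F O) (hx : 0 < x) (hx1 : x ≤ 1)
    (hpos : ∀ Y ∈ O, 1 / 2 ≤ 1 + x * Y.1)
    (heq : ∀ Y ∈ O, -(partialR (partialR F) Y + 3 * x / (1 + x * Y.1) * partialR F Y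
      + partialZ (partialZ F) Y) = W Y)
    (hA : ∀ Y ∈ tsupport κ, |F Y| ≤ A) (hB : ∀ Y ∈ tsupport κ, |W Y| ≤ B)
    (hD : ∀ Y, |κ Y| ≤ D ∧ |partialR κ Y| ≤ D ∧ |partialZ κ Y| ≤ D) :
    Integrable (fun Y => κ Y ^ 2 * (partialR F Y ^ 2 + partialZ F Y ^ 2)) ∧
    ∫ Y, κ Y ^ 2 * (partialR F Y ^ 2 + partialZ F Y ^ 2) ≤
      (2 * D ^ 2 * A * B + 88 * D ^ 2 * A ^ 2) * volume.real (tsupport κ) := by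
  have hF1 : ContDiffOn ℝ 1 F O := hF.of_le (by norm_num)
  have hFR : ContDiffOn ℝ 1 (partialR F) O :=
    ContDiffOn.partialR (n := 2) (m := 1) hO hF (by norm_num)
  have hFZ : ContDiffOn ℝ 1 (partialZ F) O :=
    ContDiffOn.partialZ (n := 2) (m := 1) hO hF (by norm_num)
  have hdiff : ∀ {G : ℝ × ℝ → ℝ}, ContDiffOn ℝ 1 G O → ∀ Y ∈ O, DifferentiableAt ℝ G Y :=
    fun hG Y hY => (hG.contDiffAt (hO.mem_nhds hY)).differentiableAt (by norm_num)
  have hκκ : ContDiffOn ℝ 1 κ O := hκ.contDiffOn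
  have hG₁ : ContDiffOn ℝ 1 (fun Y => κ Y * (F Y * partialR F Y)) O := hκκ.mul (hF1.mul hFR)
  have hG₂ : ContDiffOn ℝ 1 (fun Y => κ Y * (F Y * partialZ F Y)) O := hκκ.mul (hF1.mul hFZ)
  have h₁ := contDiff_cutoff_mul (n := 1) hO hκ hκO hG₁
  have h₂ := contDiff_cutoff_mul (n := 1) hO hκ hκO hG₂
  have c₁ : HasCompactSupport (fun Y => κ Y * (κ Y * (F Y * partialR F Y))) := hκc.mul_right
  have c₂ : HasCompactSupport (fun Y => κ Y * (κ Y * (F Y * partialZ F Y))) := hκc.mul_right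
  have hdiv := integral_divergence_eq_zero h₁ h₂ c₁ c₂
  have hcont : Continuous (fun Y => κ Y ^ 2 * (partialR F Y ^ 2 + partialZ F Y ^ 2)) := by
    have := continuous_cutoff_mul hO hκ.continuous hκO (G := fun Y =>
      κ Y * (partialR F Y ^ 2 + partialZ F Y ^ 2)) (by
        exact hκκ.continuousOn.mul ((hFR.continuousOn.pow 2).add (hFZ.continuousOn.pow 2)))
    exact this.congr fun Y => by ring
  have hint : Integrable (fun Y => κ Y ^ 2 * (partialR F Y ^ 2 + partialZ F Y ^ 2)) :=
    hcont.integrable_of_hasCompactSupport (hκc.of_eq_zero fun Y hY => by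
      simp [image_eq_zero_of_notMem_tsupport hY])
  refine ⟨hint, ?_⟩
  -- The drift coefficient `q = 3x / (1 + xR)` satisfies `|q| ≤ 6`. Completing squares costs
  -- `2κ²F²q² + 8F²|∇κ|²`, which accounts for `88 = 2 · 36 + 8 + 8`; the other summand bounds
  -- `2κ²FW`.
  set M := 2 * D ^ 2 * A * B + 88 * D ^ 2 * A ^ 2 with hM
  have hind : Integrable ((tsupport κ).indicator fun _ : ℝ × ℝ => M) :=
    (integrable_indicator_iff (isClosed_tsupport κ).measurableSet).2
      (integrableOn_const hκc.isCompact.measure_lt_top.ne)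
  have hdi := (integrable_partialR h₁ c₁).add (integrable_partialZ h₂ c₂)
  -- The vector field is `κ² F ∇F`. Twice its divergence contains `2κ²|∇F|²`; one half is kept as
  -- the energy, the other half absorbs the cross terms.
  have key : ∀ Y, κ Y ^ 2 * (partialR F Y ^ 2 + partialZ F Y ^ 2) ≤
      2 * (partialR (fun Y => κ Y * (κ Y * (F Y * partialR F Y))) Y +
        partialZ (fun Y => κ Y * (κ Y * (F Y * partialZ F Y))) Y)
      + (tsupport κ).indicator (fun _ => M) Y := by
    intro Y
    rw [partialR_cutoff_mul hO hκ hκO hG₁, partialZ_cutoff_mul hO hκ hκO hG₂]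
    by_cases hY : Y ∈ tsupport κ
    · have hYO := hκO hY
      rw [indicator_of_mem hY, partialR_mul (hdiff hκκ Y hYO) (hdiff (hF1.mul hFR) Y hYO),
        partialR_mul (hdiff hF1 Y hYO) (hdiff hFR Y hYO),
        partialZ_mul (hdiff hκκ Y hYO) (hdiff (hF1.mul hFZ) Y hYO),
        partialZ_mul (hdiff hF1 Y hYO) (hdiff hFZ Y hYO)]
      have e := heq Y hYO
      have hp := hpos Y hYO
      obtain ⟨hd1, hd2, hd3⟩ := hD Y
      have hq : |3 * x / (1 + x * Y.1)| ≤ 6 := by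
        rw [abs_of_nonneg (by positivity), div_le_iff₀ (by linarith)]; linarith
      generalize 3 * x / (1 + x * Y.1) = q at *
      have hA' := hA Y hY
      have hB' := hB Y hY
      generalize hRR : partialR (partialR F) Y = FRR at *
      generalize hZZ : partialZ (partialZ F) Y = FZZ at *
      generalize partialR F Y = FR at *
      generalize partialZ F Y = FZ at *
      generalize partialR κ Y = kR at *
      generalize partialZ κ Y = kZ at *
      generalize F Y = f at *
      generalize W Y = w at *
      generalize κ Y = k at *
      have hA0 : 0 ≤ A := (abs_nonneg _).trans hA'
      have hD0 : 0 ≤ D := (abs_nonneg _).trans hd1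
      have b1 : k ^ 2 * (f * w) ≤ D ^ 2 * (A * B) := by
        have : |f * w| ≤ A * B := by rw [abs_mul]; gcongr
        have h2 : k ^ 2 ≤ D ^ 2 := sq_le_sq' (by linarith [abs_le.1 hd1]) (abs_le.1 hd1).2
        calc k ^ 2 * (f * w) ≤ k ^ 2 * |f * w| := by gcongr; exact le_abs_self _
          _ ≤ D ^ 2 * (A * B) := by gcongr
      have s1 : k ^ 2 * f ^ 2 * q ^ 2 ≤ D ^ 2 * A ^ 2 * 36 := by
        have h2 : k ^ 2 ≤ D ^ 2 := sq_le_sq' (by linarith [abs_le.1 hd1]) (abs_le.1 hd1).2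
        have h3 : f ^ 2 ≤ A ^ 2 := sq_le_sq' (by linarith [abs_le.1 hA']) (abs_le.1 hA').2
        have h4 : q ^ 2 ≤ 36 := by nlinarith [abs_le.1 hq]
        gcongr
      have s2 : f ^ 2 * kR ^ 2 ≤ A ^ 2 * D ^ 2 := by
        have h2 : kR ^ 2 ≤ D ^ 2 := sq_le_sq' (by linarith [abs_le.1 hd2]) (abs_le.1 hd2).2
        have h3 : f ^ 2 ≤ A ^ 2 := sq_le_sq' (by linarith [abs_le.1 hA']) (abs_le.1 hA').2
        gcongr
      have s3 : f ^ 2 * kZ ^ 2 ≤ A ^ 2 * D ^ 2 := by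
        have h2 : kZ ^ 2 ≤ D ^ 2 := sq_le_sq' (by linarith [abs_le.1 hd3]) (abs_le.1 hd3).2
        have h3 : f ^ 2 ≤ A ^ 2 := sq_le_sq' (by linarith [abs_le.1 hA']) (abs_le.1 hA').2
        gcongr
      have e' : FRR = -w - q * FR - FZZ := by linarith
      subst e'
      -- The equation has removed the Laplacian, and two copies of each of the first three squares
      -- supply the cross terms exactly.
      nlinarith [sq_nonneg (k * FR / 2 - k * f * q), sq_nonneg (k * FR / 2 + 2 * f * kR),
        sq_nonneg (k * FZ / 2 + 2 * f * kZ), sq_nonneg (k * FZ)]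
    · simp [image_eq_zero_of_notMem_tsupport hY, partialR_eq_zero_of_notMem hY,
        partialZ_eq_zero_of_notMem hY, indicator_of_notMem hY]
  calc ∫ Y, κ Y ^ 2 * (partialR F Y ^ 2 + partialZ F Y ^ 2)
      ≤ ∫ Y, (2 * (partialR (fun Y => κ Y * (κ Y * (F Y * partialR F Y))) Y +
        partialZ (fun Y => κ Y * (κ Y * (F Y * partialZ F Y))) Y)
      + (tsupport κ).indicator (fun _ => M) Y) :=
        integral_mono hint ((hdi.const_mul 2).add hind) key
    _ = 2 * (∫ Y, (partialR (fun Y => κ Y * (κ Y * (F Y * partialR F Y))) Y +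
        partialZ (fun Y => κ Y * (κ Y * (F Y * partialZ F Y))) Y))
        + ∫ Y, (tsupport κ).indicator (fun _ => M) Y := by
        rw [← integral_const_mul]
        exact integral_add (hdi.const_mul 2) hind
    _ = M * volume.real (tsupport κ) := by
        rw [hdiv, integral_indicator_const _ (isClosed_tsupport κ).measurableSet, smul_eq_mul]
        ring

/-! ### Limits of integrals and uniform bounds. -/

lemma tendsto_integral_of_uniform_compact_support {ι : Type*} {l : Filter ι} [l.IsCountablyGenerated]
    {K : Set (ℝ × ℝ)} (hK : IsCompact K) {h : ι → ℝ × ℝ → ℝ} {h₀ : ℝ × ℝ → ℝ} {C : ℝ}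
    (hc : ∀ᶠ i in l, Continuous (h i)) (hz : ∀ᶠ i in l, ∀ Y ∉ K, h i Y = 0)
    (hz₀ : ∀ Y ∉ K, h₀ Y = 0)
    (hb : ∀ᶠ i in l, ∀ Y ∈ K, |h i Y| ≤ C) (hlim : ∀ Y ∈ K, Tendsto (fun i => h i Y) l (𝓝 (h₀ Y))) :
    Tendsto (fun i => ∫ Y, h i Y) l (𝓝 (∫ Y, h₀ Y)) := by
  refine tendsto_integral_filter_of_dominated_convergence (K.indicator fun _ => C) ?_ ?_ ?_ ?_
  · filter_upwards [hc] with i hi using hi.aestronglyMeasurable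
  · filter_upwards [hz, hb] with i h1 h2
    refine Eventually.of_forall fun Y => ?_
    by_cases hY : Y ∈ K
    · rw [indicator_of_mem hY]; exact h2 Y hY
    · rw [indicator_of_notMem hY, h1 Y hY]; simp
  · exact (integrable_indicator_iff hK.measurableSet).2 (integrableOn_const hK.measure_lt_top.ne)
  · refine Eventually.of_forall fun Y => ?_
    by_cases hY : Y ∈ K
    · exact hlim Y hY
    · rw [hz₀ Y hY]
      refine tendsto_const_nhds.congr' ?_
      filter_upwards [hz] with i hi
      rw [hi Y hY]

lemma exists_forall_abs_le {K : Set (ℝ × ℝ)} (hK : IsCompact K) {f : ℝ × ℝ → ℝ}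
    (hf : ContinuousOn f K) : ∃ C, 0 ≤ C ∧ ∀ Y ∈ K, |f Y| ≤ C := by
  obtain ⟨C, hC⟩ := hK.exists_bound_of_continuousOn hf
  exact ⟨max C 0, le_max_right _ _, fun Y hY => (hC Y hY).trans (le_max_left _ _)⟩

lemma exists_forall_abs_le_of_hasCompactSupport {f : ℝ × ℝ → ℝ} (hf : Continuous f)
    (hc : HasCompactSupport f) : ∃ C, 0 ≤ C ∧ ∀ Y, |f Y| ≤ C := by
  obtain ⟨C, h0, hC⟩ := exists_forall_abs_le hc.isCompact hf.continuousOn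
  refine ⟨C, h0, fun Y => ?_⟩
  by_cases hY : Y ∈ tsupport f
  · exact hC Y hY
  · rw [image_eq_zero_of_notMem_tsupport hY]; simpa using h0

/-- A common bound for a compactly supported `C¹` function and its partial derivatives. -/
lemma exists_C1_bound {χ : ℝ × ℝ → ℝ} (h : ContDiff ℝ 1 χ) (hc : HasCompactSupport χ) :
    ∃ D, 0 ≤ D ∧ ∀ Y, |χ Y| ≤ D ∧ |partialR χ Y| ≤ D ∧ |partialZ χ Y| ≤ D := by
  obtain ⟨a, ha, hA⟩ := exists_forall_abs_le_of_hasCompactSupport h.continuous hc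
  obtain ⟨b, hb, hB⟩ := exists_forall_abs_le_of_hasCompactSupport h.continuous_partialR
    (hc.of_eq_zero fun Y => partialR_eq_zero_of_notMem)
  obtain ⟨c, hc', hC⟩ := exists_forall_abs_le_of_hasCompactSupport h.continuous_partialZ
    (hc.of_eq_zero fun Y => partialZ_eq_zero_of_notMem)
  exact ⟨a + b + c, by positivity, fun Y =>
    ⟨by linarith [hA Y], by linarith [hB Y], by linarith [hC Y]⟩⟩

/-! ### Stream families and the weak limit of transport equations. -/

/-- A family of rescaled stream functions `F x` with vorticities `W x`, which converges to the
leading profile `Ψ` as the parameter `x` tends to zero along `l`. -/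
structure StreamFamily (l : Filter ℝ) (O : Set (ℝ × ℝ)) (F W : ℝ → ℝ × ℝ → ℝ)
    (Ψ : ℝ × ℝ → ℝ) : Prop where
  isOpen : IsOpen O
  le_nhds : l ≤ 𝓝[>] 0
  pos : ∀ᶠ x in l, ∀ Y ∈ O, 1 / 2 ≤ 1 + x * Y.1
  contDiffOn : ∀ᶠ x in l, ContDiffOn ℝ 2 (F x) O
  contDiffOn_limit : ContDiffOn ℝ 1 Ψ O
  eq : ∀ᶠ x in l, ∀ Y ∈ O, -(partialR (partialR (F x)) Y
    + 3 * x / (1 + x * Y.1) * partialR (F x) Y + partialZ (partialZ (F x)) Y) = W x Y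
  near : ∀ K ⊆ O, IsCompact K → ∃ C, ∀ᶠ x in l, ∀ Y ∈ K, |F x Y - Ψ Y| ≤ C * x
  bound : ∀ K ⊆ O, IsCompact K → ∃ C, ∀ᶠ x in l, ∀ Y ∈ K, |W x Y| ≤ C

namespace StreamFamily

variable {l : Filter ℝ} {O : Set (ℝ × ℝ)} {F W : ℝ → ℝ × ℝ → ℝ} {Ψ : ℝ × ℝ → ℝ}

lemma eventually_small (h : StreamFamily l O F W Ψ) : ∀ᶠ x in l, 0 < x ∧ x ≤ 1 := by
  refine h.le_nhds ?_
  filter_upwards [self_mem_nhdsWithin, mem_nhdsWithin_of_mem_nhds (Iic_mem_nhds zero_lt_one)]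
    with x h1 h2 using ⟨h1, h2⟩

lemma tendsto_zero (h : StreamFamily l O F W Ψ) : Tendsto (fun x => x) l (𝓝 (0 : ℝ)) :=
  h.le_nhds.trans nhdsWithin_le_nhds

lemma bounded (h : StreamFamily l O F W Ψ) {K : Set (ℝ × ℝ)} (hK : IsCompact K) (hKO : K ⊆ O) :
    ∃ A, 0 ≤ A ∧ ∀ᶠ x in l, ∀ Y ∈ K, |F x Y| ≤ A := by
  obtain ⟨C, hC⟩ := h.near K hKO hK
  obtain ⟨B, hB0, hB⟩ := exists_forall_abs_le hK (h.contDiffOn_limit.continuousOn.mono hKO)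
  refine ⟨B + |C|, by positivity, ?_⟩
  filter_upwards [hC, h.eventually_small] with x hx h1 Y hY
  have e1 := hx Y hY
  have e2 := hB Y hY
  have e3 : C * x ≤ |C| := by
    calc C * x ≤ |C| * x := mul_le_mul_of_nonneg_right (le_abs_self C) h1.1.le
      _ ≤ |C| := mul_le_of_le_one_right (abs_nonneg _) h1.2
  calc |F x Y| = |Ψ Y + (F x Y - Ψ Y)| := by ring_nf
    _ ≤ |Ψ Y| + |F x Y - Ψ Y| := abs_add_le _ _
    _ ≤ _ := by linarith

/-- The constants in Caccioppoli's inequality do not depend on `x`. This is the only control of the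
gradients of `F x` along the filter: `near` compares values and not derivatives. -/
lemma energy_bounded (h : StreamFamily l O F W Ψ) {κ : ℝ × ℝ → ℝ} (hκ : ContDiff ℝ 1 κ)
    (hκc : HasCompactSupport κ) (hκO : tsupport κ ⊆ O) :
    ∃ C, ∀ᶠ x in l, Integrable (fun Y => κ Y ^ 2 * (partialR (F x) Y ^ 2 + partialZ (F x) Y ^ 2)) ∧
      ∫ Y, κ Y ^ 2 * (partialR (F x) Y ^ 2 + partialZ (F x) Y ^ 2) ≤ C := by
  obtain ⟨A, hA0, hA⟩ := h.bounded hκc.isCompact hκO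
  obtain ⟨B, hB⟩ := h.bound _ hκO hκc.isCompact
  obtain ⟨D, hD0, hD⟩ := exists_C1_bound hκ hκc
  refine ⟨(2 * D ^ 2 * A * B + 88 * D ^ 2 * A ^ 2) * volume.real (tsupport κ), ?_⟩
  filter_upwards [hA, hB, h.eventually_small, h.pos, h.contDiffOn, h.eq] with x h1 h2 h3 h4 h5 h6
  exact caccioppoli h.isOpen hκ hκc hκO h5 h3.1 h3.2 h4 h6 h1 h2 hD

end StreamFamily

/-- The field `(ψ₂ F, -ψ₁ F)` has integral of its divergence zero. No derivative falls on `F` on the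
right, so uniform convergence of stream functions is enough to pass to the limit on the left. -/
lemma integral_stream_flux {O : Set (ℝ × ℝ)} (hO : IsOpen O) {F ψ₁ ψ₂ : ℝ × ℝ → ℝ}
    (hF : ContDiffOn ℝ 1 F O) (h₁ : ContDiff ℝ 1 ψ₁) (h₂ : ContDiff ℝ 1 ψ₂)
    (c₁ : HasCompactSupport ψ₁) (c₂ : HasCompactSupport ψ₂) (s₁ : tsupport ψ₁ ⊆ O)
    (s₂ : tsupport ψ₂ ⊆ O) :
    ∫ Y, (ψ₁ Y * -partialZ F Y + ψ₂ Y * partialR F Y) =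
      ∫ Y, (partialZ ψ₁ Y * F Y - partialR ψ₂ Y * F Y) := by
  have e := integral_divergence_eq_zero (contDiff_cutoff_mul (n := 1) hO h₂ s₂ hF)
    (contDiff_cutoff_mul (n := 1) hO h₁ s₁ hF.neg) c₂.mul_right c₁.mul_right
  have i1 : Integrable (fun Y => ψ₁ Y * -partialZ F Y) :=
    (continuous_cutoff_mul hO h₁.continuous s₁
      (hF.continuousOn_partialZ hO).neg).integrable_of_hasCompactSupport c₁.mul_right
  have i2 : Integrable (fun Y => ψ₂ Y * partialR F Y) :=
    (continuous_cutoff_mul hO h₂.continuous s₂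
      (hF.continuousOn_partialR hO)).integrable_of_hasCompactSupport c₂.mul_right
  have i3 : Integrable (fun Y => partialZ ψ₁ Y * F Y) :=
    (continuous_cutoff_mul hO h₁.continuous_partialZ (tsupport_partialZ_subset.trans s₁)
      hF.continuousOn).integrable_of_hasCompactSupport
      (c₁.of_eq_zero fun Y hY => by simp [partialZ_eq_zero_of_notMem hY])
  have i4 : Integrable (fun Y => partialR ψ₂ Y * F Y) :=
    (continuous_cutoff_mul hO h₂.continuous_partialR (tsupport_partialR_subset.trans s₂)
      hF.continuousOn).integrable_of_hasCompactSupport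
      (c₂.of_eq_zero fun Y hY => by simp [partialR_eq_zero_of_notMem hY])
  have e' := integral_sub (i1.add i2) (i3.sub i4)
  simp only [Pi.add_apply, Pi.sub_apply] at e'
  rw [← sub_eq_zero, ← e', ← e]
  refine integral_congr_ae (Eventually.of_forall fun Y => ?_)
  beta_reduce
  rw [partialR_cutoff_mul hO h₂ s₂ hF, partialZ_cutoff_mul hO h₁ s₁ hF.neg]
  have : partialZ (fun Y => -F Y) Y = -partialZ F Y := by
    unfold partialZ
    rw [fderiv_fun_neg]
    rfl
  rw [this]
  ring

lemma tendsto_of_forall_abs_sub_le {l : Filter ℝ} (hl : Tendsto (fun x => x) l (𝓝 (0 : ℝ)))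
    {K : Set (ℝ × ℝ)} {g : ℝ → ℝ × ℝ → ℝ} {U : ℝ × ℝ → ℝ} {C : ℝ}
    (h : ∀ᶠ x in l, ∀ Y ∈ K, |g x Y - U Y| ≤ C * x) {Y : ℝ × ℝ} (hY : Y ∈ K) :
    Tendsto (fun x => g x Y) l (𝓝 (U Y)) := by
  rw [tendsto_iff_norm_sub_tendsto_zero]
  refine squeeze_zero' (Eventually.of_forall fun _ => norm_nonneg _) (g := fun x => C * x) ?_ ?_
  · filter_upwards [h] with x hx using hx Y hY
  · simpa using hl.const_mul C

/-- Each term has a factor `x` (with `d` standing for `Φ(U) - Φ(g)`, itself of order `x`) and is at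
most linear in `∇F`, and `|∂F| ≤ 1 + |∇F|²`. The factors `1 ^ 2` are the values of `κ ^ 2` on the
set where the auxiliary cutoff `κ` equals one. -/
lemma transport_error_bound {x A C L D G M β c cR cZ φ' φ d g R f FR FZ : ℝ} (hx0 : 0 ≤ x)
    (hA0 : 0 ≤ A) (hC0 : 0 ≤ C) (hL0 : 0 ≤ L) (hD0 : 0 ≤ D) (hG0 : 0 ≤ G) (hM0 : 0 ≤ M)
    (d1 : |c| ≤ D) (d2 : |cR| ≤ D) (d3 : |cZ| ≤ D) (hL2 : |φ'| ≤ L) (hL1 : |φ| ≤ L)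
    (hd : |d| ≤ L * (C * x)) (hg : |g| ≤ G) (hR : |R| ≤ M) (hf : |f| ≤ A) :
    |-(β * x * c * φ' * g * FZ) - x * c * φ * FZ + d * (cZ * FR - cR * FZ)
      - x * φ * R * (cZ * FR - cR * FZ) - 2 * x * φ * f * cZ| ≤
    x * (D * L * |β| * G + D * L + 2 * L * C * D + 2 * L * M * D + 2 * L * A * D)
            * (1 ^ 2 + 1 ^ 2 * (FR ^ 2 + FZ ^ 2)) := by
  have sR : |FR| ≤ 1 + (FR ^ 2 + FZ ^ 2) := by
    nlinarith [sq_nonneg (|FR| - 1), sq_abs FR, sq_nonneg FZ]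
  have sZ : |FZ| ≤ 1 + (FR ^ 2 + FZ ^ 2) := by
    nlinarith [sq_nonneg (|FZ| - 1), sq_abs FZ, sq_nonneg FR]
  have s1 : 1 ≤ 1 + (FR ^ 2 + FZ ^ 2) := by nlinarith [sq_nonneg FR, sq_nonneg FZ]
  set S := 1 + (FR ^ 2 + FZ ^ 2) with hS
  have hS0 : 0 ≤ S := by linarith
  have cross : |cZ * FR - cR * FZ| ≤ D * S + D * S := by
    refine (abs_sub _ _).trans ?_
    rw [abs_mul, abs_mul]
    gcongr
  have t1 : |β * x * c * φ' * g * FZ| ≤ |β| * x * D * L * G * S := by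
    rw [abs_mul, abs_mul, abs_mul, abs_mul, abs_mul, abs_of_nonneg hx0]; gcongr
  have t2 : |x * c * φ * FZ| ≤ x * D * L * S := by
    rw [abs_mul, abs_mul, abs_mul, abs_of_nonneg hx0]; gcongr
  have t3 : |d * (cZ * FR - cR * FZ)| ≤ L * (C * x) * (D * S + D * S) := by
    rw [abs_mul]; gcongr
  have t4 : |x * φ * R * (cZ * FR - cR * FZ)| ≤ x * L * M * (D * S + D * S) := by
    rw [abs_mul, abs_mul, abs_mul, abs_of_nonneg hx0]; gcongr
  have t5 : |2 * x * φ * f * cZ| ≤ 2 * x * L * A * D * S := by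
    rw [abs_mul, abs_mul, abs_mul, abs_of_nonneg (by positivity : (0 : ℝ) ≤ 2 * x)]
    calc 2 * x * |φ| * |f| * |cZ| ≤ 2 * x * L * A * D := by gcongr
      _ ≤ 2 * x * L * A * D * S := le_mul_of_one_le_right (by positivity) s1
  have hexp : x * (D * L * |β| * G + D * L + 2 * L * C * D + 2 * L * M * D + 2 * L * A * D)
      * (1 ^ 2 + 1 ^ 2 * (FR ^ 2 + FZ ^ 2)) = |β| * x * D * L * G * S + x * D * L * S
      + L * (C * x) * (D * S + D * S) + x * L * M * (D * S + D * S)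
      + 2 * x * L * A * D * S := by rw [hS]; ring
  rw [hexp]
  rw [abs_le] at t1 t2 t3 t4 t5 ⊢
  constructor <;> linarith [t1.1, t1.2, t2.1, t2.2, t3.1, t3.2, t4.1, t4.2, t5.1, t5.2]

set_option maxHeartbeats 1000000 in
/-- The renormalized weak form of the limit of a transport equation along a stream family. -/
lemma StreamFamily.transport_weak_limit {l : Filter ℝ} [l.NeBot] [l.IsCountablyGenerated]
    {O : Set (ℝ × ℝ)} {F W : ℝ → ℝ × ℝ → ℝ} {Ψ : ℝ × ℝ → ℝ} (h : StreamFamily l O F W Ψ)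
    {γ σ β : ℝ} {g s : ℝ → ℝ × ℝ → ℝ} {U : ℝ × ℝ → ℝ} (hU : ContDiffOn ℝ 1 U O)
    (hg : ∀ᶠ x in l, ContDiffOn ℝ 1 (g x) O)
    (hgU : ∀ K ⊆ O, IsCompact K → ∃ C, ∀ᶠ x in l, ∀ Y ∈ K, |g x Y - U Y| ≤ C * x)
    (hsU : ∀ K ⊆ O, IsCompact K → ∃ C, ∀ᶠ x in l, ∀ Y ∈ K, |s x Y - σ * U Y| ≤ C * x)
    (heq : ∀ᶠ x in l, ∀ Y ∈ O,
      γ * (Y.1 * partialR (g x) Y + Y.2 * partialZ (g x) Y)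
        + -(1 + x * Y.1) * partialZ (F x) Y * partialR (g x) Y
        + (2 * x * F x Y + (1 + x * Y.1) * partialR (F x) Y) * partialZ (g x) Y
        = s x Y + β * x * g x Y * partialZ (F x) Y)
    {Φ : ℝ → ℝ} (hΦ : ContDiff ℝ 1 Φ) {χ : ℝ × ℝ → ℝ} (hχ : ContDiff ℝ 2 χ)
    (hχc : HasCompactSupport χ) (hχO : tsupport χ ⊆ O) :
    (∫ Y, (χ Y * (deriv Φ (U Y) * (σ * U Y) + 2 * γ * Φ (U Y))
        + Φ (U Y) * (γ * (Y.1 * partialR χ Y + Y.2 * partialZ χ Y))))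
      + ∫ Y, (partialR χ Y * Φ (U Y) * -partialZ Ψ Y + partialZ χ Y * Φ (U Y) * partialR Ψ Y)
      = 0 := by
  have hO := h.isOpen
  set K := tsupport χ with hKdef
  have hK : IsCompact K := hχc.isCompact
  have hχ1 : ContDiff ℝ 1 χ := hχ.of_le (by norm_num)
  have hχR : ContDiff ℝ 1 (partialR χ) := ContDiff.partialR 1 (by exact_mod_cast hχ)
  have hχZ : ContDiff ℝ 1 (partialZ χ) := ContDiff.partialZ 1 (by exact_mod_cast hχ)
  have hRO : tsupport (partialR χ) ⊆ O := tsupport_partialR_subset.trans hχO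
  have hZO : tsupport (partialZ χ) ⊆ O := tsupport_partialZ_subset.trans hχO
  have cR : HasCompactSupport (partialR χ) := hχc.of_eq_zero fun Y => partialR_eq_zero_of_notMem
  have cZ : HasCompactSupport (partialZ χ) := hχc.of_eq_zero fun Y => partialZ_eq_zero_of_notMem
  have hΦU : ContDiffOn ℝ 1 (fun Y => Φ (U Y)) O := hΦ.comp_contDiffOn hU
  have hψ₁ := contDiff_cutoff_mul (n := 1) hO hχR hRO hΦU
  have hψ₂ := contDiff_cutoff_mul (n := 1) hO hχZ hZO hΦU
  have cψ₁ : HasCompactSupport (fun Y => partialR χ Y * Φ (U Y)) := cR.mul_right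
  have cψ₂ : HasCompactSupport (fun Y => partialZ χ Y * Φ (U Y)) := cZ.mul_right
  have sψ₁ : tsupport (fun Y => partialR χ Y * Φ (U Y)) ⊆ O :=
    (tsupport_mul_subset_left (f := partialR χ) (g := fun Y => Φ (U Y))).trans hRO
  have sψ₂ : tsupport (fun Y => partialZ χ Y * Φ (U Y)) ⊆ O :=
    (tsupport_mul_subset_left (f := partialZ χ) (g := fun Y => Φ (U Y))).trans hZO
  -- bounds
  obtain ⟨D, hD0, hD⟩ := exists_C1_bound hχ1 hχc
  obtain ⟨A, hA0, hA⟩ := h.bounded hK hχO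
  obtain ⟨C₁, hC₁⟩ := hgU K hχO hK
  obtain ⟨C₂, hC₂⟩ := hsU K hχO hK
  obtain ⟨C₃, hC₃⟩ := h.near K hχO hK
  obtain ⟨B, hB0, hB⟩ := exists_forall_abs_le hK (hU.continuousOn.mono hχO)
  obtain ⟨M, hM0, hM⟩ : ∃ M, 0 ≤ M ∧ ∀ Y ∈ K, |Y.1| ≤ M ∧ |Y.2| ≤ M := by
    obtain ⟨a, ha, hA⟩ := exists_forall_abs_le hK continuous_fst.continuousOn
    obtain ⟨b, hb, hB⟩ := exists_forall_abs_le hK continuous_snd.continuousOn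
    exact ⟨a + b, by positivity, fun Y hY => ⟨by linarith [hA Y hY], by linarith [hB Y hY]⟩⟩
  set G := B + |C₁| with hG
  have hG0 : 0 ≤ G := by positivity
  have hgb : ∀ᶠ x in l, ∀ Y ∈ K, |g x Y| ≤ G := by
    filter_upwards [hC₁, h.eventually_small] with x hx h1 Y hY
    have e1 := hx Y hY
    have e2 := hB Y hY
    have e3 : C₁ * x ≤ |C₁| := by
      calc C₁ * x ≤ |C₁| * x := mul_le_mul_of_nonneg_right (le_abs_self _) h1.1.le
        _ ≤ |C₁| := mul_le_of_le_one_right (abs_nonneg _) h1.2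
    calc |g x Y| = |U Y + (g x Y - U Y)| := by ring_nf
      _ ≤ |U Y| + |g x Y - U Y| := abs_add_le _ _
      _ ≤ _ := by linarith
  have hsb : ∀ᶠ x in l, ∀ Y ∈ K, |s x Y| ≤ |σ| * B + |C₂| := by
    filter_upwards [hC₂, h.eventually_small] with x hx h1 Y hY
    have e1 := hx Y hY
    have e2 : |σ * U Y| ≤ |σ| * B := by
      rw [abs_mul]; exact mul_le_mul_of_nonneg_left (hB Y hY) (abs_nonneg _)
    have e3 : C₂ * x ≤ |C₂| := by
      calc C₂ * x ≤ |C₂| * x := mul_le_mul_of_nonneg_right (le_abs_self _) h1.1.le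
        _ ≤ |C₂| := mul_le_of_le_one_right (abs_nonneg _) h1.2
    calc |s x Y| = |σ * U Y + (s x Y - σ * U Y)| := by ring_nf
      _ ≤ |σ * U Y| + |s x Y - σ * U Y| := abs_add_le _ _
      _ ≤ _ := by linarith
  have hΦd : Continuous (deriv Φ) := hΦ.continuous_deriv (by norm_num)
  obtain ⟨L, hL0, hL⟩ : ∃ L, 0 ≤ L ∧ ∀ y ∈ Icc (-G) G, |Φ y| ≤ L ∧ |deriv Φ y| ≤ L := by
    obtain ⟨a, ha⟩ := (isCompact_Icc (a := -G) (b := G)).exists_bound_of_continuousOn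
      hΦ.continuous.continuousOn
    obtain ⟨b, hb⟩ := (isCompact_Icc (a := -G) (b := G)).exists_bound_of_continuousOn
      hΦd.continuousOn
    exact ⟨max (max a b) 0, le_max_right _ _, fun y hy =>
      ⟨(ha y hy).trans ((le_max_left _ _).trans (le_max_left _ _)),
       (hb y hy).trans ((le_max_right _ _).trans (le_max_left _ _))⟩⟩
  have hLip : ∀ y ∈ Icc (-G) G, ∀ z ∈ Icc (-G) G, |Φ y - Φ z| ≤ L * |y - z| := by
    intro y hy z hz
    exact (convex_Icc (-G) G).norm_image_sub_le_of_norm_deriv_le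
      (fun w _ => hΦ.differentiable (by norm_num) w) (fun w hw => (hL w hw).2) hz hy
  -- A second cutoff, equal to one on the support of `χ`, localizes the energy bound so that it
  -- covers this whole support.
  obtain ⟨κ, hκ, hκc, hκO, hκ01, hκ1⟩ := exists_smooth_cutoff hK hO hχO
  have hκ' : ContDiff ℝ 1 κ := hκ.of_le (by exact_mod_cast le_top)
  obtain ⟨E₀, hE₀⟩ := h.energy_bounded hκ' hκc hκO
  have hκK : ∀ Y ∈ K, κ Y = 1 := fun Y hY => hκ1.self_of_nhdsSet Y hY
  have hκint : Integrable (fun Y => κ Y ^ 2) :=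
    (hκ'.continuous.pow 2).integrable_of_hasCompactSupport
      (hκc.of_eq_zero fun Y hY => by simp [image_eq_zero_of_notMem_tsupport hY])
  -- the three parts
  let T₁ : ℝ → ℝ × ℝ → ℝ := fun x Y => χ Y * (deriv Φ (g x Y) * s x Y + 2 * γ * Φ (g x Y))
        + Φ (g x Y) * (γ * (Y.1 * partialR χ Y + Y.2 * partialZ χ Y))
  -- The flux is written with the limit `Φ (U Y)` in place of `Φ (g x Y)`, so that its test fields
  -- are independent of `x` and `integral_stream_flux` applies; the difference is of order `x`.
  let T₃ : ℝ → ℝ × ℝ → ℝ := fun x Y =>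
    partialR χ Y * Φ (U Y) * -partialZ (F x) Y + partialZ χ Y * Φ (U Y) * partialR (F x) Y
  -- `(b₁, b₂)` is `Φ(g)` times the full transport field, including the dilation `γ Y`.
  let b₁ : ℝ → ℝ × ℝ → ℝ := fun x Y =>
    Φ (g x Y) * (γ * Y.1 - (1 + x * Y.1) * partialZ (F x) Y)
  let b₂ : ℝ → ℝ × ℝ → ℝ := fun x Y =>
    Φ (g x Y) * (γ * Y.2 + (2 * x * F x Y + (1 + x * Y.1) * partialR (F x) Y))
  let Q : ℝ := D * L * |β| * G + D * L + 2 * L * |C₁| * D + 2 * L * M * D + 2 * L * A * D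
  have hlin : ContDiff ℝ 1 (fun Y : ℝ × ℝ => Y.1) := contDiff_fst
  have hlin2 : ContDiff ℝ 1 (fun Y : ℝ × ℝ => Y.2) := contDiff_snd
  have hT₁c : ∀ᶠ x in l, Continuous (T₁ x) := by
    filter_upwards [hg, h.contDiffOn, heq] with x hgx hFx hex
    have hFx1 : ContDiffOn ℝ 1 (F x) O := hFx.of_le (by norm_num)
    have gR := hgx.continuousOn_partialR hO
    have gZ := hgx.continuousOn_partialZ hO
    have FR := hFx1.continuousOn_partialR hO
    have FZ := hFx1.continuousOn_partialZ hO
    have gc := hgx.continuousOn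
    have Fc := hFx.continuousOn
    -- No regularity of the source is assumed; its continuity is read off from the transport
    -- equation.
    have sc : ContinuousOn (s x) O := by
      have : ContinuousOn (fun Y => γ * (Y.1 * partialR (g x) Y + Y.2 * partialZ (g x) Y)
        + -(1 + x * Y.1) * partialZ (F x) Y * partialR (g x) Y
        + (2 * x * F x Y + (1 + x * Y.1) * partialR (F x) Y) * partialZ (g x) Y
        - β * x * g x Y * partialZ (F x) Y) O := by fun_prop
      exact this.congr fun Y hY => by linear_combination -(hex Y hY)
    have Φg : ContinuousOn (fun Y => Φ (g x Y)) O := hΦ.continuous.comp_continuousOn gc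
    have Φ'g : ContinuousOn (fun Y => deriv Φ (g x Y)) O := hΦd.comp_continuousOn gc
    have k1 := continuous_cutoff_mul hO hχ.continuous hχO (G := fun Y =>
      deriv Φ (g x Y) * s x Y + 2 * γ * Φ (g x Y))
      ((Φ'g.mul sc).add (continuousOn_const.mul Φg))
    have k2 := continuous_cutoff_mul hO hχR.continuous hRO (G := fun Y =>
      Φ (g x Y) * (γ * Y.1)) (Φg.mul (continuousOn_const.mul continuousOn_fst))
    have k3 := continuous_cutoff_mul hO hχZ.continuous hZO (G := fun Y =>
      Φ (g x Y) * (γ * Y.2)) (Φg.mul (continuousOn_const.mul continuousOn_snd))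
    refine ((k1.add k2).add k3).congr fun Y => ?_
    simp only [T₁, Pi.add_apply]; ring
  have hT₁z : ∀ x, ∀ Y ∉ K, T₁ x Y = 0 := by
    intro x Y hY
    simp [T₁, image_eq_zero_of_notMem_tsupport hY, partialR_eq_zero_of_notMem hY,
      partialZ_eq_zero_of_notMem hY]
  have lim₁ : Tendsto (fun x => ∫ Y, T₁ x Y) l (𝓝 (∫ Y,
      (χ Y * (deriv Φ (U Y) * (σ * U Y) + 2 * γ * Φ (U Y))
        + Φ (U Y) * (γ * (Y.1 * partialR χ Y + Y.2 * partialZ χ Y))))) := by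
    refine tendsto_integral_of_uniform_compact_support hK
      (C := D * (L * (|σ| * B + |C₂|) + 2 * |γ| * L) + L * (|γ| * (M * D + M * D))) hT₁c
      (Eventually.of_forall hT₁z) ?_ ?_ ?_
    · intro Y hY
      simp [image_eq_zero_of_notMem_tsupport hY, partialR_eq_zero_of_notMem hY,
        partialZ_eq_zero_of_notMem hY]
    · filter_upwards [hgb, hsb] with x h1 h2 Y hY
      obtain ⟨hL1, hL2⟩ := hL _ (abs_le.1 (h1 Y hY))
      obtain ⟨d1, d2, d3⟩ := hD Y
      obtain ⟨m1, m2⟩ := hM Y hY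
      have h2' := h2 Y hY
      simp only [T₁]
      calc _ ≤ |χ Y| * (|deriv Φ (g x Y)| * |s x Y| + 2 * |γ| * |Φ (g x Y)|)
          + |Φ (g x Y)| * (|γ| * (|Y.1| * |partialR χ Y| + |Y.2| * |partialZ χ Y|)) := by
            refine (abs_add_le _ _).trans (add_le_add ?_ ?_)
            · rw [abs_mul]
              refine mul_le_mul_of_nonneg_left ((abs_add_le _ _).trans_eq ?_) (abs_nonneg _)
              simp [abs_mul]
            · rw [abs_mul, abs_mul]
              refine mul_le_mul_of_nonneg_left (mul_le_mul_of_nonneg_left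
                ((abs_add_le _ _).trans_eq ?_) (abs_nonneg _)) (abs_nonneg _)
              simp [abs_mul]
        _ ≤ _ := by gcongr
    · intro Y hY
      have t1 := tendsto_of_forall_abs_sub_le h.tendsto_zero hC₁ hY
      have t2 := tendsto_of_forall_abs_sub_le h.tendsto_zero (U := fun Y => σ * U Y) hC₂ hY
      have t3 := (hΦ.continuous.tendsto (U Y)).comp t1
      have t4 := (hΦd.tendsto (U Y)).comp t1
      exact (((t4.mul t2).add (t3.const_mul (2 * γ))).const_mul (χ Y)).add
        (t3.mul_const (γ * (Y.1 * partialR χ Y + Y.2 * partialZ χ Y)))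
  have lim₃ : Tendsto (fun x => ∫ Y, T₃ x Y) l (𝓝 (∫ Y,
      (partialR χ Y * Φ (U Y) * -partialZ Ψ Y + partialZ χ Y * Φ (U Y) * partialR Ψ Y))) := by
    rw [integral_stream_flux hO h.contDiffOn_limit hψ₁ hψ₂ cψ₁ cψ₂ sψ₁ sψ₂]
    have sub₁ : ∀ Y ∉ K, partialZ (fun Y => partialR χ Y * Φ (U Y)) Y = 0 := fun Y hY =>
      partialZ_eq_zero_of_notMem fun hn => hY (tsupport_partialR_subset
        (tsupport_mul_subset_left (f := partialR χ) (g := fun Y => Φ (U Y)) hn))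
    have sub₂ : ∀ Y ∉ K, partialR (fun Y => partialZ χ Y * Φ (U Y)) Y = 0 := fun Y hY =>
      partialR_eq_zero_of_notMem fun hn => hY (tsupport_partialZ_subset
        (tsupport_mul_subset_left (f := partialZ χ) (g := fun Y => Φ (U Y)) hn))
    obtain ⟨D₁, hD₁, hD₁'⟩ := exists_C1_bound hψ₁ cψ₁
    obtain ⟨D₂, hD₂, hD₂'⟩ := exists_C1_bound hψ₂ cψ₂
    have lim := tendsto_integral_of_uniform_compact_support (l := l) hK (C := D₁ * A + D₂ * A)
      (h := fun x Y => partialZ (fun Y => partialR χ Y * Φ (U Y)) Y * F x Y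
        - partialR (fun Y => partialZ χ Y * Φ (U Y)) Y * F x Y)
      (h₀ := fun Y => partialZ (fun Y => partialR χ Y * Φ (U Y)) Y * Ψ Y
        - partialR (fun Y => partialZ χ Y * Φ (U Y)) Y * Ψ Y) ?_
      (Eventually.of_forall fun x Y hY => by simp [sub₁ Y hY, sub₂ Y hY])
      (fun Y hY => by simp [sub₁ Y hY, sub₂ Y hY]) ?_ ?_
    · refine lim.congr' ?_
      filter_upwards [h.contDiffOn] with x hFx
      exact (integral_stream_flux hO (hFx.of_le (by norm_num)) hψ₁ hψ₂ cψ₁ cψ₂ sψ₁ sψ₂).symm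
    · filter_upwards [h.contDiffOn] with x hFx
      exact (continuous_cutoff_mul hO hψ₁.continuous_partialZ
        (tsupport_partialZ_subset.trans sψ₁) hFx.continuousOn).sub
        (continuous_cutoff_mul hO hψ₂.continuous_partialR
        (tsupport_partialR_subset.trans sψ₂) hFx.continuousOn)
    · filter_upwards [hA] with x hx Y hY
      refine (abs_sub _ _).trans ?_
      rw [abs_mul, abs_mul]
      have e1 := (hD₁' Y).2.2
      have e2 := (hD₂' Y).2.1
      have e3 := hx Y hY
      gcongr
    · intro Y hY
      have t := tendsto_of_forall_abs_sub_le h.tendsto_zero hC₃ hY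
      exact (t.const_mul _).sub (t.const_mul _)
  -- `T₁ + T₃` differs from the divergence of `χ b`, whose integral is zero, by at most `x Q (1 +
  -- |∇F|²)` on the support of `χ`, and the energy is bounded.
  have lim₀ : Tendsto (fun x => (∫ Y, T₁ x Y) + ∫ Y, T₃ x Y) l (𝓝 0) := by
    have hz : Tendsto (fun x : ℝ => x * (Q * ((∫ Y, κ Y ^ 2) + E₀))) l (𝓝 0) := by
      simpa using h.tendsto_zero.mul_const (Q * ((∫ Y, κ Y ^ 2) + E₀))
    refine squeeze_zero_norm' ?_ hz
    filter_upwards [hg, h.contDiffOn, heq, hE₀, hgb, hT₁c, hA, hC₁, h.eventually_small]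
      with x hgx hFx hex hEx hgbx hT₁x hAx hCx hxs
    have hFx1 : ContDiffOn ℝ 1 (F x) O := hFx.of_le (by norm_num)
    have hFR : ContDiffOn ℝ 1 (partialR (F x)) O :=
      ContDiffOn.partialR (n := 2) (m := 1) hO hFx (by norm_num)
    have hFZ : ContDiffOn ℝ 1 (partialZ (F x)) O :=
      ContDiffOn.partialZ (n := 2) (m := 1) hO hFx (by norm_num)
    have hΦg : ContDiffOn ℝ 1 (fun Y => Φ (g x Y)) O := hΦ.comp_contDiffOn hgx
    have hb₁ : ContDiffOn ℝ 1 (b₁ x) O := by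
      refine hΦg.mul (ContDiffOn.sub ?_ (ContDiffOn.mul ?_ hFZ)) <;> fun_prop
    have hb₂ : ContDiffOn ℝ 1 (b₂ x) O := by
      refine hΦg.mul (ContDiffOn.add ?_ (ContDiffOn.add (ContDiffOn.mul ?_ hFx1)
        (ContDiffOn.mul ?_ hFR))) <;> fun_prop
    have d₁ := contDiff_cutoff_mul (n := 1) hO hχ1 hχO hb₁
    have d₂ := contDiff_cutoff_mul (n := 1) hO hχ1 hχO hb₂
    have c₁ : HasCompactSupport (fun Y => χ Y * b₁ x Y) := hχc.mul_right
    have c₂ : HasCompactSupport (fun Y => χ Y * b₂ x Y) := hχc.mul_right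
    have hdiv := integral_divergence_eq_zero d₁ d₂ c₁ c₂
    have hdi := (integrable_partialR d₁ c₁).add (integrable_partialZ d₂ c₂)
    have iT₁ : Integrable (T₁ x) := hT₁x.integrable_of_hasCompactSupport
      (hχc.of_eq_zero fun Y hY => hT₁z x Y hY)
    have iT₃ : Integrable (T₃ x) := by
      refine Integrable.add ?_ ?_
      · exact (continuous_cutoff_mul hO hψ₁.continuous sψ₁
          hFZ.continuousOn.neg).integrable_of_hasCompactSupport cψ₁.mul_right
      · exact (continuous_cutoff_mul hO hψ₂.continuous sψ₂
          hFR.continuousOn).integrable_of_hasCompactSupport cψ₂.mul_right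
    have hbound : ∀ Y, ‖T₁ x Y + T₃ x Y - (partialR (fun Y => χ Y * b₁ x Y) Y
        + partialZ (fun Y => χ Y * b₂ x Y) Y)‖ ≤
        x * Q * (κ Y ^ 2 + κ Y ^ 2 * (partialR (F x) Y ^ 2 + partialZ (F x) Y ^ 2)) := by
      intro Y
      by_cases hY : Y ∈ K
      · have hYO := hχO hY
        have dg : DifferentiableAt ℝ (g x) Y :=
          (hgx.contDiffAt (hO.mem_nhds hYO)).differentiableAt (by norm_num)
        have dF : DifferentiableAt ℝ (F x) Y :=
          (hFx1.contDiffAt (hO.mem_nhds hYO)).differentiableAt (by norm_num)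
        have dFR : DifferentiableAt ℝ (partialR (F x)) Y :=
          (hFR.contDiffAt (hO.mem_nhds hYO)).differentiableAt (by norm_num)
        have dFZ : DifferentiableAt ℝ (partialZ (F x)) Y :=
          (hFZ.contDiffAt (hO.mem_nhds hYO)).differentiableAt (by norm_num)
        have hΦ' : HasDerivAt Φ (deriv Φ (g x Y)) (g x Y) :=
          (hΦ.differentiable (by norm_num) _).hasDerivAt
        have e₁ : partialR (b₁ x) Y = deriv Φ (g x Y) * partialR (g x) Y
            * (γ * Y.1 - (1 + x * Y.1) * partialZ (F x) Y) + Φ (g x Y) * (γ * 1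
            - ((x * 1) * partialZ (F x) Y + (1 + x * Y.1) * partialR (partialZ (F x)) Y)) :=
          partialR_eq_of_hasDerivAt
            ((hb₁.contDiffAt (hO.mem_nhds hYO)).differentiableAt (by norm_num))
            ((hΦ'.comp Y.1 (hasDerivAt_partialR dg)).mul (((hasDerivAt_id Y.1).const_mul γ).sub
              ((((hasDerivAt_id Y.1).const_mul x).const_add 1).mul (hasDerivAt_partialR dFZ))))
        have e₂ : partialZ (b₂ x) Y = deriv Φ (g x Y) * partialZ (g x) Y
            * (γ * Y.2 + (2 * x * F x Y + (1 + x * Y.1) * partialR (F x) Y))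
            + Φ (g x Y) * (γ * 1 + (2 * x * partialZ (F x) Y
              + (1 + x * Y.1) * partialZ (partialR (F x)) Y)) :=
          partialZ_eq_of_hasDerivAt
            ((hb₂.contDiffAt (hO.mem_nhds hYO)).differentiableAt (by norm_num))
            ((hΦ'.comp Y.2 (hasDerivAt_partialZ dg)).mul (((hasDerivAt_id Y.2).const_mul γ).add
              (((hasDerivAt_partialZ dF).const_mul (2 * x)).add
                ((hasDerivAt_partialZ dFR).const_mul (1 + x * Y.1)))))
        have e₃ := partialR_partialZ_comm (hFx.contDiffAt (hO.mem_nhds hYO))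
        have e₄ := hex Y hYO
        -- The mixed second derivatives of `F` cancel by `e₃`, and the transport equation `e₄`
        -- eliminates the derivatives of `g`. The field has divergence `2γ + x ∂_Z F`, so only terms
        -- small with `x` survive.
        have hid : T₁ x Y + T₃ x Y - (partialR (fun Y => χ Y * b₁ x Y) Y
            + partialZ (fun Y => χ Y * b₂ x Y) Y) =
            -(β * x * χ Y * deriv Φ (g x Y) * g x Y * partialZ (F x) Y)
            - x * χ Y * Φ (g x Y) * partialZ (F x) Y
            + (Φ (U Y) - Φ (g x Y)) * (partialZ χ Y * partialR (F x) Y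
              - partialR χ Y * partialZ (F x) Y)
            - x * Φ (g x Y) * Y.1 * (partialZ χ Y * partialR (F x) Y
              - partialR χ Y * partialZ (F x) Y)
            - 2 * x * Φ (g x Y) * F x Y * partialZ χ Y := by
          rw [partialR_cutoff_mul hO hχ1 hχO hb₁, partialZ_cutoff_mul hO hχ1 hχO hb₂, e₁, e₂, e₃]
          simp only [T₁, T₃, b₁, b₂]
          linear_combination -(χ Y * deriv Φ (g x Y)) * e₄
        rw [hid, hκK Y hY, Real.norm_eq_abs]
        obtain ⟨hL1, hL2⟩ := hL _ (abs_le.1 (hgbx Y hY))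
        have hUG : |U Y| ≤ G := (hB Y hY).trans (by rw [hG]; linarith [abs_nonneg C₁])
        have hΦUg : |Φ (U Y) - Φ (g x Y)| ≤ L * (|C₁| * x) := by
          refine (hLip _ (abs_le.1 hUG) _ (abs_le.1 (hgbx Y hY))).trans ?_
          refine mul_le_mul_of_nonneg_left ?_ hL0
          rw [abs_sub_comm]
          exact (hCx Y hY).trans (mul_le_mul_of_nonneg_right (le_abs_self _) hxs.1.le)
        obtain ⟨d1, d2, d3⟩ := hD Y
        exact transport_error_bound hxs.1.le hA0 (abs_nonneg C₁) hL0 hD0 hG0 hM0 d1 d2 d3 hL2 hL1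
          hΦUg (hgbx Y hY) (hM Y hY).1 (hAx Y hY)
      · rw [hT₁z x Y hY, partialR_cutoff_mul hO hχ1 hχO hb₁, partialZ_cutoff_mul hO hχ1 hχO hb₂]
        simp only [T₃, image_eq_zero_of_notMem_tsupport hY, partialR_eq_zero_of_notMem hY,
          partialZ_eq_zero_of_notMem hY]
        simp only [zero_mul, add_zero, sub_zero, norm_zero]
        have hQ : 0 ≤ Q := by positivity
        have hx0 := hxs.1.le
        positivity
    have hsub : (∫ Y, T₁ x Y) + ∫ Y, T₃ x Y = ∫ Y, (T₁ x Y + T₃ x Y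
        - (partialR (fun Y => χ Y * b₁ x Y) Y + partialZ (fun Y => χ Y * b₂ x Y) Y)) := by
      have e1 := integral_sub (iT₁.add iT₃) hdi
      have e2 := integral_add iT₁ iT₃
      simp only [Pi.add_apply] at e1
      rw [e1, e2, hdiv, sub_zero]
    rw [hsub]
    have hint : Integrable (fun Y => x * Q *
        (κ Y ^ 2 + κ Y ^ 2 * (partialR (F x) Y ^ 2 + partialZ (F x) Y ^ 2))) :=
      (hκint.add hEx.1).const_mul _
    refine (norm_integral_le_of_norm_le hint (Eventually.of_forall hbound)).trans ?_
    rw [integral_const_mul, integral_add hκint hEx.1, mul_assoc]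
    have hQ : 0 ≤ Q := by positivity
    have := hEx.2
    have hx0 := hxs.1.le
    gcongr
  exact tendsto_nhds_unique (lim₁.add lim₃) lim₀

/-! ### Truncated powers -/

/-- The exponent is at least `2`, so at the kink the function is of higher than first order and has
derivative zero. -/
lemma hasDerivAt_max_zero_pow (m : ℕ) (y : ℝ) :
    HasDerivAt (fun y : ℝ => max y 0 ^ (m + 2)) ((m + 2) * max y 0 ^ (m + 1)) y := by
  rcases lt_trichotomy y 0 with hy | rfl | hy
  · have h : (fun y : ℝ => max y 0 ^ (m + 2)) =ᶠ[𝓝 y] fun _ => 0 := by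
      filter_upwards [Iio_mem_nhds hy] with z hz
      rw [max_eq_right (le_of_lt hz)]; simp
    rw [max_eq_right hy.le]
    simpa using (hasDerivAt_const y (0 : ℝ)).congr_of_eventuallyEq h
  · have h : (fun y : ℝ => max y 0 ^ (m + 2)) =O[𝓝 0] fun y => ‖y - 0‖ ^ (m + 2) := by
      refine IsBigO.of_bound 1 (Eventually.of_forall fun z => ?_)
      rw [norm_pow, norm_pow, one_mul, sub_zero, norm_norm]
      refine pow_le_pow_left₀ (norm_nonneg _) ?_ _
      rw [Real.norm_eq_abs, Real.norm_eq_abs, abs_of_nonneg (le_max_right _ _)]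
      exact max_le (le_abs_self z) (abs_nonneg z)
    simpa using (h.hasFDerivAt (by omega)).hasDerivAt
  · have h : (fun y : ℝ => max y 0 ^ (m + 2)) =ᶠ[𝓝 y] fun y => y ^ (m + 2) := by
      filter_upwards [Ioi_mem_nhds hy] with z hz
      rw [max_eq_left (le_of_lt hz)]
    rw [max_eq_left hy.le]
    simpa using (hasDerivAt_pow (m + 2) y).congr_of_eventuallyEq h

/-- The truncated power `((s² - ε)₊)^(m+2)`. -/
def truncPow (ε : ℝ) (m : ℕ) (s : ℝ) : ℝ := max (s ^ 2 - ε) 0 ^ (m + 2)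

lemma hasDerivAt_truncPow (ε : ℝ) (m : ℕ) (s : ℝ) :
    HasDerivAt (truncPow ε m) ((m + 2) * max (s ^ 2 - ε) 0 ^ (m + 1) * (2 * s)) s := by
  have h : HasDerivAt (fun s : ℝ => s ^ 2 - ε) (2 * s) s := by
    simpa using (hasDerivAt_pow 2 s).sub_const ε
  exact (hasDerivAt_max_zero_pow m (s ^ 2 - ε)).comp s h

lemma contDiff_truncPow (ε : ℝ) (m : ℕ) : ContDiff ℝ 1 (truncPow ε m) := by
  refine contDiff_one_iff_deriv.2 ⟨fun s => (hasDerivAt_truncPow ε m s).differentiableAt, ?_⟩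
  rw [funext fun s => (hasDerivAt_truncPow ε m s).deriv]
  fun_prop

lemma truncPow_nonneg (ε : ℝ) (m : ℕ) (s : ℝ) : 0 ≤ truncPow ε m s := by
  unfold truncPow; positivity

lemma truncPow_eq_zero {ε s : ℝ} (m : ℕ) (h : s ^ 2 ≤ ε) : truncPow ε m s = 0 := by
  unfold truncPow
  rw [max_eq_right (by linarith)]; simp

lemma truncPow_pos {ε s : ℝ} (m : ℕ) (h : ε < s ^ 2) : 0 < truncPow ε m s := by
  unfold truncPow
  rw [max_eq_left (by linarith)]
  exact pow_pos (by linarith) _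

/-- For a large exponent the zeroth order term of the renormalized equation has a sign. -/
lemma exists_truncPow_sign (γ σ : ℝ) : ∃ (m : ℕ) (e : ℝ), (e = 1 ∨ e = -1) ∧
    ∀ ε > 0, ∀ s, 2 * γ * truncPow ε m s ≤
      e * (deriv (truncPow ε m) s * (σ * s) + 2 * γ * truncPow ε m s) := by
  rcases le_or_gt 0 σ with hσ | hσ
  -- For `σ ≥ 0` the term with `σ` is nonnegative already.
  · refine ⟨0, 1, Or.inl rfl, fun ε hε s => ?_⟩
    rw [(hasDerivAt_truncPow ε 0 s).deriv]
    have : 0 ≤ ((0 : ℕ) + 2 : ℝ) * max (s ^ 2 - ε) 0 ^ (0 + 1) * (2 * σ) * s ^ 2 := by positivity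
    linarith
  -- Since `s Φ'(s) ≥ 2(m + 2) Φ(s)`, it suffices that `(m + 2)(-σ) ≥ 2γ`: the term with `σ` then
  -- exceeds `4γ Φ` in size and outweighs `2γ Φ` with `2γ Φ` to spare.
  · obtain ⟨m, hm⟩ := exists_nat_ge (2 * γ / -σ)
    refine ⟨m, -1, Or.inr rfl, fun ε hε s => ?_⟩
    rw [(hasDerivAt_truncPow ε m s).deriv]
    unfold truncPow
    rw [div_le_iff₀ (by linarith)] at hm
    have hP0 : 0 ≤ max (s ^ 2 - ε) 0 := le_max_right _ _
    have hP : max (s ^ 2 - ε) 0 ≤ s ^ 2 := max_le (by linarith) (sq_nonneg s)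
    generalize max (s ^ 2 - ε) 0 = P at *
    have h1 : P ^ (m + 2) ≤ P ^ (m + 1) * s ^ 2 := by
      rw [pow_succ P (m + 1)]; gcongr
    have h2 : 0 ≤ P ^ (m + 2) := by positivity
    have h3 : 0 ≤ ((m : ℝ) + 2) * (-σ) := mul_nonneg (by positivity) (by linarith)
    have h4 := mul_le_mul_of_nonneg_left h1 h3
    have h5 : 2 * γ ≤ ((m : ℝ) + 2) * (-σ) := by nlinarith
    have h6 := mul_le_mul_of_nonneg_right h5 h2
    nlinarith

/-! ### Cutoff near the boundary of the half-plane -/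

/-- A smooth function which vanishes for `s ≥ -1` and equals one for `s ≤ -2`. -/
def stepProfile (s : ℝ) : ℝ := Real.smoothTransition (-s - 1)

lemma contDiff_stepProfile : ContDiff ℝ (⊤ : ℕ∞) stepProfile :=
  Real.smoothTransition.contDiff.comp (by fun_prop : ContDiff ℝ (⊤ : ℕ∞) fun s : ℝ => -s - 1)

lemma stepProfile_eq_zero {s : ℝ} (h : -1 ≤ s) : stepProfile s = 0 :=
  Real.smoothTransition.zero_of_nonpos (by linarith)

lemma stepProfile_eq_one {s : ℝ} (h : s ≤ -2) : stepProfile s = 1 :=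
  Real.smoothTransition.one_of_one_le (by linarith)

lemma stepProfile_nonneg (s : ℝ) : 0 ≤ stepProfile s := Real.smoothTransition.nonneg _

lemma stepProfile_le_one (s : ℝ) : stepProfile s ≤ 1 := Real.smoothTransition.le_one _

lemma stepProfile_antitone : Antitone stepProfile := fun _ _ h =>
  Real.smoothTransition.monotone (by linarith)

lemma deriv_stepProfile_eventuallyEq {s : ℝ} (h : s ∉ Icc (-2 : ℝ) (-1)) :
    deriv stepProfile =ᶠ[𝓝 s] fun _ => 0 := by
  have : s < -2 ∨ -1 < s := by
    by_contra hn
    push Not at hn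
    exact h ⟨hn.1, hn.2⟩
  rcases this with hs | hs
  · have h1 : stepProfile =ᶠ[𝓝 s] fun _ => 1 := by
      filter_upwards [Iio_mem_nhds hs] with z hz using stepProfile_eq_one (le_of_lt hz)
    simpa using h1.deriv
  · have h1 : stepProfile =ᶠ[𝓝 s] fun _ => 0 := by
      filter_upwards [Ioi_mem_nhds hs] with z hz using stepProfile_eq_zero (le_of_lt hz)
    simpa using h1.deriv

lemma deriv_stepProfile_eq_zero {s : ℝ} (h : s ∉ Icc (-2 : ℝ) (-1)) : deriv stepProfile s = 0 :=
  (deriv_stepProfile_eventuallyEq h).self_of_nhds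

lemma deriv_deriv_stepProfile_eq_zero {s : ℝ} (h : s ∉ Icc (-2 : ℝ) (-1)) :
    deriv (deriv stepProfile) s = 0 := by
  rw [(deriv_stepProfile_eventuallyEq h).deriv_eq]; simp

lemma contDiff_deriv_stepProfile : ContDiff ℝ (⊤ : ℕ∞) (deriv stepProfile) :=
  (contDiff_infty_iff_deriv.1 contDiff_stepProfile).2

lemma contDiff_deriv_deriv_stepProfile : ContDiff ℝ (⊤ : ℕ∞) (deriv (deriv stepProfile)) :=
  (contDiff_infty_iff_deriv.1 contDiff_deriv_stepProfile).2

lemma exists_deriv_stepProfile_bound :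
    ∃ D, 0 ≤ D ∧ ∀ s, |deriv stepProfile s| ≤ D ∧ |deriv (deriv stepProfile) s| ≤ D := by
  obtain ⟨a, ha⟩ := (isCompact_Icc (a := (-2 : ℝ)) (b := -1)).exists_bound_of_continuousOn
    contDiff_deriv_stepProfile.continuous.continuousOn
  obtain ⟨b, hb⟩ := (isCompact_Icc (a := (-2 : ℝ)) (b := -1)).exists_bound_of_continuousOn
    contDiff_deriv_deriv_stepProfile.continuous.continuousOn
  refine ⟨max (max a b) 0, le_max_right _ _, fun s => ?_⟩
  by_cases hs : s ∈ Icc (-2 : ℝ) (-1)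
  · exact ⟨(ha s hs).trans ((le_max_left _ _).trans (le_max_left _ _)),
      (hb s hs).trans ((le_max_right _ _).trans (le_max_left _ _))⟩
  · rw [deriv_stepProfile_eq_zero hs, deriv_deriv_stepProfile_eq_zero hs]
    simp

/-- The open left half-plane. -/
def openLeftHalfPlane : Set (ℝ × ℝ) := {Y | Y.1 < 0}

lemma isOpen_openLeftHalfPlane : IsOpen openLeftHalfPlane :=
  isOpen_lt continuous_fst continuous_const

lemma openLeftHalfPlane_subset : openLeftHalfPlane ⊆ leftHalfPlane :=
  fun Y (h : Y.1 < 0) => (h.le : Y.1 ≤ 0)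

lemma leftHalfPlane_mem_nhds {Y : ℝ × ℝ} (hY : Y ∈ openLeftHalfPlane) : leftHalfPlane ∈ 𝓝 Y :=
  mem_of_superset (isOpen_openLeftHalfPlane.mem_nhds hY) openLeftHalfPlane_subset

lemma uniqueDiffOn_leftHalfPlane : UniqueDiffOn ℝ leftHalfPlane := by
  have : leftHalfPlane = Iic (0 : ℝ) ×ˢ (univ : Set ℝ) := by
    ext Y; simp [leftHalfPlane]
  rw [this]
  exact (uniqueDiffOn_Iic 0).prod uniqueDiffOn_univ

lemma profileGrad_eq {F : ℝ × ℝ → ℝ} {Y : ℝ × ℝ} (hY : Y ∈ openLeftHalfPlane) :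
    profileGrad F Y = (partialR F Y, partialZ F Y) := by
  unfold profileGrad partialR partialZ
  rw [fderivWithin_of_mem_nhds (leftHalfPlane_mem_nhds hY)]

lemma continuousOn_profileGrad {F : ℝ × ℝ → ℝ} (hF : ContDiffOn ℝ 1 F leftHalfPlane) :
    ContinuousOn (profileGrad F) leftHalfPlane := by
  have h := hF.continuousOn_fderivWithin uniqueDiffOn_leftHalfPlane (by norm_num)
  exact (h.clm_apply continuousOn_const).prodMk (h.clm_apply continuousOn_const)

/-- The cutoff `stepProfile (n R)`. -/
def boundaryCutoff (n : ℝ) (Y : ℝ × ℝ) : ℝ := stepProfile (n * Y.1)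

lemma contDiff_boundaryCutoff (n : ℝ) : ContDiff ℝ (⊤ : ℕ∞) (boundaryCutoff n) :=
  contDiff_stepProfile.comp (by fun_prop : ContDiff ℝ (⊤ : ℕ∞) fun Y : ℝ × ℝ => n * Y.1)

lemma differentiableAt_boundaryCutoff (n : ℝ) (Y : ℝ × ℝ) :
    DifferentiableAt ℝ (boundaryCutoff n) Y :=
  (contDiff_boundaryCutoff n).differentiable (by simp) Y

lemma hasDerivAt_stepProfile (s : ℝ) : HasDerivAt stepProfile (deriv stepProfile s) s :=
  (contDiff_stepProfile.differentiable (by simp) s).hasDerivAt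

lemma partialR_boundaryCutoff (n : ℝ) (Y : ℝ × ℝ) :
    partialR (boundaryCutoff n) Y = n * deriv stepProfile (n * Y.1) :=
  partialR_eq_of_hasDerivAt (differentiableAt_boundaryCutoff n Y) (by
    have h1 : HasDerivAt (fun s : ℝ => n * s) n Y.1 := by
      simpa using (hasDerivAt_id Y.1).const_mul n
    have h2 := (hasDerivAt_stepProfile (n * Y.1)).comp Y.1 h1
    rw [mul_comm]
    exact h2)

lemma partialZ_boundaryCutoff (n : ℝ) (Y : ℝ × ℝ) : partialZ (boundaryCutoff n) Y = 0 :=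
  partialZ_eq_of_hasDerivAt (differentiableAt_boundaryCutoff n Y) (by
    simpa only [boundaryCutoff] using hasDerivAt_const Y.2 (stepProfile (n * Y.1)))

lemma tsupport_boundaryCutoff_subset {n : ℝ} (hn : 0 < n) :
    tsupport (boundaryCutoff n) ⊆ openLeftHalfPlane := by
  have h : tsupport (boundaryCutoff n) ⊆ {Y : ℝ × ℝ | n * Y.1 ≤ -1} := by
    refine closure_minimal (fun Y hY => ?_) (isClosed_le (by fun_prop) continuous_const)
    by_contra hn'
    exact hY (stepProfile_eq_zero (le_of_lt (not_le.1 hn')))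
  intro Y hY
  have := h hY
  simp only [mem_ofPred_eq] at this
  show Y.1 < 0
  by_contra h0
  nlinarith [mul_nonneg hn.le (not_lt.1 h0)]

/-- The strip of width `2 / n` along the boundary of the half-plane. -/
def boundaryStrip (n M : ℝ) : Set (ℝ × ℝ) := Icc (-2 / n) 0 ×ˢ Icc (-M) M

lemma mem_boundaryStrip_of {n M : ℝ} (hn : 0 < n) {Y : ℝ × ℝ} (h1 : n * Y.1 ∈ Icc (-2 : ℝ) (-1))
    (h2 : |Y.2| ≤ M) : Y ∈ boundaryStrip n M := by
  refine ⟨⟨?_, ?_⟩, abs_le.1 h2⟩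
  · rw [div_le_iff₀ hn]; linarith [h1.1]
  · by_contra h0
    nlinarith [h1.2, mul_pos hn (not_le.1 h0)]

lemma volume_boundaryStrip {n M : ℝ} (hn : 0 < n) (hM : 0 ≤ M) :
    volume.real (boundaryStrip n M) = 4 * M / n := by
  have h : (0 : ℝ) ≤ 0 - -2 / n := by rw [neg_div]; simp; positivity
  unfold boundaryStrip
  rw [Measure.real, Measure.volume_eq_prod, Measure.prod_prod, Real.volume_Icc, Real.volume_Icc,
    ENNReal.toReal_mul, ENNReal.toReal_ofReal h, ENNReal.toReal_ofReal (by linarith)]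
  field_simp
  ring

lemma isCompact_boundaryStrip (n M : ℝ) : IsCompact (boundaryStrip n M) :=
  isCompact_Icc.prod isCompact_Icc

/-- The area `4M / n` of the strip compensates one factor `n` from a derivative of `boundaryCutoff
n`. -/
lemma abs_integral_le_of_boundaryStrip {n M C : ℝ} (hn : 0 < n) (hM : 0 ≤ M) {f : ℝ × ℝ → ℝ}
    (hz : ∀ Y ∉ boundaryStrip n M, f Y = 0) (hb : ∀ Y ∈ boundaryStrip n M, |f Y| ≤ C) :
    |∫ Y, f Y| ≤ C * (4 * M / n) := by
  rw [← setIntegral_eq_integral_of_forall_compl_eq_zero hz, ← volume_boundaryStrip hn hM]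
  exact norm_setIntegral_le_of_norm_le_const (f := f) (isCompact_boundaryStrip n M).measure_lt_top hb

/-! ### A Liouville theorem for the profile transport equation -/

lemma exists_bound_of_tendsto_profileInfinity {U : ℝ × ℝ → ℝ}
    (h : Tendsto U profileInfinity (𝓝 0)) {ε : ℝ} (hε : 0 < ε) :
    ∃ M, 0 < M ∧ ∀ Y ∈ leftHalfPlane, Y ∉ Metric.closedBall (0 : ℝ × ℝ) M → |U Y| < ε := by
  have h1 : ∀ᶠ Y in profileInfinity, |U Y| < ε := by
    have := h (Metric.ball_mem_nhds 0 hε)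
    filter_upwards [this] with Y hY
    simpa using hY
  unfold profileInfinity at h1
  rw [eventually_inf_principal] at h1
  obtain ⟨r, hr⟩ := Metric.closedBall_compl_subset_of_mem_cocompact h1 (0 : ℝ × ℝ)
  refine ⟨max r 1, by positivity, fun Y hY hYM => hr (fun hn => hYM ?_) hY⟩
  exact Metric.closedBall_subset_closedBall (le_max_left _ _) hn

lemma mem_closedBall_zero_iff_abs {Y : ℝ × ℝ} {M : ℝ} :
    Y ∈ Metric.closedBall (0 : ℝ × ℝ) M ↔ |Y.1| ≤ M ∧ |Y.2| ≤ M := by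
  rw [mem_closedBall_zero_iff, Prod.norm_def, max_le_iff, Real.norm_eq_abs, Real.norm_eq_abs]

set_option maxHeartbeats 600000 in
-- If `U Y₀ ≠ 0`, test with a truncated power that is positive at `U Y₀`. The zeroth order term is
-- then bounded away from zero uniformly in the cutoff. The derivative of the boundary cutoff is of
-- size `n`, but lives on a strip of area of order `1 / n` where the normal component `γ R - ∂_Z Ψ`
-- of the drift is small, since it vanishes on `R = 0`. The boundary flux therefore tends to zero, a
-- contradiction.
theorem transport_liouville {γ σ : ℝ} (hγ : 0 < γ) {U Ψ : ℝ × ℝ → ℝ}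
    (hU : ContDiffOn ℝ 1 U leftHalfPlane) (hΨ : ContDiffOn ℝ 1 Ψ leftHalfPlane)
    (hdecay : Tendsto U profileInfinity (𝓝 0)) (hbc : ∀ Z : ℝ, (profileGrad Ψ (0, Z)).2 = 0)
    (hweak : ∀ Φ : ℝ → ℝ, ContDiff ℝ 1 Φ → ∀ χ : ℝ × ℝ → ℝ, ContDiff ℝ 2 χ →
      HasCompactSupport χ → tsupport χ ⊆ openLeftHalfPlane →
      (∫ Y, (χ Y * (deriv Φ (U Y) * (σ * U Y) + 2 * γ * Φ (U Y))
        + Φ (U Y) * (γ * (Y.1 * partialR χ Y + Y.2 * partialZ χ Y))))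
      + ∫ Y, (partialR χ Y * Φ (U Y) * -partialZ Ψ Y + partialZ χ Y * Φ (U Y) * partialR Ψ Y)
      = 0) :
    ∀ Y ∈ openLeftHalfPlane, U Y = 0 := by
  obtain ⟨m, e, he, hsign⟩ := exists_truncPow_sign γ σ
  have hO := isOpen_openLeftHalfPlane
  have hUo : ContDiffOn ℝ 1 U openLeftHalfPlane := hU.mono openLeftHalfPlane_subset
  have hΨo : ContDiffOn ℝ 1 Ψ openLeftHalfPlane := hΨ.mono openLeftHalfPlane_subset
  intro Y₀ hY₀
  by_contra hne
  obtain ⟨ε, hε0, hε⟩ : ∃ ε, 0 < ε ∧ ε < U Y₀ ^ 2 := exists_between (by positivity)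
  set Φ := truncPow ε m with hΦdef
  have hΦ : ContDiff ℝ 1 Φ := contDiff_truncPow ε m
  have hΦd : Continuous (deriv Φ) := hΦ.continuous_deriv (by norm_num)
  -- Outside a ball `U² < ε`, so `Φ(U)` vanishes there. The norm on the product is the maximum norm,
  -- and the ball is a square.
  obtain ⟨M, hM0, hM⟩ := exists_bound_of_tendsto_profileInfinity hdecay (Real.sqrt_pos.2 hε0)
  have hM' : ∀ Y ∈ leftHalfPlane, Y ∉ Metric.closedBall (0 : ℝ × ℝ) M → Φ (U Y) = 0 := by
    intro Y hY hYM
    refine truncPow_eq_zero m ?_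
    have := hM Y hY hYM
    rw [← sq_abs]
    calc |U Y| ^ 2 ≤ Real.sqrt ε ^ 2 := by gcongr
      _ = ε := Real.sq_sqrt hε0.le
  obtain ⟨κ, hκ, hκc, -, hκ01, hκ1⟩ := exists_smooth_cutoff
    (isCompact_closedBall (0 : ℝ × ℝ) M) isOpen_univ (subset_univ _)
  have hκM : ∀ Y ∈ Metric.closedBall (0 : ℝ × ℝ) M, κ Y = 1 := fun Y hY => hκ1.self_of_nhdsSet Y hY
  have hκn : ∀ Y ∈ Metric.closedBall (0 : ℝ × ℝ) M, κ =ᶠ[𝓝 Y] fun _ => 1 := fun Y hY =>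
    hκ1.filter_mono (nhds_le_nhdsSet hY)
  have hκR : ∀ Y ∈ Metric.closedBall (0 : ℝ × ℝ) M, partialR κ Y = 0 := fun Y hY => by
    unfold partialR; rw [(hκn Y hY).fderiv_eq]; simp
  have hκZ : ∀ Y ∈ Metric.closedBall (0 : ℝ × ℝ) M, partialZ κ Y = 0 := fun Y hY => by
    unfold partialZ; rw [(hκn Y hY).fderiv_eq]; simp
  -- The cutoff `κ` only makes the support compact: its derivatives vanish on the ball, hence
  -- wherever `Φ(U)` does not, and they contribute nothing.
  let χ : ℝ → ℝ × ℝ → ℝ := fun n Y => boundaryCutoff n Y * κ Y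
  have hχ : ∀ n, ContDiff ℝ (⊤ : ℕ∞) (χ n) := fun n => (contDiff_boundaryCutoff n).mul hκ
  have hχ2 : ∀ n, ContDiff ℝ 2 (χ n) := fun n => (hχ n).of_le (WithTop.coe_le_coe.2 le_top)
  have hχ1 : ∀ n, ContDiff ℝ 1 (χ n) := fun n => (hχ n).of_le (by exact_mod_cast le_top)
  have hχc : ∀ n, HasCompactSupport (χ n) := fun n => hκc.mul_left
  have hχO : ∀ n, 0 < n → tsupport (χ n) ⊆ openLeftHalfPlane := fun n hn =>
    (tsupport_mul_subset_left (f := boundaryCutoff n) (g := κ)).trans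
      (tsupport_boundaryCutoff_subset hn)
  have hχR : ∀ n, ∀ Y ∈ Metric.closedBall (0 : ℝ × ℝ) M,
      partialR (χ n) Y = n * deriv stepProfile (n * Y.1) := fun n Y hY => by
    rw [partialR_mul (differentiableAt_boundaryCutoff n Y) (hκ.differentiable (by simp) Y),
      hκM Y hY, hκR Y hY, partialR_boundaryCutoff]; ring
  have hχZ : ∀ n, ∀ Y ∈ Metric.closedBall (0 : ℝ × ℝ) M, partialZ (χ n) Y = 0 := fun n Y hY => by
    rw [partialZ_mul (differentiableAt_boundaryCutoff n Y) (hκ.differentiable (by simp) Y),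
      hκZ Y hY, partialZ_boundaryCutoff]; ring
  obtain ⟨D, hD0, hD⟩ := exists_deriv_stepProfile_bound
  -- continuity of the integrands
  have cU := hUo.continuousOn
  have cΦ : ContinuousOn (fun Y => Φ (U Y)) openLeftHalfPlane := hΦ.continuous.comp_continuousOn cU
  have cΦ' : ContinuousOn (fun Y => deriv Φ (U Y)) openLeftHalfPlane := hΦd.comp_continuousOn cU
  have cΨR := hΨo.continuousOn_partialR hO
  have cΨZ := hΨo.continuousOn_partialZ hO
  have cE : ContinuousOn (fun Y => deriv Φ (U Y) * (σ * U Y) + 2 * γ * Φ (U Y))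
      openLeftHalfPlane :=
    (cΦ'.mul (continuousOn_const.mul cU)).add (continuousOn_const.mul cΦ)
  have iE : ∀ n, 0 < n → Integrable
      (fun Y => χ n Y * (deriv Φ (U Y) * (σ * U Y) + 2 * γ * Φ (U Y))) := fun n hn =>
    (continuous_cutoff_mul hO (hχ n).continuous (hχO n hn) cE).integrable_of_hasCompactSupport
      (hχc n).mul_right
  have contΦ : ∀ n, 0 < n → Continuous (fun Y => χ n Y * Φ (U Y)) := fun n hn =>
    continuous_cutoff_mul hO (hχ n).continuous (hχO n hn) cΦ
  have iΦ : ∀ n, 0 < n → Integrable (fun Y => χ n Y * Φ (U Y)) := fun n hn =>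
    (contΦ n hn).integrable_of_hasCompactSupport (hχc n).mul_right
  have hχnn : ∀ n Y, 0 ≤ χ n Y := fun n Y => mul_nonneg (stepProfile_nonneg _) (hκ01 Y).1
  -- lower bound
  obtain ⟨N, hN0, hN⟩ : ∃ N : ℝ, 0 < N ∧ N * Y₀.1 ≤ -2 := by
    have hY₀' : Y₀.1 < 0 := hY₀
    refine ⟨2 / -Y₀.1, by apply div_pos <;> linarith, ?_⟩
    rw [div_mul_eq_mul_div, div_neg, mul_div_assoc, div_self hY₀'.ne]; norm_num
  have hpos : 0 < ∫ Y, χ N Y * Φ (U Y) := by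
    refine (contΦ N hN0).integral_pos_of_hasCompactSupport_nonneg_nonzero (hχc N).mul_right
      (fun Y => mul_nonneg (hχnn N Y) (truncPow_nonneg _ _ _)) (x := Y₀) ?_
    have h1 : Φ (U Y₀) ≠ 0 := (truncPow_pos m hε).ne'
    have h2 : Y₀ ∈ Metric.closedBall (0 : ℝ × ℝ) M := by
      by_contra hn
      exact h1 (hM' Y₀ (openLeftHalfPlane_subset hY₀) hn)
    have h3 : χ N Y₀ = 1 := by
      simp only [χ, boundaryCutoff]
      rw [stepProfile_eq_one hN, hκM _ h2, one_mul]
    rw [h3, one_mul]; exact h1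
  -- The cutoffs increase with `n`, and the signed integrand dominates `2γ Φ(U) ≥ 0`, so the value
  -- at the fixed parameter `N` is a lower bound for all larger `n`.
  have hlow : ∀ n, N ≤ n → 2 * γ * (∫ Y, χ N Y * Φ (U Y)) ≤
      e * ∫ Y, χ n Y * (deriv Φ (U Y) * (σ * U Y) + 2 * γ * Φ (U Y)) := by
    intro n hn
    have hn0 : 0 < n := hN0.trans_le hn
    rw [← integral_const_mul, ← integral_const_mul]
    refine integral_mono ((iΦ N hN0).const_mul _) ((iE n hn0).const_mul _) fun Y => ?_
    have h1 := hsign ε hε0 (U Y)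
    have h2 : χ N Y ≤ χ n Y := by
      simp only [χ, boundaryCutoff]
      refine mul_le_mul_of_nonneg_right ?_ (hκ01 Y).1
      rcases le_or_gt 0 Y.1 with h0 | h0
      · rw [stepProfile_eq_zero (by nlinarith)]; exact stepProfile_nonneg _
      · exact stepProfile_antitone (by nlinarith)
    have h3 : 0 ≤ 2 * γ * Φ (U Y) := mul_nonneg (by positivity) (truncPow_nonneg _ _ _)
    calc 2 * γ * (χ N Y * Φ (U Y)) = χ N Y * (2 * γ * Φ (U Y)) := by ring
      _ ≤ χ n Y * (2 * γ * Φ (U Y)) := mul_le_mul_of_nonneg_right h2 h3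
      _ ≤ χ n Y * (e * (deriv Φ (U Y) * (σ * U Y) + 2 * γ * Φ (U Y))) :=
        mul_le_mul_of_nonneg_left h1 (hχnn n Y)
      _ = _ := by ring
  -- the boundary term is small
  have hGc : ContinuousOn (fun Y : ℝ × ℝ => γ * Y.1 - (profileGrad Ψ Y).2) leftHalfPlane :=
    (continuous_const.mul continuous_fst).continuousOn.sub
      (continuous_snd.comp_continuousOn (continuousOn_profileGrad hΨ))
  have hstrip1 : boundaryStrip 2 M ⊆ leftHalfPlane := fun Y hY => hY.1.2
  obtain ⟨B, hB0, hB⟩ := exists_forall_abs_le (isCompact_boundaryStrip 2 M)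
    ((hΦ.continuous.comp_continuousOn hU.continuousOn).mono hstrip1)
  have hB' : ∀ Y ∈ boundaryStrip 2 M, |Φ (U Y)| ≤ B := hB
  -- The boundary term will be at most `B η n D` times the area `4M / n`, so `n` cancels. The `+ 1`
  -- keeps the denominator positive if `B D M = 0`.
  obtain ⟨η, hη0, hη⟩ : ∃ η, 0 < η ∧ B * (η * D) * (4 * M) < 2 * γ * ∫ Y, χ N Y * Φ (U Y) := by
    have hp : 0 < 2 * γ * ∫ Y, χ N Y * Φ (U Y) := by positivity
    refine ⟨(2 * γ * ∫ Y, χ N Y * Φ (U Y)) / (2 * (B * D * (4 * M) + 1)), by positivity, ?_⟩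
    set I := 2 * γ * ∫ Y, χ N Y * Φ (U Y)
    have hq : 0 ≤ B * D * (4 * M) := by positivity
    rw [show B * (I / (2 * (B * D * (4 * M) + 1)) * D) * (4 * M)
      = I * ((B * D * (4 * M)) / (2 * (B * D * (4 * M) + 1))) by ring]
    have : (B * D * (4 * M)) / (2 * (B * D * (4 * M) + 1)) < 1 := by
      rw [div_lt_one (by positivity)]; linarith
    nlinarith
  -- Uniform continuity up to the boundary makes the normal drift at most `η` on a thin strip; this
  -- uses that `Ψ` is `C¹` on the closed half-plane.
  obtain ⟨d, hd0, hd⟩ := Metric.uniformContinuousOn_iff.1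
    ((isCompact_boundaryStrip 2 M).uniformContinuousOn_of_continuous (hGc.mono hstrip1)) η hη0
  obtain ⟨n, hn1, hn2, hn3⟩ : ∃ n : ℝ, N ≤ n ∧ 2 ≤ n ∧ 2 / n < d := by
    refine ⟨max N (max 2 (4 / d)), le_max_left _ _, (le_max_left _ _).trans (le_max_right _ _), ?_⟩
    have h1 : 4 / d ≤ max N (max 2 (4 / d)) := (le_max_right _ _).trans (le_max_right _ _)
    have h2 : 0 < max N (max 2 (4 / d)) := lt_of_lt_of_le (by positivity) h1
    rw [div_lt_iff₀ h2]
    rw [div_le_iff₀ hd0] at h1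
    linarith
  have hn0 : 0 < n := by linarith
  have hsub : ∀ Y ∈ boundaryStrip n M, Y ∈ boundaryStrip 2 M := fun Y hY =>
    ⟨⟨le_trans (by rw [neg_div, neg_div, neg_le_neg_iff]; gcongr) hY.1.1, hY.1.2⟩, hY.2⟩
  have hGη : ∀ Y ∈ boundaryStrip n M, |γ * Y.1 - (profileGrad Ψ Y).2| ≤ η := by
    intro Y hY
    have h0 : ((0 : ℝ), Y.2) ∈ boundaryStrip 2 M :=
      ⟨⟨by norm_num, le_rfl⟩, hY.2⟩
    have hdist : dist Y ((0 : ℝ), Y.2) < d := by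
      rw [Prod.dist_eq]
      simp only [dist_self, Real.dist_eq, sub_zero]
      refine max_lt ?_ hd0
      rw [abs_of_nonpos hY.1.2]
      have := hY.1.1
      rw [neg_div] at this
      linarith
    have := hd Y (hsub Y hY) _ h0 hdist
    rw [Real.dist_eq] at this
    simp only [mul_zero, hbc, sub_zero] at this
    exact this.le
  let b : ℝ × ℝ → ℝ := fun Y => Φ (U Y) * (γ * (Y.1 * partialR (χ n) Y + Y.2 * partialZ (χ n) Y))
    + (partialR (χ n) Y * Φ (U Y) * -partialZ Ψ Y + partialZ (χ n) Y * Φ (U Y) * partialR Ψ Y)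
  have hzero : ∀ Y, Y ∉ openLeftHalfPlane → partialR (χ n) Y = 0 ∧ partialZ (χ n) Y = 0 :=
    fun Y hY => ⟨partialR_eq_zero_of_notMem fun h => hY (hχO n hn0 h),
      partialZ_eq_zero_of_notMem fun h => hY (hχO n hn0 h)⟩
  have hb_eq : ∀ Y ∈ openLeftHalfPlane, Y ∈ Metric.closedBall (0 : ℝ × ℝ) M →
      b Y = Φ (U Y) * ((γ * Y.1 - (profileGrad Ψ Y).2) * (n * deriv stepProfile (n * Y.1))) := by
    intro Y hY hYM
    simp only [b]
    rw [hχR n Y hYM, hχZ n Y hYM, profileGrad_eq hY]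
    ring
  have hb0 : ∀ Y ∉ boundaryStrip n M, b Y = 0 := by
    intro Y hY
    by_cases hYO : Y ∈ openLeftHalfPlane
    · by_cases hYM : Y ∈ Metric.closedBall (0 : ℝ × ℝ) M
      · rw [hb_eq Y hYO hYM, deriv_stepProfile_eq_zero]
        · ring
        · intro h
          exact hY (mem_boundaryStrip_of hn0 h (mem_closedBall_zero_iff_abs.1 hYM).2)
      · simp only [b]
        rw [hM' Y (openLeftHalfPlane_subset hYO) hYM]
        ring
    · simp only [b]
      rw [(hzero Y hYO).1, (hzero Y hYO).2]
      ring
  have hbb : ∀ Y ∈ boundaryStrip n M, |b Y| ≤ B * (η * (n * D)) := by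
    intro Y hY
    by_cases hYO : Y ∈ openLeftHalfPlane
    · by_cases hYM : Y ∈ Metric.closedBall (0 : ℝ × ℝ) M
      · rw [hb_eq Y hYO hYM, abs_mul, abs_mul, abs_mul, abs_of_pos hn0]
        have h1 := hB' Y (hsub Y hY)
        have h2 := hGη Y hY
        have h3 := (hD (n * Y.1)).1
        gcongr
      · simp only [b]
        rw [hM' Y (openLeftHalfPlane_subset hYO) hYM]
        simp only [zero_mul, mul_zero, add_zero, abs_zero]
        positivity
    · simp only [b]
      rw [(hzero Y hYO).1, (hzero Y hYO).2]
      simp only [zero_mul, mul_zero, add_zero, abs_zero]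
      positivity
  have hbI := abs_integral_le_of_boundaryStrip hn0 hM0.le hb0 hbb
  have hw := hweak Φ hΦ (χ n) (hχ2 n) (hχc n) (hχO n hn0)
  have cχR : Continuous (partialR (χ n)) := (hχ1 n).continuous_partialR
  have cχZ : Continuous (partialZ (χ n)) := (hχ1 n).continuous_partialZ
  have sR := tsupport_partialR_subset.trans (hχO n hn0)
  have sZ := tsupport_partialZ_subset.trans (hχO n hn0)
  have kR : HasCompactSupport (partialR (χ n)) :=
    (hχc n).of_eq_zero fun Y => partialR_eq_zero_of_notMem
  have kZ : HasCompactSupport (partialZ (χ n)) :=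
    (hχc n).of_eq_zero fun Y => partialZ_eq_zero_of_notMem
  have int : ∀ (θ G : ℝ × ℝ → ℝ), Continuous θ → HasCompactSupport θ → tsupport θ ⊆ openLeftHalfPlane →
      ContinuousOn G openLeftHalfPlane → Integrable (fun Y => θ Y * G Y) := fun θ G h1 h2 h3 h4 =>
    (continuous_cutoff_mul hO h1 h3 h4).integrable_of_hasCompactSupport h2.mul_right
  have j1 : Integrable (fun Y => Φ (U Y) * (γ * (Y.1 * partialR (χ n) Y + Y.2 * partialZ (χ n) Y))) := by
    have := (int _ (fun Y => Φ (U Y) * (γ * Y.1)) cχR kR sR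
      (cΦ.mul (continuousOn_const.mul continuousOn_fst))).add
      (int _ (fun Y => Φ (U Y) * (γ * Y.2)) cχZ kZ sZ
      (cΦ.mul (continuousOn_const.mul continuousOn_snd)))
    refine this.congr (Eventually.of_forall fun Y => ?_)
    simp only [Pi.add_apply]; ring
  have j2 : Integrable (fun Y => partialR (χ n) Y * Φ (U Y) * -partialZ Ψ Y
      + partialZ (χ n) Y * Φ (U Y) * partialR Ψ Y) := by
    have := (int _ (fun Y => Φ (U Y) * -partialZ Ψ Y) cχR kR sR (cΦ.mul cΨZ.neg)).add
      (int _ (fun Y => Φ (U Y) * partialR Ψ Y) cχZ kZ sZ (cΦ.mul cΨR))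
    refine this.congr (Eventually.of_forall fun Y => ?_)
    simp only [Pi.add_apply]; ring
  rw [integral_add (iE n hn0) j1, add_assoc, ← integral_add j1 j2] at hw
  have hfin := hlow n hn1
  have hconst : B * (η * (n * D)) * (4 * M / n) = B * (η * D) * (4 * M) := by
    field_simp
  rw [hconst] at hbI
  have hab := abs_le.1 hbI
  simp only [b] at hab
  rcases he with rfl | rfl <;> linarith [hab.1, hab.2]

/-! ### Weak form of the stream function equation. -/

/-- The Laplacian on the plane. -/
def planeLaplacian (f : ℝ × ℝ → ℝ) (Y : ℝ × ℝ) : ℝ :=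
  partialR (partialR f) Y + partialZ (partialZ f) Y

lemma planeLaplacian_eq_zero_of_notMem {f : ℝ × ℝ → ℝ} {Y : ℝ × ℝ} (hY : Y ∉ tsupport f) :
    planeLaplacian f Y = 0 := by
  unfold planeLaplacian
  rw [partialR_eq_zero_of_notMem fun h => hY (tsupport_partialR_subset h),
    partialZ_eq_zero_of_notMem fun h => hY (tsupport_partialZ_subset h), add_zero]

lemma continuous_planeLaplacian {f : ℝ × ℝ → ℝ} (hf : ContDiff ℝ 2 f) :
    Continuous (planeLaplacian f) :=
  (ContDiff.partialR 1 (by exact_mod_cast hf) : ContDiff ℝ 1 (partialR f)).continuous_partialR.add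
    (ContDiff.partialZ 1 (by exact_mod_cast hf) : ContDiff ℝ 1 (partialZ f)).continuous_partialZ

set_option maxHeartbeats 400000 in
/-- Green's identity for the rescaled stream function equation. -/
lemma integral_stream_equation {O : Set (ℝ × ℝ)} (hO : IsOpen O) {g χ : ℝ × ℝ → ℝ} {x c : ℝ}
    (hpos : ∀ Y ∈ O, 1 / 2 ≤ 1 + x * Y.1) (hg : ContDiffOn ℝ 2 g O)
    (heq : ∀ Y ∈ O, planeLaplacian g Y + 3 * x / (1 + x * Y.1) * partialR g Y
      = -(3 * c / (1 + x * Y.1)))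
    (hχ : ContDiff ℝ 2 χ) (hχc : HasCompactSupport χ) (hχO : tsupport χ ⊆ O) :
    ∫ Y, (planeLaplacian χ Y * g Y - partialR χ Y * (3 * x / (1 + x * Y.1) * g Y)
      + χ Y * (3 * x ^ 2 / (1 + x * Y.1) ^ 2 * g Y) + χ Y * (3 * c / (1 + x * Y.1))) = 0 := by
  have hχ1 : ContDiff ℝ 1 χ := hχ.of_le (by norm_num)
  have hχR : ContDiff ℝ 1 (partialR χ) := ContDiff.partialR 1 (by exact_mod_cast hχ)
  have hχZ : ContDiff ℝ 1 (partialZ χ) := ContDiff.partialZ 1 (by exact_mod_cast hχ)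
  have hRO : tsupport (partialR χ) ⊆ O := tsupport_partialR_subset.trans hχO
  have hZO : tsupport (partialZ χ) ⊆ O := tsupport_partialZ_subset.trans hχO
  have cR : HasCompactSupport (partialR χ) := hχc.of_eq_zero fun Y => partialR_eq_zero_of_notMem
  have cZ : HasCompactSupport (partialZ χ) := hχc.of_eq_zero fun Y => partialZ_eq_zero_of_notMem
  have hg1 : ContDiffOn ℝ 1 g O := hg.of_le (by norm_num)
  have hgR : ContDiffOn ℝ 1 (partialR g) O :=
    ContDiffOn.partialR (n := 2) (m := 1) hO hg (by norm_num)
  have hgZ : ContDiffOn ℝ 1 (partialZ g) O :=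
    ContDiffOn.partialZ (n := 2) (m := 1) hO hg (by norm_num)
  have hq : ContDiffOn ℝ 1 (fun Y : ℝ × ℝ => 3 * x / (1 + x * Y.1)) O := by
    refine ContDiffOn.div contDiffOn_const (by fun_prop) fun Y hY => ?_
    have := hpos Y hY
    exact ne_of_gt (by linarith)
  -- With `q = 3x / (1 + xR)`, the identity is the divergence theorem for `g ∇χ - χ (∇g + (q g,
  -- 0))`; the derivative of `q` produces the term with `x²`.
  have hG : ContDiffOn ℝ 1 (fun Y => partialR g Y + 3 * x / (1 + x * Y.1) * g Y) O :=
    hgR.add (hq.mul hg1)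
  have a₁ := contDiff_cutoff_mul (n := 1) hO hχ1 hχO hG
  have a₂ := contDiff_cutoff_mul (n := 1) hO hχR hRO hg1
  have a₃ := contDiff_cutoff_mul (n := 1) hO hχ1 hχO hgZ
  have a₄ := contDiff_cutoff_mul (n := 1) hO hχZ hZO hg1
  have e₁ := integral_divergence_eq_zero a₁ a₃ hχc.mul_right hχc.mul_right
  have e₂ := integral_divergence_eq_zero a₂ a₄ cR.mul_right cZ.mul_right
  have i₁ := (integrable_partialR a₁ hχc.mul_right).add (integrable_partialZ a₃ hχc.mul_right)
  have i₂ := (integrable_partialR a₂ cR.mul_right).add (integrable_partialZ a₄ cZ.mul_right)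
  have e₃ := integral_sub i₂ i₁
  simp only [Pi.add_apply] at e₃
  rw [e₁, e₂, sub_zero] at e₃
  rw [← e₃]
  refine integral_congr_ae (Eventually.of_forall fun Y => ?_)
  beta_reduce
  rw [partialR_cutoff_mul hO hχ1 hχO hG, partialR_cutoff_mul hO hχR hRO hg1,
    partialZ_cutoff_mul hO hχ1 hχO hgZ, partialZ_cutoff_mul hO hχZ hZO hg1]
  by_cases hY : Y ∈ tsupport χ
  · have hYO := hχO hY
    have hne : 1 + x * Y.1 ≠ 0 := by have := hpos Y hYO; exact ne_of_gt (by linarith)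
    have dg : DifferentiableAt ℝ g Y :=
      (hg1.contDiffAt (hO.mem_nhds hYO)).differentiableAt (by norm_num)
    have dgR : DifferentiableAt ℝ (partialR g) Y :=
      (hgR.contDiffAt (hO.mem_nhds hYO)).differentiableAt (by norm_num)
    have h1 : HasDerivAt (fun s : ℝ => 1 + x * s) x Y.1 := by
      simpa using ((hasDerivAt_id Y.1).const_mul x).const_add 1
    have h2 := (hasDerivAt_const Y.1 (3 * x)).div h1 hne
    have e₄ : partialR (fun Y => partialR g Y + 3 * x / (1 + x * Y.1) * g Y) Y
        = partialR (partialR g) Y + ((0 * (1 + x * Y.1) - 3 * x * x) / (1 + x * Y.1) ^ 2 * g Y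
          + 3 * x / (1 + x * Y.1) * partialR g Y) :=
      partialR_eq_of_hasDerivAt ((hG.contDiffAt (hO.mem_nhds hYO)).differentiableAt (by norm_num))
        ((hasDerivAt_partialR dgR).add (h2.mul (hasDerivAt_partialR dg)))
    have e₅ := heq Y hYO
    rw [e₄]
    unfold planeLaplacian at e₅ ⊢
    have e₆ : (0 * (1 + x * Y.1) - 3 * x * x) / (1 + x * Y.1) ^ 2
        = -(3 * x ^ 2 / (1 + x * Y.1) ^ 2) := by ring
    rw [e₆]
    linear_combination (χ Y) * e₅
  · simp [planeLaplacian_eq_zero_of_notMem hY, image_eq_zero_of_notMem_tsupport hY,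
      partialR_eq_zero_of_notMem hY, partialZ_eq_zero_of_notMem hY,
      partialR_eq_zero_of_notMem fun h => hY (tsupport_partialR_subset h),
      partialZ_eq_zero_of_notMem fun h => hY (tsupport_partialZ_subset h)]

/-- The weak form of the limit of the rescaled stream function equation without vorticity. -/
lemma StreamFamily.stream_weak_limit {l : Filter ℝ} [l.NeBot] [l.IsCountablyGenerated]
    {O : Set (ℝ × ℝ)} {F W : ℝ → ℝ × ℝ → ℝ} {Ψ₀ : ℝ × ℝ → ℝ} (h : StreamFamily l O F W Ψ₀)
    (hW : ∀ᶠ x in l, ∀ Y ∈ O, W x Y = 0) {k : ℕ} {A B : ℝ → ℝ} {c : ℝ} {Ψ : ℝ × ℝ → ℝ}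
    (hΨ : ContinuousOn Ψ O) (hB : ∀ᶠ x in l, x * B x = c * x ^ k)
    (hnear : ∀ K ⊆ O, IsCompact K → ∃ C, ∀ᶠ x in l, ∀ Y ∈ K,
      |F x Y - (A x + B x * Y.1) - x ^ k * Ψ Y| ≤ C * x ^ (k + 1))
    {χ : ℝ × ℝ → ℝ} (hχ : ContDiff ℝ 2 χ) (hχc : HasCompactSupport χ) (hχO : tsupport χ ⊆ O) :
    ∫ Y, (planeLaplacian χ Y * Ψ Y + χ Y * (3 * c)) = 0 := by
  have hO := h.isOpen
  set K := tsupport χ with hKdef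
  have hK : IsCompact K := hχc.isCompact
  have hχ1 : ContDiff ℝ 1 χ := hχ.of_le (by norm_num)
  -- The known lower orders `A + B R` are removed and the rest is divided by `x^k`, so that `g x`
  -- tends to `Ψ`. The drift acting on `B R` leaves the source `3c / (1 + xR)`, because `x B = c
  -- x^k`.
  let g : ℝ → ℝ × ℝ → ℝ := fun x Y => (x ^ k)⁻¹ * (F x Y - (A x + B x * Y.1))
  obtain ⟨C, hC⟩ := hnear K hχO hK
  have hgC : ∀ᶠ x in l, ∀ Y ∈ K, |g x Y - Ψ Y| ≤ C * x := by
    filter_upwards [hC, h.eventually_small] with x hx hxs Y hY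
    have hp : 0 < x ^ k := pow_pos hxs.1 k
    have e : g x Y - Ψ Y = (x ^ k)⁻¹ * (F x Y - (A x + B x * Y.1) - x ^ k * Ψ Y) := by
      simp only [g]; field_simp
    rw [e, abs_mul, abs_of_pos (inv_pos.2 hp), inv_mul_le_iff₀ hp]
    calc _ ≤ C * x ^ (k + 1) := hx Y hY
      _ = _ := by ring
  have hg2 : ∀ᶠ x in l, ContDiffOn ℝ 2 (g x) O := by
    filter_upwards [h.contDiffOn] with x hx
    exact contDiffOn_const.mul (hx.sub (by fun_prop))
  have hid : ∀ᶠ x in l, ∫ Y, (planeLaplacian χ Y * g x Y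
      - partialR χ Y * (3 * x / (1 + x * Y.1) * g x Y)
      + χ Y * (3 * x ^ 2 / (1 + x * Y.1) ^ 2 * g x Y) + χ Y * (3 * c / (1 + x * Y.1))) = 0 := by
    filter_upwards [h.contDiffOn, h.eq, hW, hB, h.eventually_small, h.pos, hg2]
      with x hF hex hWx hBx hxs hpos hgx
    refine integral_stream_equation hO hpos hgx (fun Y hY => ?_) hχ hχc hχO
    have hF1 : ContDiffOn ℝ 1 (F x) O := hF.of_le (by norm_num)
    have dF : ∀ y ∈ O, DifferentiableAt ℝ (F x) y := fun y hy =>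
      (hF1.contDiffAt (hO.mem_nhds hy)).differentiableAt (by norm_num)
    have dg : ∀ y ∈ O, DifferentiableAt ℝ (g x) y := fun y hy =>
      (hgx.contDiffAt (hO.mem_nhds hy)).differentiableAt (by norm_num)
    have hFR : ContDiffOn ℝ 1 (partialR (F x)) O :=
      ContDiffOn.partialR (n := 2) (m := 1) hO hF (by norm_num)
    have hFZ : ContDiffOn ℝ 1 (partialZ (F x)) O :=
      ContDiffOn.partialZ (n := 2) (m := 1) hO hF (by norm_num)
    have gR : ∀ y ∈ O, partialR (g x) y = (x ^ k)⁻¹ * (partialR (F x) y - B x) := fun y hy =>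
      partialR_eq_of_hasDerivAt (dg y hy) (by
        have h1 : HasDerivAt (fun s : ℝ => A x + B x * s) (B x) y.1 := by
          simpa using ((hasDerivAt_id y.1).const_mul (B x)).const_add (A x)
        exact ((hasDerivAt_partialR (dF y hy)).sub h1).const_mul _)
    have gZ : ∀ y ∈ O, partialZ (g x) y = (x ^ k)⁻¹ * partialZ (F x) y := fun y hy =>
      partialZ_eq_of_hasDerivAt (dg y hy)
        (((hasDerivAt_partialZ (dF y hy)).sub_const (A x + B x * y.1)).const_mul (x ^ k)⁻¹)
    have gRR : partialR (partialR (g x)) Y = (x ^ k)⁻¹ * partialR (partialR (F x)) Y := by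
      have he : partialR (g x) =ᶠ[𝓝 Y] fun y => (x ^ k)⁻¹ * (partialR (F x) y - B x) := by
        filter_upwards [hO.mem_nhds hY] with y hy using gR y hy
      have hd : DifferentiableAt ℝ (partialR (F x)) Y :=
        (hFR.contDiffAt (hO.mem_nhds hY)).differentiableAt (by norm_num)
      have : partialR (partialR (g x)) Y
          = partialR (fun y => (x ^ k)⁻¹ * (partialR (F x) y - B x)) Y := by
        rw [partialR, he.fderiv_eq]; rfl
      rw [this]
      exact partialR_eq_of_hasDerivAt ((hd.sub_const _).const_mul _)
        (((hasDerivAt_partialR hd).sub_const _).const_mul _)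
    have gZZ : partialZ (partialZ (g x)) Y = (x ^ k)⁻¹ * partialZ (partialZ (F x)) Y := by
      have he : partialZ (g x) =ᶠ[𝓝 Y] fun y => (x ^ k)⁻¹ * partialZ (F x) y := by
        filter_upwards [hO.mem_nhds hY] with y hy using gZ y hy
      have hd : DifferentiableAt ℝ (partialZ (F x)) Y :=
        (hFZ.contDiffAt (hO.mem_nhds hY)).differentiableAt (by norm_num)
      have : partialZ (partialZ (g x)) Y
          = partialZ (fun y => (x ^ k)⁻¹ * partialZ (F x) y) Y := by
        rw [partialZ, he.fderiv_eq]; rfl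
      rw [this]
      exact partialZ_eq_of_hasDerivAt (hd.const_mul _) ((hasDerivAt_partialZ hd).const_mul _)
    have e := hex Y hY
    rw [hWx Y hY] at e
    unfold planeLaplacian
    rw [gRR, gZZ, gR Y hY]
    have hp : x ^ k ≠ 0 := (pow_pos hxs.1 k).ne'
    have hq : (x ^ k)⁻¹ * (3 * x / (1 + x * Y.1) * B x) = 3 * c / (1 + x * Y.1) := by
      rw [inv_mul_eq_iff_eq_mul₀ hp]
      linear_combination (3 / (1 + x * Y.1)) * hBx
    linear_combination -(x ^ k)⁻¹ * e - hq
  obtain ⟨D, hD0, hD⟩ := exists_C1_bound hχ1 hχc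
  obtain ⟨E, hE0, hE⟩ := exists_forall_abs_le hK (hΨ.mono hχO)
  obtain ⟨L, hL0, hL⟩ := exists_forall_abs_le hK (continuous_planeLaplacian hχ).continuousOn
  have hgb : ∀ᶠ x in l, ∀ Y ∈ K, |g x Y| ≤ E + |C| := by
    filter_upwards [hgC, h.eventually_small] with x hx h1 Y hY
    have e1 := hx Y hY
    have e2 := hE Y hY
    have e3 : C * x ≤ |C| := by
      calc C * x ≤ |C| * x := mul_le_mul_of_nonneg_right (le_abs_self _) h1.1.le
        _ ≤ |C| := mul_le_of_le_one_right (abs_nonneg _) h1.2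
    calc |g x Y| = |Ψ Y + (g x Y - Ψ Y)| := by ring_nf
      _ ≤ |Ψ Y| + |g x Y - Ψ Y| := abs_add_le _ _
      _ ≤ _ := by linarith
  have lim : Tendsto (fun x => ∫ Y, (planeLaplacian χ Y * g x Y
      - partialR χ Y * (3 * x / (1 + x * Y.1) * g x Y)
      + χ Y * (3 * x ^ 2 / (1 + x * Y.1) ^ 2 * g x Y) + χ Y * (3 * c / (1 + x * Y.1)))) l
      (𝓝 (∫ Y, (planeLaplacian χ Y * Ψ Y + χ Y * (3 * c)))) := by
    refine tendsto_integral_of_uniform_compact_support hK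
      (C := L * (E + |C|) + D * (6 * (E + |C|)) + D * (12 * (E + |C|)) + D * (6 * |c|))
      ?_ ?_ ?_ ?_ ?_
    · filter_upwards [hg2, h.pos] with x hgx hpos
      have gc := hgx.continuousOn
      have hq : ContinuousOn (fun Y : ℝ × ℝ => (1 + x * Y.1)) O := by fun_prop
      have hne : ∀ Y ∈ O, 1 + x * Y.1 ≠ 0 := fun Y hY => by
        have := hpos Y hY; exact ne_of_gt (by linarith)
      have hq1 : ContinuousOn (fun Y : ℝ × ℝ => 3 * x / (1 + x * Y.1)) O :=
        continuousOn_const.div hq hne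
      have hq2 : ContinuousOn (fun Y : ℝ × ℝ => 3 * x ^ 2 / (1 + x * Y.1) ^ 2) O :=
        continuousOn_const.div (hq.pow 2) fun Y hY => pow_ne_zero _ (hne Y hY)
      have hq3 : ContinuousOn (fun Y : ℝ × ℝ => 3 * c / (1 + x * Y.1)) O :=
        continuousOn_const.div hq hne
      have sL : tsupport (planeLaplacian χ) ⊆ O := by
        refine (closure_minimal (fun Y hY => ?_) (isClosed_tsupport χ)).trans hχO
        by_contra hn
        exact hY (planeLaplacian_eq_zero_of_notMem hn)
      exact (((continuous_cutoff_mul hO (continuous_planeLaplacian hχ) sL gc).sub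
        (continuous_cutoff_mul hO hχ1.continuous_partialR (tsupport_partialR_subset.trans hχO)
          (hq1.mul gc))).add (continuous_cutoff_mul hO hχ.continuous hχO (hq2.mul gc))).add
        (continuous_cutoff_mul hO hχ.continuous hχO hq3)
    · refine Eventually.of_forall fun x Y hY => ?_
      simp [planeLaplacian_eq_zero_of_notMem hY, image_eq_zero_of_notMem_tsupport hY,
        partialR_eq_zero_of_notMem hY]
    · intro Y hY
      simp [planeLaplacian_eq_zero_of_notMem hY, image_eq_zero_of_notMem_tsupport hY]
    · filter_upwards [hgb, h.eventually_small, h.pos] with x hx hxs hpos Y hY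
      have hp := hpos Y (hχO hY)
      have hx0 := hxs.1.le
      have q1 : |3 * x / (1 + x * Y.1)| ≤ 6 := by
        rw [abs_of_nonneg (by positivity), div_le_iff₀ (by linarith)]; linarith [hxs.2]
      have q2 : |3 * x ^ 2 / (1 + x * Y.1) ^ 2| ≤ 12 := by
        rw [abs_of_nonneg (by positivity), div_le_iff₀ (by positivity)]
        nlinarith [hxs.2]
      have q3 : |3 * c / (1 + x * Y.1)| ≤ 6 * |c| := by
        rw [abs_div, abs_mul, abs_of_pos (by linarith : 0 < 1 + x * Y.1),
          div_le_iff₀ (by linarith), abs_of_pos (by norm_num : (0 : ℝ) < 3)]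
        nlinarith [abs_nonneg c]
      have g1 := hx Y hY
      have l1 := hL Y hY
      obtain ⟨d1, d2, -⟩ := hD Y
      refine (abs_add_le _ _).trans (add_le_add ((abs_add_le _ _).trans (add_le_add
        ((abs_sub _ _).trans (add_le_add ?_ ?_)) ?_)) ?_)
      · rw [abs_mul]; gcongr
      · rw [abs_mul, abs_mul]; gcongr
      · rw [abs_mul, abs_mul]; gcongr
      · rw [abs_mul]; gcongr
    · intro Y hY
      have t := tendsto_of_forall_abs_sub_le h.tendsto_zero hgC hY
      have t0 := h.tendsto_zero
      have t1 : Tendsto (fun x : ℝ => 1 + x * Y.1) l (𝓝 1) := by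
        simpa using (t0.mul_const Y.1).const_add 1
      have t2 : Tendsto (fun x : ℝ => 3 * x / (1 + x * Y.1)) l (𝓝 0) := by
        simpa [Pi.div_def] using (t0.const_mul 3).div t1 (by norm_num)
      have t3 : Tendsto (fun x : ℝ => 3 * x ^ 2 / (1 + x * Y.1) ^ 2) l (𝓝 0) := by
        simpa [Pi.div_def] using ((t0.pow 2).const_mul 3).div (t1.pow 2) (by norm_num)
      have t4 : Tendsto (fun x : ℝ => 3 * c / (1 + x * Y.1)) l (𝓝 (3 * c)) := by
        simpa [Pi.div_def] using (tendsto_const_nhds (x := 3 * c)).div t1 (by norm_num)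
      have := (((t.const_mul (planeLaplacian χ Y)).sub ((t2.mul t).const_mul (partialR χ Y))).add
        ((t3.mul t).const_mul (χ Y))).add (t4.const_mul (χ Y))
      simpa using this
  exact tendsto_nhds_unique lim (tendsto_const_nhds.congr' (by
    filter_upwards [hid] with x hx using hx.symm))

/-- Growth of smaller order than `‖Y‖`. -/
def IsSublinear (v : ℝ × ℝ → ℝ) : Prop := ∀ η > 0, ∃ C, 0 ≤ C ∧ ∀ Y, |v Y| ≤ η * ‖Y‖ + C

/-! ### Liouville's theorem for entire functions and harmonic functions of sublinear growth -/

/-- Cauchy's estimate on large circles. -/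
lemma deriv_eq_zero_of_sublinear {g : ℂ → ℂ} (hg : Differentiable ℂ g)
    (hs : ∀ η > 0, ∃ C, 0 ≤ C ∧ ∀ z, ‖g z‖ ≤ η * ‖z‖ + C) (c : ℂ) : deriv g c = 0 := by
  rw [← norm_le_zero_iff]
  refine le_of_forall_pos_le_add fun η hη => ?_
  obtain ⟨C, hC0, hC⟩ := hs (η / 2) (by positivity)
  -- Chosen so that `(η / 2) (‖c‖ + R) + C ≤ η R`; the `+ 1` makes the radius positive.
  set R : ℝ := ‖c‖ + 2 * C / η + 1 with hR
  have hR0 : 0 < R := by positivity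
  have h := Complex.norm_deriv_le_of_forall_mem_sphere_norm_le (c := c) (f := g) hR0
    hg.diffContOnCl (C := η / 2 * (‖c‖ + R) + C) (fun z hz => (hC z).trans (by
      have : ‖z‖ ≤ ‖c‖ + R := by
        have h1 : ‖z - c‖ = R := by simpa using hz
        calc ‖z‖ = ‖c + (z - c)‖ := by ring_nf
          _ ≤ _ := (norm_add_le _ _).trans (by rw [h1])
      gcongr))
  rw [zero_add]
  refine h.trans ?_
  rw [div_le_iff₀ hR0]
  have h2 : η * (2 * C / η) = 2 * C := by field_simp
  have : η * R = η * ‖c‖ + 2 * C + η := by rw [hR]; linear_combination h2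
  nlinarith [norm_nonneg c]

lemma norm_le_complex_norm (z : ℂ) : ‖(z.re, z.im)‖ ≤ ‖z‖ := by
  rw [Prod.norm_def]
  exact max_le (Complex.abs_re_le_norm z) (Complex.abs_im_le_norm z)

/-- `∂_R v - i ∂_Z v` is entire and of sublinear growth, hence constant. Thus `v` is affine, and an
affine function of sublinear growth is constant. -/
lemma harmonic_liouville {v : ℝ × ℝ → ℝ} (hv : ContDiff ℝ 2 v) (hΔ : ∀ Y, planeLaplacian v Y = 0)
    (h0 : IsSublinear v) (hR : IsSublinear (partialR v)) (hZ : IsSublinear (partialZ v)) :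
    ∀ Y, v Y = v 0 := by
  have hvR : ContDiff ℝ 1 (partialR v) := ContDiff.partialR 1 (by exact_mod_cast hv)
  have hvZ : ContDiff ℝ 1 (partialZ v) := ContDiff.partialZ 1 (by exact_mod_cast hv)
  let E : ℂ →L[ℝ] ℝ × ℝ := Complex.equivRealProdCLM.toContinuousLinearMap
  have hE : ∀ z : ℂ, E z = (z.re, z.im) := fun z => rfl
  let g : ℂ → ℂ := fun z => (partialR v (E z) : ℂ) - Complex.I * (partialZ v (E z) : ℂ)
  have hfd : ∀ z, HasFDerivAt g
      (Complex.ofRealCLM.comp ((fderiv ℝ (partialR v) (E z)).comp E)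
        - Complex.I • Complex.ofRealCLM.comp ((fderiv ℝ (partialZ v) (E z)).comp E)) z := by
    intro z
    have h1 : HasFDerivAt (fun z => partialR v (E z)) ((fderiv ℝ (partialR v) (E z)).comp E) z :=
      ((hvR.differentiable (by norm_num) (E z)).hasFDerivAt).comp z E.hasFDerivAt
    have h2 : HasFDerivAt (fun z => partialZ v (E z)) ((fderiv ℝ (partialZ v) (E z)).comp E) z :=
      ((hvZ.differentiable (by norm_num) (E z)).hasFDerivAt).comp z E.hasFDerivAt
    exact (Complex.ofRealCLM.hasFDerivAt.comp z h1).sub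
      ((Complex.ofRealCLM.hasFDerivAt.comp z h2).const_mul Complex.I)
  have hg : Differentiable ℂ g := by
    intro z
    rw [differentiableAt_complex_iff_differentiableAt_real]
    refine ⟨(hfd z).differentiableAt, ?_⟩
    rw [(hfd z).fderiv]
    have e1 : fderiv ℝ (partialR v) (E z) (0, 1) = fderiv ℝ (partialZ v) (E z) (1, 0) :=
      (partialR_partialZ_comm (hv.contDiffAt (x := E z))).symm
    have e2 : fderiv ℝ (partialZ v) (E z) (0, 1) = -fderiv ℝ (partialR v) (E z) (1, 0) := by
      have := hΔ (E z)
      unfold planeLaplacian at this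
      exact eq_neg_of_add_eq_zero_right this
    have hI : E Complex.I = (0, 1) := by simp [hE]
    have h1 : E 1 = (1, 0) := by simp [hE]
    simp only [sub_apply, ContinuousLinearMap.comp_apply, smul_apply, hI, h1, e1, e2, Complex.ofRealCLM_apply, smul_eq_mul]
    push_cast
    linear_combination (fderiv ℝ (partialZ v) (E z) (1, 0) : ℂ) * Complex.I_mul_I
  have hgs : ∀ η > 0, ∃ C, 0 ≤ C ∧ ∀ z, ‖g z‖ ≤ η * ‖z‖ + C := by
    intro η hη
    obtain ⟨C₁, hC₁, h₁⟩ := hR (η / 2) (by positivity)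
    obtain ⟨C₂, hC₂, h₂⟩ := hZ (η / 2) (by positivity)
    refine ⟨C₁ + C₂, by positivity, fun z => ?_⟩
    have hn : ‖E z‖ ≤ ‖z‖ := norm_le_complex_norm z
    have a1 : |partialR v (E z)| ≤ η / 2 * ‖z‖ + C₁ := (h₁ (E z)).trans (by gcongr)
    have a2 : |partialZ v (E z)| ≤ η / 2 * ‖z‖ + C₂ := (h₂ (E z)).trans (by gcongr)
    calc ‖g z‖ ≤ ‖(partialR v (E z) : ℂ)‖ + ‖Complex.I * (partialZ v (E z) : ℂ)‖ := norm_sub_le _ _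
      _ = |partialR v (E z)| + |partialZ v (E z)| := by simp
      _ ≤ _ := by linarith
  have hconst : ∀ z, g z = g 0 := fun z =>
    is_const_of_deriv_eq_zero hg (deriv_eq_zero_of_sublinear hg hgs) z 0
  have z0 : ((0 : ℝ), (0 : ℝ)) = 0 := rfl
  have hcR : ∀ Y, partialR v Y = partialR v 0 := by
    intro Y
    have := congrArg Complex.re (hconst ⟨Y.1, Y.2⟩)
    simpa [g, hE, z0] using this
  have hcZ : ∀ Y, partialZ v Y = partialZ v 0 := by
    intro Y
    have := congrArg Complex.im (hconst ⟨Y.1, Y.2⟩)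
    simpa [g, hE, z0] using this
  set a := partialR v 0
  set b := partialZ v 0
  have haff : ∀ Y : ℝ × ℝ, v Y = v 0 + a * Y.1 + b * Y.2 := by
    intro Y
    have hd := hv.differentiable (by norm_num)
    have s1 : ∀ s, v (s, Y.2) - a * s = v (0, Y.2) - a * 0 := fun s =>
      is_const_of_deriv_eq_zero (f := fun s => v (s, Y.2) - a * s)
        (fun s => ((hasDerivAt_partialR (hd (s, Y.2))).sub
          ((hasDerivAt_id s).const_mul a)).differentiableAt)
        (fun s => by
          have : HasDerivAt (fun s => v (s, Y.2) - a * s) (partialR v (s, Y.2) - a * 1) s :=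
            (hasDerivAt_partialR (hd (s, Y.2))).sub ((hasDerivAt_id s).const_mul a)
          rw [this.deriv, hcR, mul_one, sub_self]) s 0
    have s2 : ∀ s, v (0, s) - b * s = v (0, 0) - b * 0 := fun s =>
      is_const_of_deriv_eq_zero (f := fun s => v (0, s) - b * s)
        (fun s => ((hasDerivAt_partialZ (hd (0, s))).sub
          ((hasDerivAt_id s).const_mul b)).differentiableAt)
        (fun s => by
          have : HasDerivAt (fun s => v (0, s) - b * s) (partialZ v (0, s) - b * 1) s :=
            (hasDerivAt_partialZ (hd (0, s))).sub ((hasDerivAt_id s).const_mul b)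
          rw [this.deriv, hcZ, mul_one, sub_self]) s 0
    have e1 := s1 Y.1
    have e2 := s2 Y.2
    have e3 : v (Y.1, Y.2) = v Y := rfl
    have e4 : v (0, 0) = v 0 := rfl
    rw [← e3, ← e4]
    linarith
  have hlim : ∀ (α : ℝ), (∀ η > 0, ∃ C, 0 ≤ C ∧ ∀ s : ℝ, 0 ≤ s → |v 0 + α * s| ≤ η * s + C) →
      α = 0 := by
    intro α h
    by_contra hα
    obtain ⟨C, hC0, hC⟩ := h (|α| / 2) (by positivity)
    have hαp : 0 < |α| := abs_pos.2 hα
    set s := (2 * (C + |v 0| + 1)) / |α| with hs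
    have hs0 : 0 ≤ s := by positivity
    have h1 := hC s hs0
    have h2 : |α| * s = 2 * (C + |v 0| + 1) := by rw [hs]; field_simp
    have h3 : |α * s| ≤ |v 0 + α * s| + |v 0| := by
      calc |α * s| = |(v 0 + α * s) - v 0| := by ring_nf
        _ ≤ _ := abs_sub _ _
    rw [abs_mul, abs_of_nonneg hs0] at h3
    linarith
  have ha : a = 0 := hlim a fun η hη => by
    obtain ⟨C, hC0, hC⟩ := h0 η hη
    refine ⟨C, hC0, fun s hs => ?_⟩
    have := hC (s, 0)
    rw [haff (s, 0), Prod.norm_def] at this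
    simpa [abs_of_nonneg hs, hs] using this
  have hb : b = 0 := hlim b fun η hη => by
    obtain ⟨C, hC0, hC⟩ := h0 η hη
    refine ⟨C, hC0, fun s hs => ?_⟩
    have := hC (0, s)
    rw [haff (0, s), Prod.norm_def] at this
    simpa [abs_of_nonneg hs, hs] using this
  intro Y
  rw [haff Y, ha, hb]; ring

/-! ### Mollification -/

/-- The convolution of two real functions on the plane. -/
def planeConv (f ρ : ℝ × ℝ → ℝ) : ℝ × ℝ → ℝ :=
  convolution f ρ (ContinuousLinearMap.lsmul ℝ ℝ) volume

lemma planeConv_apply (f ρ : ℝ × ℝ → ℝ) (Y : ℝ × ℝ) :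
    planeConv f ρ Y = ∫ t, f t * ρ (Y - t) := rfl

lemma planeConv_apply' (f ρ : ℝ × ℝ → ℝ) (Y : ℝ × ℝ) :
    planeConv f ρ Y = ∫ t, f (Y - t) * ρ t := by
  unfold planeConv
  rw [convolution_eq_swap]
  rfl

/-- All derivatives fall on the kernel, so `f` need only be continuous. -/
lemma fderiv_planeConv_apply {f ρ : ℝ × ℝ → ℝ} (hf : Continuous f) (hρ : ContDiff ℝ 1 ρ)
    (hc : HasCompactSupport ρ) (Y w : ℝ × ℝ) :
    fderiv ℝ (planeConv f ρ) Y w = planeConv f (fun y => fderiv ℝ ρ y w) Y := by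
  have h := hc.hasFDerivAt_convolution_right (ContinuousLinearMap.lsmul ℝ ℝ)
    (hf.locallyIntegrable (μ := volume)) hρ Y
  have h' : HasFDerivAt (planeConv f ρ) _ Y := h
  rw [h'.fderiv, convolution_precompR_apply _ hf.locallyIntegrable (hc.fderiv ℝ)
    (hρ.continuous_fderiv (by norm_num))]
  rfl

lemma partialR_planeConv {f ρ : ℝ × ℝ → ℝ} (hf : Continuous f) (hρ : ContDiff ℝ 1 ρ)
    (hc : HasCompactSupport ρ) : partialR (planeConv f ρ) = planeConv f (partialR ρ) :=
  funext fun Y => fderiv_planeConv_apply hf hρ hc Y _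

lemma partialZ_planeConv {f ρ : ℝ × ℝ → ℝ} (hf : Continuous f) (hρ : ContDiff ℝ 1 ρ)
    (hc : HasCompactSupport ρ) : partialZ (planeConv f ρ) = planeConv f (partialZ ρ) :=
  funext fun Y => fderiv_planeConv_apply hf hρ hc Y _

lemma contDiff_planeConv {f ρ : ℝ × ℝ → ℝ} (hf : Continuous f) (hρ : ContDiff ℝ (⊤ : ℕ∞) ρ)
    (hc : HasCompactSupport ρ) : ContDiff ℝ (⊤ : ℕ∞) (planeConv f ρ) :=
  hc.contDiff_convolution_right _ hf.locallyIntegrable hρ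

lemma integrable_planeConv {f θ : ℝ × ℝ → ℝ} (hf : Continuous f) (hθ : Continuous θ)
    (hc : HasCompactSupport θ) (Y : ℝ × ℝ) : Integrable (fun t => f (Y - t) * θ t) :=
  Continuous.integrable_of_hasCompactSupport (by fun_prop) hc.mul_left

lemma ContDiff.partialR_top {f : ℝ × ℝ → ℝ} (hf : ContDiff ℝ (⊤ : ℕ∞) f) :
    ContDiff ℝ (⊤ : ℕ∞) (_root_.partialR f) :=
  contDiff_infty.2 fun n => ContDiff.partialR n (hf.of_le (by exact_mod_cast le_top))

lemma ContDiff.partialZ_top {f : ℝ × ℝ → ℝ} (hf : ContDiff ℝ (⊤ : ℕ∞) f) :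
    ContDiff ℝ (⊤ : ℕ∞) (_root_.partialZ f) :=
  contDiff_infty.2 fun n => ContDiff.partialZ n (hf.of_le (by exact_mod_cast le_top))

lemma partialR_comp_sub {ρ : ℝ × ℝ → ℝ} (hρ : Differentiable ℝ ρ) (Y t : ℝ × ℝ) :
    partialR (fun t => ρ (Y - t)) t = -partialR ρ (Y - t) := by
  refine partialR_eq_of_hasDerivAt (by fun_prop) ?_
  have h1 := hasDerivAt_partialR (hρ (Y - t))
  have h2 : HasDerivAt (fun s : ℝ => Y.1 - s) (-1) t.1 := by
    simpa using (hasDerivAt_id t.1).const_sub Y.1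
  have h3 : HasDerivAt (fun s => ρ (Y - (s, t.2))) (partialR ρ (Y - t) * -1) t.1 :=
    HasDerivAt.comp t.1 (h₂ := fun s => ρ (s, (Y - t).2)) (h := fun s : ℝ => Y.1 - s) h1 h2
  rwa [mul_neg_one] at h3

lemma partialZ_comp_sub {ρ : ℝ × ℝ → ℝ} (hρ : Differentiable ℝ ρ) (Y t : ℝ × ℝ) :
    partialZ (fun t => ρ (Y - t)) t = -partialZ ρ (Y - t) := by
  refine partialZ_eq_of_hasDerivAt (by fun_prop) ?_
  have h1 := hasDerivAt_partialZ (hρ (Y - t))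
  have h2 : HasDerivAt (fun s : ℝ => Y.2 - s) (-1) t.2 := by
    simpa using (hasDerivAt_id t.2).const_sub Y.2
  have h3 : HasDerivAt (fun s => ρ (Y - (t.1, s))) (partialZ ρ (Y - t) * -1) t.2 :=
    HasDerivAt.comp t.2 (h₂ := fun s => ρ ((Y - t).1, s)) (h := fun s : ℝ => Y.2 - s) h1 h2
  rwa [mul_neg_one] at h3

lemma planeLaplacian_comp_sub {ρ : ℝ × ℝ → ℝ} (hρ : ContDiff ℝ 2 ρ) (Y t : ℝ × ℝ) :
    planeLaplacian (fun t => ρ (Y - t)) t = planeLaplacian ρ (Y - t) := by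
  have hR : ContDiff ℝ 1 (partialR ρ) := ContDiff.partialR 1 (by exact_mod_cast hρ)
  have hZ : ContDiff ℝ 1 (partialZ ρ) := ContDiff.partialZ 1 (by exact_mod_cast hρ)
  have d := hρ.differentiable (by norm_num)
  have dR := hR.differentiable (by norm_num)
  have dZ := hZ.differentiable (by norm_num)
  have e1 : partialR (fun t => ρ (Y - t)) = fun t => -partialR ρ (Y - t) :=
    funext fun t => partialR_comp_sub d Y t
  have e2 : partialZ (fun t => ρ (Y - t)) = fun t => -partialZ ρ (Y - t) :=
    funext fun t => partialZ_comp_sub d Y t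
  unfold planeLaplacian
  rw [e1, e2]
  have n1 : partialR (fun t => -partialR ρ (Y - t)) t = -partialR (fun t => partialR ρ (Y - t)) t := by
    unfold partialR; rw [fderiv_fun_neg]; rfl
  have n2 : partialZ (fun t => -partialZ ρ (Y - t)) t = -partialZ (fun t => partialZ ρ (Y - t)) t := by
    unfold partialZ; rw [fderiv_fun_neg]; rfl
  rw [n1, n2, partialR_comp_sub dR, partialZ_comp_sub dZ, neg_neg, neg_neg]

/-- The function `t ↦ ρ (Y - t)` is an admissible test function in the weak equation. -/
lemma planeLaplacian_planeConv {f ρ : ℝ × ℝ → ℝ} (hf : Continuous f) (hρ : ContDiff ℝ (⊤ : ℕ∞) ρ)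
    (hc : HasCompactSupport ρ)
    (hweak : ∀ φ : ℝ × ℝ → ℝ, ContDiff ℝ (⊤ : ℕ∞) φ → HasCompactSupport φ →
      ∫ Y, f Y * planeLaplacian φ Y = 0) (Y : ℝ × ℝ) : planeLaplacian (planeConv f ρ) Y = 0 := by
  have h1 : ∀ {θ : ℝ × ℝ → ℝ}, ContDiff ℝ (⊤ : ℕ∞) θ → ContDiff ℝ 1 θ := fun h =>
    h.of_le (WithTop.coe_le_coe.2 le_top)
  have cR : HasCompactSupport (partialR ρ) := hc.of_eq_zero fun Y => partialR_eq_zero_of_notMem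
  have cZ : HasCompactSupport (partialZ ρ) := hc.of_eq_zero fun Y => partialZ_eq_zero_of_notMem
  have cRR : HasCompactSupport (partialR (partialR ρ)) :=
    cR.of_eq_zero fun Y => partialR_eq_zero_of_notMem
  have cZZ : HasCompactSupport (partialZ (partialZ ρ)) :=
    cZ.of_eq_zero fun Y => partialZ_eq_zero_of_notMem
  unfold planeLaplacian
  rw [partialR_planeConv hf (h1 hρ) hc, partialZ_planeConv hf (h1 hρ) hc,
    partialR_planeConv hf (h1 hρ.partialR_top) cR, partialZ_planeConv hf (h1 hρ.partialZ_top) cZ,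
    planeConv_apply, planeConv_apply]
  have hsub : Topology.IsClosedEmbedding (fun t : ℝ × ℝ => Y - t) :=
    (Homeomorph.subLeft Y).isClosedEmbedding
  have i1 : Integrable (fun t => f t * partialR (partialR ρ) (Y - t)) := by
    refine Continuous.integrable_of_hasCompactSupport ?_ (cRR.comp_isClosedEmbedding hsub).mul_left
    have := hρ.partialR_top.partialR_top.continuous
    fun_prop
  have i2 : Integrable (fun t => f t * partialZ (partialZ ρ) (Y - t)) := by
    refine Continuous.integrable_of_hasCompactSupport ?_ (cZZ.comp_isClosedEmbedding hsub).mul_left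
    have := hρ.partialZ_top.partialZ_top.continuous
    fun_prop
  rw [← integral_add i1 i2, ← hweak (fun t => ρ (Y - t)) (hρ.comp (by fun_prop))
    (hc.comp_isClosedEmbedding hsub)]
  refine integral_congr_ae (Eventually.of_forall fun t => ?_)
  beta_reduce
  rw [planeLaplacian_comp_sub (hρ.of_le (WithTop.coe_le_coe.2 le_top))]
  unfold planeLaplacian
  ring

/-- The kernel is arbitrary, so that the statement also applies to derivatives of a mollifier and
supplies the growth of the derivatives of the mollified increments. -/
lemma isSublinear_planeConv_sub {f θ : ℝ × ℝ → ℝ} (hf : Continuous f) (hθ : Continuous θ)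
    (hc : HasCompactSupport θ) {h : ℝ × ℝ} (hs : IsSublinear fun Y => f (Y + h) - f Y) :
    IsSublinear fun Y => planeConv f θ (Y + h) - planeConv f θ Y := by
  intro η hη
  set I := ∫ t, |θ t| with hI
  have hI0 : 0 ≤ I := integral_nonneg fun _ => abs_nonneg _
  have iθ : Integrable (fun t => |θ t|) := (hθ.integrable_of_hasCompactSupport hc).abs
  obtain ⟨M, hM⟩ : ∃ M, ∀ t ∈ tsupport θ, ‖t‖ ≤ M := hc.isCompact.isBounded.exists_norm_le
  -- The kernel has `L¹` norm `I`, possibly zero; dividing by `I + 1` absorbs it.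
  obtain ⟨C, hC0, hC⟩ := hs (η / (I + 1)) (by positivity)
  have hle : η / (I + 1) * I ≤ η := by
    rw [div_mul_eq_mul_div, div_le_iff₀ (by positivity)]; nlinarith
  refine ⟨(η / (I + 1) * |M| + C) * I, by positivity, fun Y => ?_⟩
  have e : planeConv f θ (Y + h) - planeConv f θ Y
      = ∫ t, (f (Y - t + h) - f (Y - t)) * θ t := by
    rw [planeConv_apply', planeConv_apply',
      ← integral_sub (integrable_planeConv hf hθ hc _) (integrable_planeConv hf hθ hc _)]
    refine integral_congr_ae (Eventually.of_forall fun t => ?_)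
    beta_reduce
    rw [show Y + h - t = Y - t + h by abel]; ring
  have hb : ∀ t, ‖(f (Y - t + h) - f (Y - t)) * θ t‖
      ≤ (η / (I + 1) * (‖Y‖ + |M|) + C) * |θ t| := by
    intro t
    rw [norm_mul, Real.norm_eq_abs, Real.norm_eq_abs]
    by_cases ht : t ∈ tsupport θ
    · refine mul_le_mul_of_nonneg_right ((hC (Y - t)).trans ?_) (abs_nonneg _)
      have : ‖Y - t‖ ≤ ‖Y‖ + |M| :=
        (norm_sub_le _ _).trans (by linarith [hM t ht, le_abs_self M])
      gcongr
    · rw [image_eq_zero_of_notMem_tsupport ht]; simp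
  beta_reduce
  rw [e, ← Real.norm_eq_abs]
  refine (norm_integral_le_of_norm_le (iθ.const_mul _) (Eventually.of_forall hb)).trans ?_
  rw [integral_const_mul, ← hI]
  have := mul_le_mul_of_nonneg_right hle (norm_nonneg Y)
  nlinarith

lemma planeConv_normed_tendsto {f : ℝ × ℝ → ℝ} (hf : Continuous f)
    {φ : ℕ → ContDiffBump (0 : ℝ × ℝ)} (hφ : Tendsto (fun i => (φ i).rOut) atTop (𝓝 0))
    (Y : ℝ × ℝ) : Tendsto (fun i => planeConv f ((φ i).normed volume) Y) atTop (𝓝 (f Y)) := by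
  refine (ContDiffBump.convolution_tendsto_right_of_continuous (μ := volume) hφ hf Y).congr
    fun i => ?_
  rw [planeConv_apply', convolution_def]
  refine integral_congr_ae (Eventually.of_forall fun t => ?_)
  simp [mul_comm]

/-- A continuous weakly harmonic function on the plane which vanishes on the line `R = 0` and whose
increments in `Z` grow sublinearly is a multiple of `R`. -/
theorem weakly_harmonic_liouville {f : ℝ × ℝ → ℝ} (hf : Continuous f)
    (hweak : ∀ φ : ℝ × ℝ → ℝ, ContDiff ℝ (⊤ : ℕ∞) φ → HasCompactSupport φ →
      ∫ Y, f Y * planeLaplacian φ Y = 0)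
    (hinc : ∀ h : ℝ, IsSublinear fun Y => f (Y + (0, h)) - f Y) (hzero : ∀ Z, f (0, Z) = 0) :
    ∀ R Z : ℝ, f (R, Z) = f (1, 0) * R := by
  have h1 : ∀ {n : ℕ} {θ : ℝ × ℝ → ℝ}, ContDiff ℝ (⊤ : ℕ∞) θ → ContDiff ℝ n θ := fun h =>
    h.of_le (by exact_mod_cast le_top)
  let φ : ℕ → ContDiffBump (0 : ℝ × ℝ) := fun i =>
    ⟨1 / (2 * ((i : ℝ) + 1)), 1 / ((i : ℝ) + 1), by positivity, by
      apply one_div_lt_one_div_of_lt <;> nlinarith [(Nat.cast_nonneg i : (0 : ℝ) ≤ i)]⟩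
  have hφ : Tendsto (fun i => (φ i).rOut) atTop (𝓝 0) := tendsto_one_div_add_atTop_nhds_zero_nat
  let u : ℕ → ℝ × ℝ → ℝ := fun i => planeConv f ((φ i).normed volume)
  have hρ : ∀ i, ContDiff ℝ (⊤ : ℕ∞) ((φ i).normed volume) := fun i => (φ i).contDiff_normed
  have hρ1 : ∀ i, ContDiff ℝ 1 ((φ i).normed volume) := fun i => h1 (n := 1) (hρ i)
  have hρc : ∀ i, HasCompactSupport ((φ i).normed volume) := fun i => (φ i).hasCompactSupport_normed
  have hu : ∀ i, ContDiff ℝ (⊤ : ℕ∞) (u i) := fun i => contDiff_planeConv hf (hρ i) (hρc i)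
  have hud : ∀ i, Differentiable ℝ (u i) := fun i => (hu i).differentiable (by simp)
  have hΔ : ∀ i Y, planeLaplacian (u i) Y = 0 := fun i Y =>
    planeLaplacian_planeConv hf (hρ i) (hρc i) hweak Y
  have hlim : ∀ Y, Tendsto (fun i => u i Y) atTop (𝓝 (f Y)) := fun Y =>
    planeConv_normed_tendsto hf hφ Y
  have shift : ∀ (h : ℝ × ℝ) (g : ℝ × ℝ → ℝ) (w Y : ℝ × ℝ), Differentiable ℝ g →
      fderiv ℝ (fun Y => g (Y + h) - g Y) Y w = fderiv ℝ g (Y + h) w - fderiv ℝ g Y w := by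
    intro h g w Y hg
    rw [fderiv_fun_sub (by fun_prop) (hg Y), fderiv_comp_add_right]
    rfl
  -- The vertical increments of a mollification are smooth, harmonic and sublinear together with
  -- their first derivatives, hence constant.
  have hv : ∀ i (h : ℝ) Y, u i (Y + (0, h)) - u i Y = u i (0 + (0, h)) - u i 0 := by
    intro i h
    have sR : partialR (fun Y => u i (Y + (0, h)) - u i Y)
        = fun Y => partialR (u i) (Y + (0, h)) - partialR (u i) Y :=
      funext fun Y => shift _ _ _ Y (hud i)
    have sZ : partialZ (fun Y => u i (Y + (0, h)) - u i Y)
        = fun Y => partialZ (u i) (Y + (0, h)) - partialZ (u i) Y :=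
      funext fun Y => shift _ _ _ Y (hud i)
    refine harmonic_liouville (v := fun Y => u i (Y + (0, h)) - u i Y) ?_ ?_ ?_ ?_ ?_
    · exact ((h1 (n := 2) (hu i)).comp (by fun_prop)).sub (h1 (n := 2) (hu i))
    · intro Y
      have e1 := hΔ i Y
      have e2 := hΔ i (Y + (0, h))
      unfold planeLaplacian at e1 e2 ⊢
      rw [sR, sZ]
      have t1 : partialR (fun Y => partialR (u i) (Y + (0, h)) - partialR (u i) Y) Y
          = partialR (partialR (u i)) (Y + (0, h)) - partialR (partialR (u i)) Y :=
        shift _ _ _ Y ((hu i).partialR_top.differentiable (by simp))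
      have t2 : partialZ (fun Y => partialZ (u i) (Y + (0, h)) - partialZ (u i) Y) Y
          = partialZ (partialZ (u i)) (Y + (0, h)) - partialZ (partialZ (u i)) Y :=
        shift _ _ _ Y ((hu i).partialZ_top.differentiable (by simp))
      rw [t1, t2]
      linarith
    · exact isSublinear_planeConv_sub hf (hρ i).continuous (hρc i) (hinc h)
    · rw [sR, partialR_planeConv hf (hρ1 i) (hρc i)]
      exact isSublinear_planeConv_sub hf (hρ1 i).continuous_partialR
        ((hρc i).of_eq_zero fun Y => partialR_eq_zero_of_notMem) (hinc h)
    · rw [sZ, partialZ_planeConv hf (hρ1 i) (hρc i)]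
      exact isSublinear_planeConv_sub hf (hρ1 i).continuous_partialZ
        ((hρc i).of_eq_zero fun Y => partialZ_eq_zero_of_notMem) (hinc h)
  -- In the limit the increment equals its value on the axis `R = 0`, where `f` vanishes, so `f`
  -- does not depend on `Z`.
  have hind : ∀ R Z : ℝ, f (R, Z) = f (R, 0) := by
    intro R Z
    have l1 := (hlim ((R, 0) + (0, Z))).sub (hlim (R, 0))
    have l2 := (hlim (0 + (0, Z))).sub (hlim 0)
    have l3 := tendsto_nhds_unique (l1.congr fun i => hv i Z (R, 0)) l2
    have z1 : f (0 + (0, Z)) = 0 := by rw [zero_add]; exact hzero Z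
    have z2 : f 0 = 0 := hzero 0
    rw [z1, z2, Prod.mk_add_mk, add_zero, zero_add] at l3
    linarith
  have huZ : ∀ i Y h, u i (Y + (0, h)) = u i Y := by
    intro i Y h
    simp only [u]
    rw [planeConv_apply', planeConv_apply']
    refine integral_congr_ae (Eventually.of_forall fun t => ?_)
    beta_reduce
    congr 1
    rw [show f (Y + (0, h) - t) = f ((Y + (0, h) - t).1, (Y + (0, h) - t).2) from rfl,
      show f (Y - t) = f ((Y - t).1, (Y - t).2) from rfl, hind, hind (Y - t).1]
    simp
  have hpZ : ∀ i Y, partialZ (u i) Y = 0 := by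
    intro i Y
    refine partialZ_eq_of_hasDerivAt (hud i Y) ?_
    have : (fun s => u i (Y.1, s)) = fun _ => u i (Y.1, 0) := by
      funext s
      have := huZ i (Y.1, 0) s
      rwa [Prod.mk_add_mk, add_zero, zero_add] at this
    rw [this]
    exact hasDerivAt_const _ _
  -- The mollifications do not depend on `Z` either, so harmonicity reduces to `∂_R² u = 0` and they
  -- are affine in `R`.
  have hRR : ∀ i Y, partialR (partialR (u i)) Y = 0 := by
    intro i Y
    have e := hΔ i Y
    unfold planeLaplacian at e
    have : partialZ (u i) = fun _ => 0 := funext (hpZ i)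
    rw [this] at e
    have e' : partialZ (fun _ : ℝ × ℝ => (0 : ℝ)) Y = 0 := by unfold partialZ; simp
    linarith
  have haff : ∀ i R, u i (R, 0) - u i 0 = R * (u i (1, 0) - u i 0) := by
    intro i
    set a := partialR (u i) 0
    have s1 : ∀ s, partialR (u i) (s, 0) = a := fun s =>
      is_const_of_deriv_eq_zero (f := fun s => partialR (u i) (s, 0))
        (fun s => (hasDerivAt_partialR ((hu i).partialR_top.differentiable (by simp)
          (s, 0))).differentiableAt)
        (fun s => by
          rw [(hasDerivAt_partialR ((hu i).partialR_top.differentiable (by simp) (s, 0))).deriv,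
            hRR]) s 0
    have s2 : ∀ s, u i (s, 0) - a * s = u i (0, 0) - a * 0 := fun s =>
      is_const_of_deriv_eq_zero (f := fun s => u i (s, 0) - a * s)
        (fun s => ((hasDerivAt_partialR (hud i (s, 0))).sub
          ((hasDerivAt_id s).const_mul a)).differentiableAt)
        (fun s => by
          have : HasDerivAt (fun s => u i (s, 0) - a * s) (partialR (u i) (s, 0) - a * 1) s :=
            (hasDerivAt_partialR (hud i (s, 0))).sub ((hasDerivAt_id s).const_mul a)
          rw [this.deriv, s1, mul_one, sub_self]) s 0
    intro R
    have e1 := s2 R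
    have e2 := s2 1
    have e3 : u i (0, 0) = u i 0 := rfl
    rw [e3] at e1 e2
    linear_combination e1 - R * e2
  intro R Z
  rw [hind R Z]
  have l1 := (hlim (R, 0)).sub (hlim 0)
  have l2 := ((hlim (1, 0)).sub (hlim 0)).const_mul R
  have l3 := tendsto_nhds_unique (l1.congr fun i => haff i R) l2
  have z2 : f 0 = 0 := hzero 0
  rw [z2] at l3
  linarith

/-! ### A Liouville theorem for the stream function profiles -/

lemma euclNorm_le (Y : ℝ × ℝ) : euclNorm Y ≤ 2 * ‖Y‖ := by
  have h1 : |Y.1| ≤ ‖Y‖ := norm_fst_le Y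
  have h2 : |Y.2| ≤ ‖Y‖ := norm_snd_le Y
  unfold euclNorm
  refine Real.sqrt_le_iff.2 ⟨by positivity, ?_⟩
  rw [← sq_abs Y.1, ← sq_abs Y.2]
  nlinarith [abs_nonneg Y.1, abs_nonneg Y.2, norm_nonneg Y]

lemma abs_fst_le_euclNorm (Y : ℝ × ℝ) : |Y.1| ≤ euclNorm Y :=
  Real.abs_le_sqrt (by nlinarith [sq_nonneg Y.2])

lemma abs_snd_le_euclNorm (Y : ℝ × ℝ) : |Y.2| ≤ euclNorm Y :=
  Real.abs_le_sqrt (by nlinarith [sq_nonneg Y.1])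

/-- Near infinity this is the little-o condition, with `η / 2` to pay for `euclNorm Y ≤ 2 ‖Y‖`; on
the remaining compact set the gradient is bounded because it is continuous up to the boundary. -/
lemma profileGrad_growth {Ψ : ℝ × ℝ → ℝ} (hΨ : ContDiffOn ℝ 1 Ψ leftHalfPlane)
    (hgrad : (fun Y => euclNorm (profileGrad Ψ Y)) =o[profileInfinity] euclNorm) {η : ℝ}
    (hη : 0 < η) : ∃ C, 0 ≤ C ∧ ∀ Y ∈ leftHalfPlane,
      |(profileGrad Ψ Y).1| ≤ η * ‖Y‖ + C ∧ |(profileGrad Ψ Y).2| ≤ η * ‖Y‖ + C := by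
  have h1 := hgrad.def (half_pos hη)
  unfold profileInfinity at h1
  rw [eventually_inf_principal] at h1
  obtain ⟨r, hr⟩ := Metric.closedBall_compl_subset_of_mem_cocompact h1 (0 : ℝ × ℝ)
  have hcl : IsClosed leftHalfPlane := isClosed_le continuous_fst continuous_const
  have hK : IsCompact (leftHalfPlane ∩ Metric.closedBall (0 : ℝ × ℝ) r) :=
    (isCompact_closedBall _ _).inter_left hcl
  have hc := (continuousOn_profileGrad hΨ).mono
    (inter_subset_left : leftHalfPlane ∩ Metric.closedBall (0 : ℝ × ℝ) r ⊆ _)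
  obtain ⟨C₁, hC₁, h₁⟩ := exists_forall_abs_le hK (continuous_fst.comp_continuousOn hc)
  obtain ⟨C₂, hC₂, h₂⟩ := exists_forall_abs_le hK (continuous_snd.comp_continuousOn hc)
  refine ⟨C₁ + C₂, by positivity, fun Y hY => ?_⟩
  have hp : 0 ≤ η * ‖Y‖ := by positivity
  by_cases hYr : Y ∈ Metric.closedBall (0 : ℝ × ℝ) r
  · have a1 : |(profileGrad Ψ Y).1| ≤ C₁ := h₁ Y ⟨hY, hYr⟩
    have a2 : |(profileGrad Ψ Y).2| ≤ C₂ := h₂ Y ⟨hY, hYr⟩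
    constructor <;> linarith
  · have h3 : ‖euclNorm (profileGrad Ψ Y)‖ ≤ η / 2 * ‖euclNorm Y‖ := hr hYr hY
    have e1 : ∀ X, ‖euclNorm X‖ = euclNorm X := fun X =>
      by rw [Real.norm_eq_abs, abs_of_nonneg (show 0 ≤ euclNorm X from Real.sqrt_nonneg _)]
    rw [e1, e1] at h3
    have h4 := euclNorm_le Y
    have h5 : euclNorm (profileGrad Ψ Y) ≤ η * ‖Y‖ := by nlinarith
    exact ⟨((abs_fst_le_euclNorm _).trans h5).trans (by linarith),
      ((abs_snd_le_euclNorm _).trans h5).trans (by linarith)⟩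

/-- Vertical lines stay in the closed half-plane, so the derivative in `Z` is two-sided even on the
boundary. -/
lemma hasDerivAt_profile_snd {Ψ : ℝ × ℝ → ℝ} (hΨ : ContDiffOn ℝ 1 Ψ leftHalfPlane) {R : ℝ}
    (hR : R ≤ 0) (Z : ℝ) : HasDerivAt (fun s => Ψ (R, s)) (profileGrad Ψ (R, Z)).2 Z := by
  have h1 : HasFDerivWithinAt Ψ (fderivWithin ℝ Ψ leftHalfPlane (R, Z)) leftHalfPlane (R, Z) :=
    ((hΨ.differentiableOn (by norm_num)) (R, Z) hR).hasFDerivWithinAt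
  have h2 : HasDerivAt (fun s : ℝ => (R, s)) ((0 : ℝ), (1 : ℝ)) Z :=
    (hasDerivAt_const _ _).prodMk (hasDerivAt_id _)
  exact HasFDerivWithinAt.comp_hasDerivAt (f := fun s : ℝ => (R, s)) Z h1 h2
    (Eventually.of_forall fun _ => hR)

lemma hasDerivWithinAt_profile_fst {Ψ : ℝ × ℝ → ℝ} (hΨ : ContDiffOn ℝ 1 Ψ leftHalfPlane) {R : ℝ}
    (hR : R ≤ 0) (Z : ℝ) :
    HasDerivWithinAt (fun s => Ψ (s, Z)) (profileGrad Ψ (R, Z)).1 (Iic 0) R := by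
  have h1 : HasFDerivWithinAt Ψ (fderivWithin ℝ Ψ leftHalfPlane (R, Z)) leftHalfPlane (R, Z) :=
    ((hΨ.differentiableOn (by norm_num)) (R, Z) hR).hasFDerivWithinAt
  have h2 : HasDerivWithinAt (fun s : ℝ => (s, Z)) ((1 : ℝ), (0 : ℝ)) (Iic 0) R :=
    ((hasDerivAt_id _).prodMk (hasDerivAt_const _ _)).hasDerivWithinAt
  exact HasFDerivWithinAt.comp_hasDerivWithinAt (f := fun s : ℝ => (s, Z)) R h1 h2
    fun s hs => hs

lemma planeLaplacian_mul {χ ψ : ℝ × ℝ → ℝ} (hχ : ContDiff ℝ 2 χ) (hψ : ContDiff ℝ 2 ψ)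
    (Y : ℝ × ℝ) : planeLaplacian (fun Y => χ Y * ψ Y) Y = planeLaplacian χ Y * ψ Y
      + 2 * (partialR χ Y * partialR ψ Y + partialZ χ Y * partialZ ψ Y)
      + χ Y * planeLaplacian ψ Y := by
  have dχ := hχ.differentiable (by norm_num)
  have dψ := hψ.differentiable (by norm_num)
  have dχR := (ContDiff.partialR 1 (by exact_mod_cast hχ) :
    ContDiff ℝ 1 (partialR χ)).differentiable (by norm_num)
  have dχZ := (ContDiff.partialZ 1 (by exact_mod_cast hχ) :
    ContDiff ℝ 1 (partialZ χ)).differentiable (by norm_num)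
  have dψR := (ContDiff.partialR 1 (by exact_mod_cast hψ) :
    ContDiff ℝ 1 (partialR ψ)).differentiable (by norm_num)
  have dψZ := (ContDiff.partialZ 1 (by exact_mod_cast hψ) :
    ContDiff ℝ 1 (partialZ ψ)).differentiable (by norm_num)
  have e1 : partialR (fun Y => χ Y * ψ Y) = fun Y => partialR χ Y * ψ Y + χ Y * partialR ψ Y :=
    funext fun Y => partialR_mul (dχ Y) (dψ Y)
  have e2 : partialZ (fun Y => χ Y * ψ Y) = fun Y => partialZ χ Y * ψ Y + χ Y * partialZ ψ Y :=
    funext fun Y => partialZ_mul (dχ Y) (dψ Y)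
  have e3 : partialR (fun Y => partialR χ Y * ψ Y + χ Y * partialR ψ Y) Y
      = (partialR (partialR χ) Y * ψ Y + partialR χ Y * partialR ψ Y)
        + (partialR χ Y * partialR ψ Y + χ Y * partialR (partialR ψ) Y) :=
    partialR_eq_of_hasDerivAt (by fun_prop)
      (((hasDerivAt_partialR (dχR Y)).mul (hasDerivAt_partialR (dψ Y))).add
        ((hasDerivAt_partialR (dχ Y)).mul (hasDerivAt_partialR (dψR Y))))
  have e4 : partialZ (fun Y => partialZ χ Y * ψ Y + χ Y * partialZ ψ Y) Y
      = (partialZ (partialZ χ) Y * ψ Y + partialZ χ Y * partialZ ψ Y)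
        + (partialZ χ Y * partialZ ψ Y + χ Y * partialZ (partialZ ψ) Y) :=
    partialZ_eq_of_hasDerivAt (by fun_prop)
      (((hasDerivAt_partialZ (dχZ Y)).mul (hasDerivAt_partialZ (dψ Y))).add
        ((hasDerivAt_partialZ (dχ Y)).mul (hasDerivAt_partialZ (dψZ Y))))
  unfold planeLaplacian
  rw [e1, e2, e3, e4]
  ring

lemma planeLaplacian_boundaryCutoff (n : ℝ) (Y : ℝ × ℝ) :
    planeLaplacian (boundaryCutoff n) Y = n ^ 2 * deriv (deriv stepProfile) (n * Y.1) := by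
  have e1 : partialR (boundaryCutoff n) = fun Y => n * deriv stepProfile (n * Y.1) :=
    funext fun Y => partialR_boundaryCutoff n Y
  have e2 : partialZ (boundaryCutoff n) = fun _ => 0 := funext fun Y => partialZ_boundaryCutoff n Y
  have e3 : partialZ (fun _ : ℝ × ℝ => (0 : ℝ)) Y = 0 := by unfold partialZ; simp
  have hd : Differentiable ℝ (deriv stepProfile) :=
    contDiff_deriv_stepProfile.differentiable (by simp)
  have e4 : partialR (fun Y : ℝ × ℝ => n * deriv stepProfile (n * Y.1)) Y
      = n * (deriv (deriv stepProfile) (n * Y.1) * n) :=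
    partialR_eq_of_hasDerivAt (by fun_prop) (by
      have h1 : HasDerivAt (fun s : ℝ => n * s) n Y.1 := by
        simpa using (hasDerivAt_id Y.1).const_mul n
      exact (((hd (n * Y.1)).hasDerivAt).comp Y.1 h1).const_mul n)
  unfold planeLaplacian
  rw [e1, e2, e3, e4]
  ring

/-! ### Odd reflection across the boundary. -/

/-- Reflection of the plane in the line `R = 0`. -/
def reflectR : ℝ × ℝ ≃ₜ ℝ × ℝ := (Homeomorph.neg ℝ).prodCongr (Homeomorph.refl ℝ)

@[simp] lemma reflectR_apply (Y : ℝ × ℝ) : reflectR Y = (-Y.1, Y.2) := rfl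

lemma measurePreserving_reflectR : MeasurePreserving reflectR volume volume :=
  (Measure.measurePreserving_neg (volume : Measure ℝ)).prod (MeasurePreserving.id volume)

lemma contDiff_reflectR {n : WithTop ℕ∞} : ContDiff ℝ n reflectR :=
  (contDiff_fst.neg).prodMk contDiff_snd

lemma partialR_comp_reflectR {φ : ℝ × ℝ → ℝ} (hφ : Differentiable ℝ φ) (Y : ℝ × ℝ) :
    partialR (fun Y => φ (reflectR Y)) Y = -partialR φ (reflectR Y) :=
  partialR_eq_of_hasDerivAt ((hφ _).comp Y (contDiff_reflectR.differentiable (n := 1) (by norm_num) Y)) (by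
    have h3 : HasDerivAt (fun s => φ (-s, Y.2)) (partialR φ (reflectR Y) * -1) Y.1 :=
      HasDerivAt.comp Y.1 (h₂ := fun s => φ (s, Y.2)) (h := fun s : ℝ => -s)
        (hasDerivAt_partialR (hφ (reflectR Y))) (hasDerivAt_neg Y.1)
    rwa [mul_neg_one] at h3)

lemma partialZ_comp_reflectR {φ : ℝ × ℝ → ℝ} (hφ : Differentiable ℝ φ) (Y : ℝ × ℝ) :
    partialZ (fun Y => φ (reflectR Y)) Y = partialZ φ (reflectR Y) :=
  partialZ_eq_of_hasDerivAt ((hφ _).comp Y (contDiff_reflectR.differentiable (n := 1) (by norm_num) Y))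
    (hasDerivAt_partialZ (hφ (reflectR Y)))

lemma planeLaplacian_sub_reflectR {φ : ℝ × ℝ → ℝ} (hφ : ContDiff ℝ (⊤ : ℕ∞) φ) (Y : ℝ × ℝ) :
    planeLaplacian (fun Y => φ Y - φ (reflectR Y)) Y
      = planeLaplacian φ Y - planeLaplacian φ (reflectR Y) := by
  have d := hφ.differentiable (by simp)
  have dR := hφ.partialR_top.differentiable (by simp)
  have dZ := hφ.partialZ_top.differentiable (by simp)
  have dr : Differentiable ℝ reflectR := contDiff_reflectR.differentiable (n := 1) (by norm_num)
  have cmp : ∀ {g : ℝ × ℝ → ℝ}, Differentiable ℝ g → Differentiable ℝ fun Y => g (reflectR Y) :=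
    fun hg => hg.comp dr
  have e1 : partialR (fun Y => φ Y - φ (reflectR Y))
      = fun Y => partialR φ Y + partialR φ (reflectR Y) := funext fun Y => by
    have : partialR (fun Y => φ Y - φ (reflectR Y)) Y
        = partialR φ Y - partialR (fun Y => φ (reflectR Y)) Y := by
      unfold partialR; rw [fderiv_fun_sub (d Y) (cmp d Y)]; rfl
    rw [this, partialR_comp_reflectR d, sub_neg_eq_add]
  have e2 : partialZ (fun Y => φ Y - φ (reflectR Y))
      = fun Y => partialZ φ Y - partialZ φ (reflectR Y) := funext fun Y => by
    have : partialZ (fun Y => φ Y - φ (reflectR Y)) Y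
        = partialZ φ Y - partialZ (fun Y => φ (reflectR Y)) Y := by
      unfold partialZ; rw [fderiv_fun_sub (d Y) (cmp d Y)]; rfl
    rw [this, partialZ_comp_reflectR d]
  have e3 : partialR (fun Y => partialR φ Y + partialR φ (reflectR Y)) Y
      = partialR (partialR φ) Y - partialR (partialR φ) (reflectR Y) := by
    have : partialR (fun Y => partialR φ Y + partialR φ (reflectR Y)) Y
        = partialR (partialR φ) Y + partialR (fun Y => partialR φ (reflectR Y)) Y := by
      show fderiv ℝ (fun Y => partialR φ Y + partialR φ (reflectR Y)) Y (1, 0) = _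
      rw [fderiv_fun_add (dR Y) (cmp dR Y)]; rfl
    rw [this, partialR_comp_reflectR dR, sub_eq_add_neg]
  have e4 : partialZ (fun Y => partialZ φ Y - partialZ φ (reflectR Y)) Y
      = partialZ (partialZ φ) Y - partialZ (partialZ φ) (reflectR Y) := by
    have : partialZ (fun Y => partialZ φ Y - partialZ φ (reflectR Y)) Y
        = partialZ (partialZ φ) Y - partialZ (fun Y => partialZ φ (reflectR Y)) Y := by
      show fderiv ℝ (fun Y => partialZ φ Y - partialZ φ (reflectR Y)) Y (0, 1) = _
      rw [fderiv_fun_sub (dZ Y) (cmp dZ Y)]; rfl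
    rw [this, partialZ_comp_reflectR dZ]
  unfold planeLaplacian
  rw [e1, e2, e3, e4]
  ring

lemma abs_le_mul_abs_fst {ψ : ℝ × ℝ → ℝ} (hψ : Differentiable ℝ ψ) (h0 : ∀ Z, ψ (0, Z) = 0) {D : ℝ}
    (hD : ∀ Y, |partialR ψ Y| ≤ D) (Y : ℝ × ℝ) : |ψ Y| ≤ D * |Y.1| := by
  have h := convex_univ.norm_image_sub_le_of_norm_hasDerivWithin_le (C := D) (s := univ)
    (f := fun s => ψ (s, Y.2)) (f' := fun s => partialR ψ (s, Y.2)) (x := 0) (y := Y.1)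
    (fun s _ => (hasDerivAt_partialR (hψ (s, Y.2))).hasDerivWithinAt) (fun s _ => hD (s, Y.2))
    (mem_univ _) (mem_univ _)
  simpa [h0] using h

set_option maxHeartbeats 400000 in
/-- The odd reflection of a function which is weakly harmonic in the half-plane and vanishes
linearly at its boundary is weakly harmonic in the plane. -/
lemma weakly_harmonic_of_odd {f : ℝ × ℝ → ℝ} (hf : Continuous f)
    (hodd : ∀ Y, f (reflectR Y) = -f Y)
    (hlin : ∀ M : ℝ, ∃ C, 0 ≤ C ∧ ∀ Y ∈ boundaryStrip 2 M, |f Y| ≤ C * |Y.1|)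
    (hweak : ∀ χ : ℝ × ℝ → ℝ, ContDiff ℝ 2 χ → HasCompactSupport χ →
      tsupport χ ⊆ openLeftHalfPlane → ∫ Y, f Y * planeLaplacian χ Y = 0)
    {φ : ℝ × ℝ → ℝ} (hφ : ContDiff ℝ (⊤ : ℕ∞) φ) (hφc : HasCompactSupport φ) :
    ∫ Y, f Y * planeLaplacian φ Y = 0 := by
  -- By oddness of `f`, the integral against `φ` over the plane is the integral against `ψ` over the
  -- left half-plane, and `ψ` vanishes on the boundary.
  let ψ : ℝ × ℝ → ℝ := fun Y => φ Y - φ (reflectR Y)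
  have hψ : ContDiff ℝ (⊤ : ℕ∞) ψ := hφ.sub (hφ.comp contDiff_reflectR)
  have hψc : HasCompactSupport ψ := hφc.sub (hφc.comp_homeomorph reflectR)
  have hψ2 : ContDiff ℝ 2 ψ := hψ.of_le (WithTop.coe_le_coe.2 le_top)
  have hψ1 : ContDiff ℝ 1 ψ := hψ.of_le (WithTop.coe_le_coe.2 le_top)
  have hφ2 : ContDiff ℝ 2 φ := hφ.of_le (WithTop.coe_le_coe.2 le_top)
  have hlap : ∀ {θ : ℝ × ℝ → ℝ}, ContDiff ℝ 2 θ → HasCompactSupport θ →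
      Integrable (fun Y => f Y * planeLaplacian θ Y) := fun h hc =>
    (hf.mul (continuous_planeLaplacian h)).integrable_of_hasCompactSupport
      (hc.of_eq_zero fun Y hY => by simp [planeLaplacian_eq_zero_of_notMem hY])
  have hmeas : MeasurableSet openLeftHalfPlane := isOpen_openLeftHalfPlane.measurableSet
  let L : ℝ × ℝ → ℝ := openLeftHalfPlane.indicator f
  have hLi : ∀ {θ : ℝ × ℝ → ℝ}, ContDiff ℝ 2 θ → HasCompactSupport θ →
      Integrable (fun Y => L Y * planeLaplacian θ Y) := fun {θ} h hc => by
    refine ((hlap h hc).indicator hmeas).congr (Eventually.of_forall fun Y => ?_)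
    simp only [L, indicator]
    split_ifs <;> simp
  have hL : ∀ Y, f Y = L Y - L (reflectR Y) := by
    intro Y
    simp only [L, indicator, openLeftHalfPlane, mem_ofPred_eq, reflectR_apply]
    rcases lt_trichotomy Y.1 0 with h | h | h
    · rw [if_pos h, if_neg (by linarith)]; ring
    · rw [if_neg (by linarith), if_neg (by linarith)]
      have h1 := hodd Y
      have h2 : reflectR Y = Y := by ext <;> simp [h]
      rw [h2] at h1
      linarith
    · rw [if_neg (by linarith), if_pos (by linarith)]
      have h1 := hodd Y
      rw [reflectR_apply] at h1
      linarith
  have hemb : MeasurableEmbedding reflectR := reflectR.measurableEmbedding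
  have hrr : ∀ Y, reflectR (reflectR Y) = Y := fun Y => by ext <;> simp
  have i2 : Integrable (fun Y => L Y * planeLaplacian φ (reflectR Y)) := by
    refine ((hLi hφ2 hφc).sub (hLi hψ2 hψc)).congr (Eventually.of_forall fun Y => ?_)
    simp only [Pi.sub_apply, ψ]
    rw [planeLaplacian_sub_reflectR hφ]; ring
  have i3 : Integrable (fun Y => L (reflectR Y) * planeLaplacian φ Y) := by
    have := (measurePreserving_reflectR.integrable_comp_emb hemb).2 i2
    refine this.congr (Eventually.of_forall fun Y => ?_)
    simp only [Function.comp_apply, hrr]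
  have key : ∫ Y, f Y * planeLaplacian φ Y = ∫ Y, L Y * planeLaplacian ψ Y := by
    have e1 : ∫ Y, L (reflectR Y) * planeLaplacian φ Y = ∫ Y, L Y * planeLaplacian φ (reflectR Y) := by
      rw [← measurePreserving_reflectR.integral_comp hemb]
      simp only [hrr]
    calc ∫ Y, f Y * planeLaplacian φ Y
        = ∫ Y, (L Y * planeLaplacian φ Y - L (reflectR Y) * planeLaplacian φ Y) := by
          refine integral_congr_ae (Eventually.of_forall fun Y => ?_)
          beta_reduce
          rw [hL Y]; ring
      _ = ∫ Y, (L Y * planeLaplacian φ Y - L Y * planeLaplacian φ (reflectR Y)) := by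
          rw [integral_sub (hLi hφ2 hφc) i3, integral_sub (hLi hφ2 hφc) i2, e1]
      _ = _ := by
          refine integral_congr_ae (Eventually.of_forall fun Y => ?_)
          simp only [ψ]
          rw [planeLaplacian_sub_reflectR hφ]; ring
  rw [key]
  obtain ⟨D, hD0, hD⟩ := exists_deriv_stepProfile_bound
  obtain ⟨D₁, hD₁0, hD₁⟩ := exists_C1_bound hψ1 hψc
  obtain ⟨B, hB0, hB⟩ := exists_forall_abs_le_of_hasCompactSupport (continuous_planeLaplacian hψ2)
    (hψc.of_eq_zero fun Y => planeLaplacian_eq_zero_of_notMem)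
  obtain ⟨M, hM0, hM⟩ : ∃ M, 0 ≤ M ∧ ∀ Y ∈ tsupport ψ, |Y.2| ≤ M :=
    exists_forall_abs_le hψc.isCompact continuous_snd.continuousOn
  obtain ⟨C, hC0, hC⟩ := hlin M
  have hψ0 : ∀ Z, ψ (0, Z) = 0 := fun Z => by simp [ψ]
  have hψR := abs_le_mul_abs_fst (hψ.differentiable (by simp)) hψ0 (fun Y => (hD₁ Y).2.1)
  -- Inserting `boundaryCutoff n` changes the Laplacian by terms of order `n` on the strip: `n² ψ`
  -- is of order `n` because `ψ = O(|R|)`. The factor `f = O(1 / n)` makes the integrand bounded,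
  -- and the strip has area of order `1 / n`.
  have hbound : ∀ n : ℝ, 2 ≤ n → |∫ Y, L Y * planeLaplacian ψ Y|
      ≤ (2 * C * (B + 4 * D * D₁)) * (4 * M / n) := by
    intro n hn
    have hn0 : 0 < n := by linarith
    have hχ : ContDiff ℝ 2 (boundaryCutoff n) :=
      (contDiff_boundaryCutoff n).of_le (WithTop.coe_le_coe.2 le_top)
    have hp2 : ContDiff ℝ 2 (fun Y => boundaryCutoff n Y * ψ Y) := hχ.mul hψ2
    have hpc : HasCompactSupport (fun Y => boundaryCutoff n Y * ψ Y) := hψc.mul_left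
    have hpO : tsupport (fun Y => boundaryCutoff n Y * ψ Y) ⊆ openLeftHalfPlane :=
      (tsupport_mul_subset_left (f := boundaryCutoff n) (g := ψ)).trans
        (tsupport_boundaryCutoff_subset hn0)
    have hz : ∫ Y, L Y * planeLaplacian (fun Y => boundaryCutoff n Y * ψ Y) Y = 0 := by
      rw [← hweak _ hp2 hpc hpO]
      refine integral_congr_ae (Eventually.of_forall fun Y => ?_)
      beta_reduce
      by_cases hY : Y ∈ openLeftHalfPlane
      · simp only [L]; rw [indicator_of_mem hY]
      · rw [planeLaplacian_eq_zero_of_notMem fun h => hY (hpO h)]; simp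
    have hdiff : ∫ Y, L Y * planeLaplacian ψ Y = ∫ Y, L Y * (planeLaplacian ψ Y
        - planeLaplacian (fun Y => boundaryCutoff n Y * ψ Y) Y) := by
      have := integral_sub (hLi hψ2 hψc) (hLi hp2 hpc)
      rw [hz, sub_zero] at this
      rw [← this]
      refine integral_congr_ae (Eventually.of_forall fun Y => ?_)
      beta_reduce; ring
    rw [hdiff]
    have hform : ∀ Y, planeLaplacian ψ Y - planeLaplacian (fun Y => boundaryCutoff n Y * ψ Y) Y
        = (1 - boundaryCutoff n Y) * planeLaplacian ψ Y
          - 2 * (n * deriv stepProfile (n * Y.1) * partialR ψ Y)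
          - n ^ 2 * deriv (deriv stepProfile) (n * Y.1) * ψ Y := by
      intro Y
      rw [planeLaplacian_mul hχ hψ2, planeLaplacian_boundaryCutoff, partialR_boundaryCutoff,
        partialZ_boundaryCutoff]
      ring
    refine abs_integral_le_of_boundaryStrip hn0 hM0 (fun Y hY => ?_) (fun Y hY => ?_)
    · by_cases hYO : Y ∈ openLeftHalfPlane
      · have hYO' : Y.1 < 0 := hYO
        by_cases hYs : Y ∈ tsupport ψ
        · have hlt : n * Y.1 < -2 := by
            by_contra hge
            refine hY ⟨⟨?_, hYO'.le⟩, abs_le.1 (hM Y hYs)⟩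
            rw [div_le_iff₀ hn0]; linarith
          have hnm : n * Y.1 ∉ Icc (-2 : ℝ) (-1) := fun h => by linarith [h.1]
          rw [hform, deriv_stepProfile_eq_zero hnm, deriv_deriv_stepProfile_eq_zero hnm]
          simp only [boundaryCutoff]
          rw [stepProfile_eq_one hlt.le]
          ring
        · rw [hform, planeLaplacian_eq_zero_of_notMem hYs, partialR_eq_zero_of_notMem hYs,
            image_eq_zero_of_notMem_tsupport hYs]
          ring
      · simp only [L]
        rw [indicator_of_notMem hYO, zero_mul]
    · have hR : |Y.1| ≤ 2 / n := by
        rw [abs_of_nonpos hY.1.2]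
        have := hY.1.1
        rw [neg_div] at this
        linarith
      have hY2 : Y ∈ boundaryStrip 2 M :=
        ⟨⟨le_trans (by rw [neg_div, neg_div, neg_le_neg_iff]; gcongr) hY.1.1, hY.1.2⟩, hY.2⟩
      have hLb : |L Y| ≤ C * (2 / n) := by
        have h1 : |L Y| ≤ |f Y| := by
          simp only [L, indicator]; split_ifs <;> simp
        exact h1.trans ((hC Y hY2).trans (by gcongr))
      have hd := hD (n * Y.1)
      have hd₁ := hD₁ Y
      have t1 : |(1 - boundaryCutoff n Y) * planeLaplacian ψ Y| ≤ B := by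
        rw [abs_mul]
        have h1 : |1 - boundaryCutoff n Y| ≤ 1 := by
          unfold boundaryCutoff
          rw [abs_le]
          constructor <;> linarith [stepProfile_nonneg (n * Y.1), stepProfile_le_one (n * Y.1)]
        calc _ ≤ 1 * |planeLaplacian ψ Y| := by gcongr
          _ ≤ B := by rw [one_mul]; exact hB Y
      have t2 : |2 * (n * deriv stepProfile (n * Y.1) * partialR ψ Y)| ≤ 2 * (n * D * D₁) := by
        rw [abs_mul, abs_mul, abs_mul, abs_of_pos hn0, abs_of_pos (by norm_num : (0 : ℝ) < 2)]
        have h1 := hd.1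
        have h2 := hd₁.2.1
        gcongr
      have t3 : |n ^ 2 * deriv (deriv stepProfile) (n * Y.1) * ψ Y| ≤ 2 * (n * D * D₁) := by
        rw [abs_mul, abs_mul, abs_of_pos (by positivity : (0 : ℝ) < n ^ 2)]
        have h1 := hd.2
        have h2 : |ψ Y| ≤ D₁ * (2 / n) := (hψR Y).trans (by gcongr)
        calc _ ≤ n ^ 2 * D * (D₁ * (2 / n)) := by gcongr
          _ = _ := by field_simp
      have hsum : |planeLaplacian ψ Y - planeLaplacian (fun Y => boundaryCutoff n Y * ψ Y) Y|
          ≤ B + 4 * (n * D * D₁) := by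
        rw [hform, abs_le]
        rw [abs_le] at t1 t2 t3
        constructor <;> linarith [t1.1, t1.2, t2.1, t2.2, t3.1, t3.2]
      rw [abs_mul]
      calc |L Y| * _ ≤ C * (2 / n) * (B + 4 * (n * D * D₁)) := by gcongr
        _ = 2 * C * (B / n + 4 * D * D₁) := by field_simp
        _ ≤ _ := by
          have : B / n ≤ B := div_le_self hB0 (by linarith)
          gcongr
  rw [← abs_nonpos_iff]
  refine le_of_forall_pos_le_add fun ε hε => ?_
  set Q := 2 * C * (B + 4 * D * D₁) with hQ
  have hQ0 : 0 ≤ Q := by positivity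
  have hn : 2 ≤ max 2 (Q * (4 * M) / ε) := le_max_left _ _
  refine (hbound _ hn).trans ?_
  have hn0 : 0 < max 2 (Q * (4 * M) / ε) := by linarith
  have h1 : Q * (4 * M) / ε ≤ max 2 (Q * (4 * M) / ε) := le_max_right _ _
  rw [zero_add, ← mul_div_assoc, div_le_iff₀ hn0]
  rw [div_le_iff₀ hε] at h1
  linarith

/-- Green's identity for a function with constant Laplacian `3c`, obtained from
`integral_stream_equation` at `x = 0` with the sign of `c` reversed. -/
lemma integral_quadratic_planeLaplacian {χ : ℝ × ℝ → ℝ} (hχ : ContDiff ℝ 2 χ)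
    (hχc : HasCompactSupport χ) (c d : ℝ) :
    ∫ Y, (planeLaplacian χ Y * (3 * c / 2 * Y.1 ^ 2 - d) - χ Y * (3 * c)) = 0 := by
  have hg : ContDiff ℝ 2 fun Y : ℝ × ℝ => 3 * c / 2 * Y.1 ^ 2 - d := by fun_prop
  have hgR : partialR (fun Y : ℝ × ℝ => 3 * c / 2 * Y.1 ^ 2 - d) = fun Y => 3 * c * Y.1 :=
    funext fun Y => partialR_eq_of_hasDerivAt (hg.differentiable (by norm_num) Y) (by
      refine (((hasDerivAt_pow 2 Y.1).const_mul (3 * c / 2)).sub_const d).congr_deriv ?_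
      norm_num; ring)
  have hgZ : partialZ (fun Y : ℝ × ℝ => 3 * c / 2 * Y.1 ^ 2 - d) = fun _ => 0 :=
    funext fun Y => partialZ_eq_of_hasDerivAt (hg.differentiable (by norm_num) Y)
      (hasDerivAt_const Y.2 (3 * c / 2 * Y.1 ^ 2 - d))
  have hΔ : ∀ Y, planeLaplacian (fun Y : ℝ × ℝ => 3 * c / 2 * Y.1 ^ 2 - d) Y = 3 * c := by
    intro Y
    unfold planeLaplacian
    rw [hgR, hgZ]
    have e1 : partialZ (fun _ : ℝ × ℝ => (0 : ℝ)) Y = 0 := by unfold partialZ; simp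
    have e2 : partialR (fun Y : ℝ × ℝ => 3 * c * Y.1) Y = 3 * c :=
      partialR_eq_of_hasDerivAt (by fun_prop) (by simpa using (hasDerivAt_id Y.1).const_mul (3 * c))
    rw [e1, e2, add_zero]
  have := integral_stream_equation (x := 0) (c := -c) isOpen_univ (fun Y _ => by norm_num)
    hg.contDiffOn (fun Y _ => by rw [hΔ]; norm_num) hχ hχc (subset_univ _)
  rw [← this]
  refine integral_congr_ae (Eventually.of_forall fun Y => ?_)
  simp only [mul_zero, zero_mul, add_zero, div_one, sub_zero]
  norm_num
  ring


/-- The quadratic correction turns the equation into Laplace's equation, odd reflection extends it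
to the plane, and sublinearity of `∇Ψ` enters twice: for the increments in `Z`, and to exclude the
slope `-3cR` at the end. A linear term `A R` has bounded gradient and survives. -/
theorem elliptic_liouville {Ψ : ℝ × ℝ → ℝ} {c : ℝ} (hΨ : ContDiffOn ℝ 1 Ψ leftHalfPlane)
    (hgrad : (fun Y => euclNorm (profileGrad Ψ Y)) =o[profileInfinity] euclNorm)
    (hbc : ∀ Z : ℝ, (profileGrad Ψ (0, Z)).2 = 0)
    (hweak : ∀ χ : ℝ × ℝ → ℝ, ContDiff ℝ 2 χ → HasCompactSupport χ →
      tsupport χ ⊆ openLeftHalfPlane → ∫ Y, (planeLaplacian χ Y * Ψ Y + χ Y * (3 * c)) = 0) :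
    c = 0 ∧ ∃ A d, ∀ Y ∈ openLeftHalfPlane, Ψ Y = A * Y.1 + d := by
  have hb0 : ∀ Z, Ψ (0, Z) = Ψ (0, 0) := fun Z =>
    is_const_of_deriv_eq_zero (f := fun s => Ψ (0, s))
      (fun s => (hasDerivAt_profile_snd hΨ le_rfl s).differentiableAt)
      (fun s => by rw [(hasDerivAt_profile_snd hΨ le_rfl s).deriv, hbc]) Z 0
  set d := Ψ (0, 0) with hd
  -- Projecting to the closed half-plane makes the corrected profile continuous on the plane and
  -- zero for `R ≥ 0`, where `Ψ` itself is not controlled.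
  let p : ℝ × ℝ → ℝ × ℝ := fun Y => (min Y.1 0, Y.2)
  have hp : Continuous p := by fun_prop
  have hpm : ∀ Y, p Y ∈ leftHalfPlane := fun Y => show min Y.1 0 ≤ 0 from min_le_right _ _
  have hpn : ∀ Y, ‖p Y‖ ≤ ‖Y‖ := fun Y => by
    refine max_le_max ?_ le_rfl
    show |min Y.1 0| ≤ |Y.1|
    rcases min_cases Y.1 0 with h | h <;> rw [h.1]
    simp
  let H : ℝ × ℝ → ℝ := fun Y => Ψ (p Y) + 3 * c / 2 * (p Y).1 ^ 2 - d
  have hH : Continuous H := by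
    have h1 : Continuous fun Y => Ψ (p Y) := hΨ.continuousOn.comp_continuous hp hpm
    exact (h1.add (continuous_const.mul ((continuous_fst.comp hp).pow 2))).sub continuous_const
  have hH0 : ∀ Y : ℝ × ℝ, 0 ≤ Y.1 → H Y = 0 := fun Y hY => by
    simp [H, p, min_eq_right hY, hb0]
  have hHl : ∀ Y : ℝ × ℝ, Y.1 ≤ 0 → H Y = Ψ Y + 3 * c / 2 * Y.1 ^ 2 - d := fun Y hY => by
    simp [H, p, min_eq_left hY]
  let f : ℝ × ℝ → ℝ := fun Y => H Y - H (reflectR Y)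
  have hf : Continuous f := hH.sub (hH.comp reflectR.continuous)
  have hodd : ∀ Y, f (reflectR Y) = -f Y := fun Y => by simp [f]
  have hfl : ∀ Y : ℝ × ℝ, Y.1 ≤ 0 → f Y = Ψ Y + 3 * c / 2 * Y.1 ^ 2 - d := fun Y hY => by
    simp only [f]
    rw [hHl Y hY, hH0 (reflectR Y) (by simpa using hY), sub_zero]
  have hΨinc : ∀ η > 0, ∃ C, 0 ≤ C ∧ ∀ Y ∈ leftHalfPlane, ∀ h : ℝ,
      |Ψ (Y.1, Y.2 + h) - Ψ Y| ≤ (η * (‖Y‖ + |h|) + C) * |h| := by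
    intro η hη
    obtain ⟨C, hC, hG⟩ := profileGrad_growth hΨ hgrad hη
    refine ⟨C, hC, fun Y hY h => ?_⟩
    have := (convex_uIcc Y.2 (Y.2 + h)).norm_image_sub_le_of_norm_hasDerivWithin_le
      (C := η * (‖Y‖ + |h|) + C)
      (f := fun s => Ψ (Y.1, s)) (f' := fun s => (profileGrad Ψ (Y.1, s)).2)
      (fun s _ => (hasDerivAt_profile_snd hΨ hY s).hasDerivWithinAt)
      (fun s hs => by
        refine (hG (Y.1, s) hY).2.trans ?_
        have h1 : ‖((Y.1, s) : ℝ × ℝ)‖ ≤ ‖Y‖ + |h| := by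
          refine max_le ((norm_fst_le Y).trans (by linarith [abs_nonneg h])) ?_
          have h2 : |s - Y.2| ≤ |h| := by
            have := abs_sub_left_of_mem_uIcc hs
            simpa using this
          have h3 : |Y.2| ≤ ‖Y‖ := norm_snd_le Y
          have h4 := abs_add_le (s - Y.2) Y.2
          rw [sub_add_cancel] at h4
          rw [Real.norm_eq_abs]
          linarith
        gcongr)
      left_mem_uIcc right_mem_uIcc
    simpa [Real.norm_eq_abs] using this
  have hHinc : ∀ η > 0, ∀ h : ℝ, ∃ C, 0 ≤ C ∧ ∀ Y, |H (Y + (0, h)) - H Y| ≤ η * ‖Y‖ + C := by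
    intro η hη h
    have hη' : 0 < η / (|h| + 1) := by positivity
    obtain ⟨C, hC, hG⟩ := hΨinc _ hη'
    refine ⟨η * |h| + C * |h|, by positivity, fun Y => ?_⟩
    -- The quadratic term depends on `R` only and drops out of vertical increments, so it does not
    -- spoil sublinearity.
    have h1 : H (Y + (0, h)) - H Y = Ψ ((p Y).1, (p Y).2 + h) - Ψ (p Y) := by
      simp only [H, p, Prod.fst_add, Prod.snd_add, add_zero]; ring
    rw [h1]
    refine (hG (p Y) (hpm Y) h).trans ?_
    have h2 : η / (|h| + 1) * |h| ≤ η := by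
      rw [div_mul_eq_mul_div, div_le_iff₀ (by positivity)]
      nlinarith [abs_nonneg h]
    have h3 := hpn Y
    calc (η / (|h| + 1) * (‖p Y‖ + |h|) + C) * |h|
        = η / (|h| + 1) * |h| * (‖p Y‖ + |h|) + C * |h| := by ring
      _ ≤ η * (‖Y‖ + |h|) + C * |h| := by gcongr
      _ = _ := by ring
  have hinc : ∀ h : ℝ, IsSublinear fun Y => f (Y + (0, h)) - f Y := by
    intro h η hη
    obtain ⟨C, hC, hB⟩ := hHinc (η / 2) (half_pos hη) h
    refine ⟨C + C, by positivity, fun Y => ?_⟩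
    have h1 := hB Y
    have h2 := hB (reflectR Y)
    have h3 : ‖reflectR Y‖ = ‖Y‖ := by simp [Prod.norm_def]
    have h4 : reflectR (Y + (0, h)) = reflectR Y + (0, h) := by
      ext <;> simp
    rw [h3] at h2
    simp only [f, h4]
    rw [abs_le] at *
    constructor <;> linarith
  have hlin : ∀ M : ℝ, ∃ C, 0 ≤ C ∧ ∀ Y ∈ boundaryStrip 2 M, |f Y| ≤ C * |Y.1| := by
    intro M
    obtain ⟨C, hC, hG⟩ := profileGrad_growth hΨ hgrad one_pos
    refine ⟨1 + |M| + C + |3 * c / 2|, by positivity, fun Y hY => ?_⟩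
    obtain ⟨⟨hY1, hY0⟩, hY2, hY3⟩ := hY
    norm_num at hY1
    have hYM : |Y.2| ≤ |M| := (abs_le.2 ⟨hY2, hY3⟩).trans (le_abs_self M)
    have h1 := (convex_Icc (-1 : ℝ) 0).norm_image_sub_le_of_norm_hasDerivWithin_le
      (C := 1 + |M| + C) (f := fun s => Ψ (s, Y.2)) (f' := fun s => (profileGrad Ψ (s, Y.2)).1)
      (fun s hs => (hasDerivWithinAt_profile_fst hΨ hs.2 Y.2).mono fun r hr => hr.2)
      (fun s hs => by
        refine (hG (s, Y.2) hs.2).1.trans ?_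
        have h1 : ‖((s, Y.2) : ℝ × ℝ)‖ ≤ 1 + |M| := by
          refine max_le ?_ ?_
          · rw [Real.norm_eq_abs, abs_le]
            constructor <;> linarith [hs.1, hs.2, abs_nonneg M]
          · rw [Real.norm_eq_abs]; linarith
        linarith)
      (x := 0) (y := Y.1) ⟨by norm_num, le_rfl⟩ ⟨hY1, hY0⟩
    simp only [Prod.mk.eta, sub_zero, hb0, Real.norm_eq_abs] at h1
    have h2 : |3 * c / 2 * Y.1 ^ 2| ≤ |3 * c / 2| * |Y.1| := by
      rw [abs_mul, abs_pow]
      have h3 : |Y.1| ≤ 1 := abs_le.2 ⟨hY1, by linarith⟩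
      gcongr
      nlinarith [abs_nonneg Y.1]
    rw [hfl Y hY0]
    calc |Ψ Y + 3 * c / 2 * Y.1 ^ 2 - d| = |(Ψ Y - d) + 3 * c / 2 * Y.1 ^ 2| := by ring_nf
      _ ≤ |Ψ Y - d| + |3 * c / 2 * Y.1 ^ 2| := abs_add_le _ _
      _ ≤ (1 + |M| + C) * |Y.1| + |3 * c / 2| * |Y.1| := add_le_add h1 h2
      _ = _ := by ring
  have hleft : ∀ χ : ℝ × ℝ → ℝ, ContDiff ℝ 2 χ → HasCompactSupport χ →
      tsupport χ ⊆ openLeftHalfPlane → ∫ Y, f Y * planeLaplacian χ Y = 0 := by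
    intro χ hχ hχc hχO
    have hΔc := continuous_planeLaplacian hχ
    have hΔs : HasCompactSupport (planeLaplacian χ) :=
      hχc.of_eq_zero fun Y hY => planeLaplacian_eq_zero_of_notMem hY
    have hq : Integrable fun Y : ℝ × ℝ =>
        planeLaplacian χ Y * (3 * c / 2 * Y.1 ^ 2 - d) - χ Y * (3 * c) :=
      ((hΔc.mul (by fun_prop)).integrable_of_hasCompactSupport hΔs.mul_right).sub
        ((hχ.continuous.mul continuous_const).integrable_of_hasCompactSupport hχc.mul_right)
    have hfi : Integrable fun Y => f Y * planeLaplacian χ Y :=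
      (hf.mul hΔc).integrable_of_hasCompactSupport hΔs.mul_left
    have hsub : (fun Y => planeLaplacian χ Y * Ψ Y + χ Y * (3 * c)) = fun Y =>
        f Y * planeLaplacian χ Y
          - (planeLaplacian χ Y * (3 * c / 2 * Y.1 ^ 2 - d) - χ Y * (3 * c)) := funext fun Y => by
      by_cases hY : Y ∈ tsupport χ
      · rw [hfl Y (openLeftHalfPlane_subset (hχO hY))]; ring
      · rw [planeLaplacian_eq_zero_of_notMem hY, image_eq_zero_of_notMem_tsupport hY]; ring
    have := hweak χ hχ hχc hχO
    rw [hsub, integral_sub hfi hq, integral_quadratic_planeLaplacian hχ hχc, sub_zero] at this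
    exact this
  have hzero : ∀ Z, f (0, Z) = 0 := fun Z => by rw [hfl _ le_rfl]; simp [hb0]
  have hfin := weakly_harmonic_liouville hf
    (fun φ hφ hφc => weakly_harmonic_of_odd hf hodd hlin hleft hφ hφc) hinc hzero
  set a := f (1, 0) with ha
  have hΨf : ∀ Y : ℝ × ℝ, Y.1 ≤ 0 → Ψ Y = a * Y.1 - 3 * c / 2 * Y.1 ^ 2 + d := fun Y hY => by
    have h1 := hfl Y hY
    have h2 := hfin Y.1 Y.2
    rw [Prod.mk.eta] at h2
    linarith
  -- The gradient grows at the exact rate `3|c|`; the growth bound with rate `|c|` fails at `(-ρ,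
  -- 0)` when `|c| ρ = |a| + C + 1`.
  have hc0 : c = 0 := by
    have hder : ∀ R < 0, (profileGrad Ψ (R, 0)).1 = a - 3 * c * R := by
      intro R hR
      have h1 := hasDerivWithinAt_profile_fst hΨ hR.le 0
      have h2 : HasDerivAt (fun s : ℝ => a * s - 3 * c / 2 * s ^ 2 + d) (a - 3 * c * R) R := by
        refine ((((hasDerivAt_id R).const_mul a).sub
          ((hasDerivAt_pow 2 R).const_mul (3 * c / 2))).add_const d).congr_deriv ?_
        norm_num; ring
      have h3 : HasDerivWithinAt (fun s => Ψ (s, 0)) (a - 3 * c * R) (Iic 0) R :=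
        h2.hasDerivWithinAt.congr (fun s hs => hΨf (s, 0) hs) (hΨf (R, 0) hR.le)
      exact (uniqueDiffOn_Iic (0 : ℝ) R hR.le).eq_deriv _ h1 h3
    by_contra hc
    have hc' : 0 < |c| := abs_pos.2 hc
    obtain ⟨C, hC, hG⟩ := profileGrad_growth hΨ hgrad hc'
    set ρ := (|a| + C + 1) / |c| with hρ
    have hρ0 : 0 < ρ := by positivity
    have h1 := (hG (-ρ, 0) (by simpa [leftHalfPlane] using hρ0.le)).1
    rw [hder (-ρ) (by linarith)] at h1
    have h2 : ‖((-ρ, 0) : ℝ × ℝ)‖ = ρ := by simp [Prod.norm_def, abs_of_pos hρ0, hρ0.le]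
    rw [h2] at h1
    have h3 : |c| * ρ = |a| + C + 1 := by rw [hρ]; field_simp
    have h4 : 3 * (|c| * ρ) = |3 * c * ρ| := by
      rw [abs_mul, abs_mul, abs_of_pos hρ0]; norm_num; ring
    have h5 : |3 * c * ρ| ≤ |a - 3 * c * -ρ| + |a| := by
      have := abs_sub (a - 3 * c * -ρ) a
      rwa [show a - 3 * c * -ρ - a = 3 * c * ρ by ring] at this
    linarith [abs_nonneg a]
  refine ⟨hc0, a, d, fun Y hY => ?_⟩
  rw [hΨf Y (openLeftHalfPlane_subset hY), hc0]
  ring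

/-! ### Physical points in terms of the scale `x = (T - t)^γ` and the similarity variables -/

/-- The affine map which takes `Y` to the point `(r, z)` with similarity variables `Y` at the
scale `x`. -/
def dilate (x : ℝ) (Y : ℝ × ℝ) : ℝ × ℝ := (1 + x * Y.1, x * Y.2)

/-- The point `(r, z, t)` with `(T - t)^γ = x` and similarity variables `Y`. -/
def scalePoint (γ T x : ℝ) (Y : ℝ × ℝ) : ℝ × ℝ × ℝ := (1 + x * Y.1, x * Y.2, T - x ^ (1 / γ))

/-- Half-boxes which exhaust the open left half-plane. -/
def profileBox (M : ℝ) : Set (ℝ × ℝ) := Ioo (-M) 0 ×ˢ Ioo (-M) M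

/-- The scales at which the box of size `M` lies in the interior of the region. -/
def scaleSet (γ T : ℝ) (S : Set (ℝ × ℝ × ℝ)) (M : ℝ) : Set ℝ :=
  {x | 0 < x ∧ ∀ Y ∈ profileBox M, scalePoint γ T x Y ∈ interior S}

/-- The filter of small scales at which the box of size `M` lies in the interior of the region. -/
def scaleFilter (γ T : ℝ) (S : Set (ℝ × ℝ × ℝ)) (M : ℝ) : Filter ℝ :=
  𝓝[>] 0 ⊓ 𝓟 (scaleSet γ T S M)

instance (γ T : ℝ) (S : Set (ℝ × ℝ × ℝ)) (M : ℝ) : (scaleFilter γ T S M).IsCountablyGenerated := by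
  unfold scaleFilter; infer_instance

lemma isOpen_profileBox (M : ℝ) : IsOpen (profileBox M) := isOpen_Ioo.prod isOpen_Ioo

lemma profileBox_subset (M : ℝ) : profileBox M ⊆ openLeftHalfPlane := fun _ h => h.1.2

lemma exists_subset_profileBox {K : Set (ℝ × ℝ)} (hK : IsCompact K) (h : K ⊆ openLeftHalfPlane) :
    ∃ M, 0 < M ∧ K ⊆ profileBox M := by
  obtain ⟨a, ha, hA⟩ := exists_forall_abs_le hK continuous_fst.continuousOn
  obtain ⟨b, hb, hB⟩ := exists_forall_abs_le hK continuous_snd.continuousOn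
  refine ⟨a + b + 1, by positivity, fun Y hY => ?_⟩
  have h1 := abs_le.1 (hA Y hY)
  have h2 := abs_le.1 (hB Y hY)
  exact ⟨⟨by linarith [h1.1], h hY⟩, by linarith [h2.1], by linarith [h2.2]⟩

lemma contDiff_dilate (x : ℝ) {n : WithTop ℕ∞} : ContDiff ℝ n (dilate x) := by
  unfold dilate; fun_prop

lemma rpow_one_div_rpow {γ x : ℝ} (hγ : 0 < γ) (hx : 0 < x) : (x ^ (1 / γ)) ^ γ = x := by
  rw [← Real.rpow_mul hx.le, one_div_mul_cancel hγ.ne', Real.rpow_one]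

lemma rpow_rpow_one_div {γ x : ℝ} (hγ : 0 < γ) (hx : 0 < x) : (x ^ γ) ^ (1 / γ) = x := by
  rw [← Real.rpow_mul hx.le, mul_one_div_cancel hγ.ne', Real.rpow_one]

lemma rpow_one_div_rpow_mul {γ x : ℝ} (hγ : 0 < γ) (hx : 0 < x) (k : ℕ) :
    (x ^ (1 / γ)) ^ ((k : ℝ) * γ) = x ^ k := by
  rw [mul_comm, Real.rpow_mul (Real.rpow_nonneg hx.le _), rpow_one_div_rpow hγ hx,
    Real.rpow_natCast]

lemma similarityVar_scalePoint {γ T x : ℝ} (hγ : 0 < γ) (hx : 0 < x) (Y : ℝ × ℝ) :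
    similarityVar γ T (scalePoint γ T x Y) = Y := by
  unfold similarityVar scalePoint
  simp only [sub_sub_cancel, rpow_one_div_rpow hγ hx, add_sub_cancel_left]
  ext <;> simp [hx.ne']

lemma continuousAt_scalePoint {γ T x : ℝ} (hx : 0 < x) (Y : ℝ × ℝ) :
    ContinuousAt (fun s => scalePoint γ T s Y) x := by
  have h1 : ContinuousAt (fun s : ℝ => s ^ (1 / γ)) x :=
    Real.continuousAt_rpow_const x _ (Or.inl hx.ne')
  unfold scalePoint
  fun_prop

lemma IsAdmissibleRegion.lt {γ T : ℝ} {S : Set (ℝ × ℝ × ℝ)} (hS : IsAdmissibleRegion γ T S)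
    {x : ℝ × ℝ × ℝ} (hx : x ∈ S) : x.1 < 1 ∧ x.2.2 < T := by
  rcases hS with ⟨δ, -, -, rfl⟩ | ⟨T₀, δ, -, -, -, -, -, rfl⟩
  · exact ⟨hx.2.1, hx.2.2.2.2.2⟩
  · exact ⟨hx.2.1, hx.2.2.2.2.2⟩

lemma IsAdmissibleRegion.similarityVar_mem {γ T : ℝ} {S : Set (ℝ × ℝ × ℝ)}
    (hS : IsAdmissibleRegion γ T S) {x : ℝ × ℝ × ℝ} (hx : x ∈ S) :
    similarityVar γ T x ∈ openLeftHalfPlane := by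
  have h := hS.lt hx
  exact div_neg_of_neg_of_pos (by linarith [h.1]) (Real.rpow_pos_of_pos (by linarith [h.2]) _)

lemma IsAdmissibleRegion.isOpen_slice {γ T : ℝ} {S : Set (ℝ × ℝ × ℝ)}
    (hS : IsAdmissibleRegion γ T S) (t : ℝ) : IsOpen {y : ℝ × ℝ | (y.1, y.2, t) ∈ S} := by
  have key : ∀ (a b : ℝ) (P : Prop),
      IsOpen {y : ℝ × ℝ | 1 - a < y.1 ∧ y.1 < 1 ∧ -b < y.2 ∧ y.2 < b ∧ P} := fun a b P =>
    (isOpen_lt continuous_const continuous_fst).inter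
      ((isOpen_lt continuous_fst continuous_const).inter
        ((isOpen_lt continuous_const continuous_snd).inter
          ((isOpen_lt continuous_snd continuous_const).inter isOpen_const)))
  rcases hS with ⟨δ, -, -, rfl⟩ | ⟨T₀, δ, -, -, -, -, -, rfl⟩
  · exact key δ δ (T - δ < t ∧ t < T)
  · exact key (δ t) (δ t) (T₀ < t ∧ t < T)

lemma isOpen_cylinder (a b c d : ℝ) : IsOpen {x : ℝ × ℝ × ℝ |
    1 - a < x.1 ∧ x.1 < 1 ∧ -b < x.2.1 ∧ x.2.1 < b ∧ c < x.2.2 ∧ x.2.2 < d} :=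
  (isOpen_lt continuous_const continuous_fst).inter
    ((isOpen_lt continuous_fst continuous_const).inter
      ((isOpen_lt continuous_const (continuous_fst.comp continuous_snd)).inter
        ((isOpen_lt (continuous_fst.comp continuous_snd) continuous_const).inter
          ((isOpen_lt continuous_const (continuous_snd.comp continuous_snd)).inter
            (isOpen_lt (continuous_snd.comp continuous_snd) continuous_const)))))

lemma scalePoint_mem_cylinder {γ T x M a c d : ℝ} (hx : 0 < x) (hMa : M * x < a)
    (hc : c < T - x ^ (1 / γ)) (hd : T - x ^ (1 / γ) < d) {Y : ℝ × ℝ} (hY : Y ∈ profileBox M) :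
    scalePoint γ T x Y ∈ {x : ℝ × ℝ × ℝ |
      1 - a < x.1 ∧ x.1 < 1 ∧ -a < x.2.1 ∧ x.2.1 < a ∧ c < x.2.2 ∧ x.2.2 < d} := by
  obtain ⟨⟨h1, h2⟩, h3, h4⟩ := hY
  have e1 := mul_lt_mul_of_pos_left h1 hx
  have e2 := mul_neg_of_pos_of_neg hx h2
  have e3 := mul_lt_mul_of_pos_left h3 hx
  have e4 := mul_lt_mul_of_pos_left h4 hx
  refine ⟨?_, ?_, ?_, ?_, hc, hd⟩ <;> simp only [scalePoint] <;> nlinarith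

/-- For the fixed cylinder all small scales are admissible. For the window, the infinite upper limit
gives times `t₀` arbitrarily close to `T` with `δ(t₀) > 2M (T - t₀)^γ`, and only along such times
does the box fit. -/
lemma IsAdmissibleRegion.frequently_scale {γ T : ℝ} {S : Set (ℝ × ℝ × ℝ)} (hγ : 0 < γ)
    (hS : IsAdmissibleRegion γ T S) {M : ℝ} (hM : 0 < M) :
    ∃ᶠ x in 𝓝[>] (0 : ℝ), x ∈ scaleSet γ T S M := by
  rcases hS with ⟨δ, hδ, -, rfl⟩ | ⟨T₀, δ, hT₀, hδ, hanti, -, hlim, rfl⟩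
  · refine Eventually.frequently ?_
    have h1 : Tendsto (fun x : ℝ => x ^ (1 / γ)) (𝓝[>] 0) (𝓝 0) := by
      have := (Real.continuousAt_rpow_const (0 : ℝ) (1 / γ) (Or.inr (by positivity))).tendsto
      rw [Real.zero_rpow (by positivity)] at this
      exact this.mono_left nhdsWithin_le_nhds
    have h2 : Tendsto (fun x : ℝ => M * x) (𝓝[>] 0) (𝓝 0) := by
      have : Tendsto (fun x : ℝ => M * x) (𝓝 0) (𝓝 (M * 0)) := tendsto_id.const_mul M
      rw [mul_zero] at this
      exact this.mono_left nhdsWithin_le_nhds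
    filter_upwards [self_mem_nhdsWithin, h1.eventually_lt_const hδ, h2.eventually_lt_const hδ]
      with x hx e1 e2
    have hx : 0 < x := hx
    refine ⟨hx, fun Y hY => ?_⟩
    have ho : IsOpen (cylinderRegion δ T) := isOpen_cylinder δ δ (T - δ) T
    rw [ho.interior_eq]
    exact scalePoint_mem_cylinder hx e2 (by linarith)
      (by linarith [Real.rpow_pos_of_pos hx (1 / γ)]) hY
  · intro hev
    obtain ⟨ε, hε, hsub⟩ := mem_nhdsGT_iff_exists_Ioo_subset.1 hev
    have hε : 0 < ε := hε
    have h1 : ∃ᶠ t in 𝓝[<] T, ((2 * M : ℝ) : EReal) < (((T - t) ^ (-γ) * δ t : ℝ) : EReal) :=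
      frequently_lt_of_lt_limsup (h := by rw [hlim]; exact EReal.coe_lt_top _)
    have h2 : ∀ᶠ t in 𝓝[<] T, (T - t) ^ γ < ε := by
      have h3 : ContinuousAt (fun t : ℝ => (T - t) ^ γ) T := by
        have h4 : ContinuousAt (fun s : ℝ => s ^ γ) (T - T) :=
          Real.continuousAt_rpow_const _ _ (Or.inr hγ.le)
        exact ContinuousAt.comp (f := fun t : ℝ => T - t) h4 (by fun_prop)
      have h4 := h3.tendsto
      simp only [sub_self, Real.zero_rpow hγ.ne'] at h4
      exact (h4.eventually_lt_const hε).filter_mono nhdsWithin_le_nhds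
    obtain ⟨t₀, hb, hεt, ht₀⟩ :=
      (h1.and_eventually (h2.and (Ioo_mem_nhdsLT hT₀))).exists
    have hb := EReal.coe_lt_coe_iff.1 hb
    have hτ₀ : 0 < T - t₀ := by linarith [ht₀.2]
    have hp := Real.rpow_pos_of_pos hτ₀ γ
    rw [Real.rpow_neg hτ₀.le, inv_mul_eq_div, lt_div_iff₀ hp] at hb
    have hc : ContinuousAt (fun s : ℝ => s ^ γ) (T - t₀) :=
      Real.continuousAt_rpow_const _ _ (Or.inr hγ.le)
    have e1 : ∀ᶠ s in 𝓝[>] (T - t₀), s ^ γ < ε :=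
      (hc.tendsto.eventually_lt_const hεt).filter_mono nhdsWithin_le_nhds
    have e2 : ∀ᶠ s in 𝓝[>] (T - t₀), M * s ^ γ < δ t₀ :=
      ((hc.tendsto.const_mul M).eventually_lt_const (by nlinarith)).filter_mono nhdsWithin_le_nhds
    have e3 : Ioo (T - t₀) (T - T₀) ∈ 𝓝[>] (T - t₀) := Ioo_mem_nhdsGT (by linarith [ht₀.1])
    -- The time `T - τ` lies slightly before `t₀`. Since `δ` may jump, an open neighbourhood inside
    -- the window is obtained from monotonicity: at all times before `t₀` the window has width at
    -- least `δ t₀`.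
    obtain ⟨τ, h3, h4, h5⟩ := (e1.and (e2.and e3)).exists
    have hτ : 0 < τ := hτ₀.trans h5.1
    have hx : 0 < τ ^ γ := Real.rpow_pos_of_pos hτ γ
    have ht : (τ ^ γ) ^ (1 / γ) = τ := rpow_rpow_one_div hγ hτ
    refine hsub ⟨hx, h3⟩ ⟨hx, fun Y hY => ?_⟩
    refine mem_interior.2 ⟨_, ?_, isOpen_cylinder (δ t₀) (δ t₀) T₀ t₀,
      scalePoint_mem_cylinder hx h4 (by rw [ht]; linarith [h5.2]) (by rw [ht]; linarith [h5.1]) hY⟩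
    rintro y ⟨y1, y2, y3, y4, y5, y6⟩
    have hmono : δ t₀ ≤ δ y.2.2 := hanti ⟨y5, y6.trans ht₀.2⟩ ht₀ y6.le
    exact ⟨by linarith, y2, by linarith, by linarith, y5, y6.trans ht₀.2⟩

lemma IsAdmissibleRegion.neBot_scaleFilter {γ T : ℝ} {S : Set (ℝ × ℝ × ℝ)} (hγ : 0 < γ)
    (hS : IsAdmissibleRegion γ T S) {M : ℝ} (hM : 0 < M) : (scaleFilter γ T S M).NeBot :=
  frequently_mem_iff_neBot.1 (hS.frequently_scale hγ hM)

/-! ### Convergence of the series -/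

section series

variable {γ T a x : ℝ} {S : Set (ℝ × ℝ × ℝ)} {U : ℕ → ℝ × ℝ → ℝ} {u : ℝ × ℝ × ℝ → ℝ}

lemma partialSum_scalePoint (hγ : 0 < γ) (hx : 0 < x) (N : ℕ) (Y : ℝ × ℝ) :
    (T - (scalePoint γ T x Y).2.2) ^ a * ∑ k ∈ Finset.range N,
      (T - (scalePoint γ T x Y).2.2) ^ ((k : ℝ) * γ)
        * U k (similarityVar γ T (scalePoint γ T x Y))
    = (x ^ (1 / γ)) ^ a * ∑ k ∈ Finset.range N, x ^ k * U k Y := by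
  rw [similarityVar_scalePoint hγ hx]
  simp only [scalePoint, sub_sub_cancel, rpow_one_div_rpow_mul hγ hx]

/-- Locally uniform convergence is uniform on the compact image of `K`, so late partial sums lie
within `1` of the limit and late terms are at most `2`. The finitely many early terms are bounded by
`hU`. -/
lemma HasSelfSimilarSeries.exists_coeff_bound (hγ : 0 < γ)
    (hu : HasSelfSimilarSeries γ T a S U u) (hx : 0 < x) {K : Set (ℝ × ℝ)} (hK : IsCompact K)
    (hKS : ∀ Y ∈ K, scalePoint γ T x Y ∈ S) (hU : ∀ k, ∃ C, ∀ Y ∈ K, |U k Y| ≤ C) :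
    ∃ C, ∀ k, ∀ Y ∈ K, |U k Y| * x ^ k ≤ C := by
  have hcont : Continuous (scalePoint γ T x) := by unfold scalePoint; fun_prop
  have hunif := (tendstoLocallyUniformlyOn_iff_tendstoUniformlyOn_of_compact
    (hK.image hcont)).1 (hu.mono (image_subset_iff.2 hKS))
  have h1 := Metric.tendstoUniformlyOn_iff.1 hunif 1 one_pos
  obtain ⟨N, hN⟩ := eventually_atTop.1 h1
  have hτ : 0 < (x ^ (1 / γ)) ^ a := Real.rpow_pos_of_pos (Real.rpow_pos_of_pos hx _) _
  have hbig : ∀ n ≥ N, ∀ Y ∈ K, |U n Y| * x ^ n ≤ 2 / (x ^ (1 / γ)) ^ a := by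
    intro n hn Y hY
    have e1 := hN n hn _ (mem_image_of_mem _ hY)
    have e2 := hN (n + 1) (by omega) _ (mem_image_of_mem _ hY)
    rw [Real.dist_eq, partialSum_scalePoint hγ hx] at e1 e2
    rw [Finset.sum_range_succ] at e2
    rw [le_div_iff₀ hτ]
    have e3 : |U n Y| * x ^ n * (x ^ (1 / γ)) ^ a = |(x ^ (1 / γ)) ^ a * (x ^ n * U n Y)| := by
      rw [abs_mul, abs_mul, abs_of_pos hτ, abs_of_pos (pow_pos hx n)]; ring
    rw [e3]
    rw [abs_lt] at e1 e2
    rw [abs_le]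
    constructor <;> linarith [e1.1, e1.2, e2.1, e2.2]
  choose C hC using hU
  have hnn : ∀ n, 0 ≤ |C n| * x ^ n := fun n => by positivity
  refine ⟨2 / (x ^ (1 / γ)) ^ a + ∑ n ∈ Finset.range N, |C n| * x ^ n, fun k Y hY => ?_⟩
  by_cases hk : N ≤ k
  · exact (hbig k hk Y hY).trans (le_add_of_nonneg_right (Finset.sum_nonneg fun n _ => hnn n))
  · have h2 := Finset.single_le_sum (f := fun n => |C n| * x ^ n) (fun n _ => hnn n)
      (Finset.mem_range.2 (not_le.1 hk))
    have h3 : |U k Y| * x ^ k ≤ |C k| * x ^ k := by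
      have := (hC k Y hY).trans (le_abs_self _)
      gcongr
    have h4 : 0 ≤ 2 / (x ^ (1 / γ)) ^ a := by positivity
    exact (h3.trans h2).trans (le_add_of_nonneg_left h4)

lemma summable_pow_mul_of_bound {c : ℕ → ℝ} {C x₀ : ℝ} (hx : 0 < x) (hxx : x < x₀)
    (hc : ∀ j, |c j| * x₀ ^ j ≤ C) : Summable fun j => x ^ j * c j := by
  have hx₀ : 0 < x₀ := hx.trans hxx
  have hr : ‖x / x₀‖ < 1 := by
    rw [Real.norm_eq_abs, abs_of_pos (by positivity), div_lt_one hx₀]; exact hxx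
  refine Summable.of_norm_bounded ((summable_geometric_of_norm_lt_one hr).mul_left C) fun n => ?_
  have hn : |c n| ≤ C / x₀ ^ n := by rw [le_div_iff₀ (by positivity)]; exact hc n
  rw [norm_mul, Real.norm_eq_abs, Real.norm_eq_abs, abs_of_nonneg (by positivity), div_pow]
  calc x ^ n * |c n| ≤ x ^ n * (C / x₀ ^ n) := by gcongr
    _ = _ := by ring

/-- At an interior point the scale can be increased slightly with `Y` fixed. The series at `x` is
then strictly inside its disc of convergence, which allows termwise differentiation in `x`. -/
lemma HasSelfSimilarSeries.exists_larger_bound (hγ : 0 < γ)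
    (hu : HasSelfSimilarSeries γ T a S U u) (hx : 0 < x) {Y : ℝ × ℝ}
    (hY : scalePoint γ T x Y ∈ interior S) :
    ∃ x₀ C, x < x₀ ∧ ∀ k, |U k Y| * x₀ ^ k ≤ C := by
  have h1 : ∀ᶠ s in 𝓝[>] x, scalePoint γ T s Y ∈ interior S :=
    ((continuousAt_scalePoint hx Y).eventually (isOpen_interior.mem_nhds hY)).filter_mono
      nhdsWithin_le_nhds
  obtain ⟨x₀, h2, h3⟩ := (h1.and self_mem_nhdsWithin).exists
  obtain ⟨C, hC⟩ := hu.exists_coeff_bound hγ (hx.trans h3) (isCompact_singleton (x := Y))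
    (fun Y' h => by rw [mem_singleton_iff.1 h]; exact interior_subset h2)
    (fun k => ⟨|U k Y|, fun Y' h => by rw [mem_singleton_iff.1 h]⟩)
  exact ⟨x₀, C, h3, fun k => hC k Y rfl⟩

lemma HasSelfSimilarSeries.eq_profileSeries (hγ : 0 < γ)
    (hu : HasSelfSimilarSeries γ T a S U u) (hx : 0 < x) {Y : ℝ × ℝ}
    (hY : scalePoint γ T x Y ∈ interior S) :
    u (scalePoint γ T x Y) = (x ^ (1 / γ)) ^ a * profileSeries U x Y := by
  obtain ⟨x₀, C, hxx, hC⟩ := hu.exists_larger_bound hγ hx hY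
  have h1 := (summable_pow_mul_of_bound hx hxx hC).hasSum.tendsto_sum_nat.const_mul
    ((x ^ (1 / γ)) ^ a)
  have h2 := hu.tendsto_at (interior_subset hY)
  simp only [partialSum_scalePoint hγ hx] at h2
  exact tendsto_nhds_unique h2 h1

/-- The partial sums vanish at every point of `S`, so no passage to the interior is needed. -/
lemma HasSelfSimilarSeries.eq_zero (hS : IsAdmissibleRegion γ T S)
    (hu : HasSelfSimilarSeries γ T a S U u) (hU : ∀ k, ∀ Y ∈ openLeftHalfPlane, U k Y = 0)
    {y : ℝ × ℝ × ℝ} (hy : y ∈ S) : u y = 0 := by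
  have h2 := hu.tendsto_at hy
  simp only [hU _ _ (hS.similarityVar_mem hy), mul_zero, Finset.sum_const_zero] at h2
  exact tendsto_nhds_unique h2 tendsto_const_nhds

/-- One admissible scale `x₀` already bounds all coefficients on `K`; uniform remainder estimates at
smaller scales follow as for any power series. -/
lemma HasSelfSimilarSeries.exists_scale_bound (hγ : 0 < γ) (hS : IsAdmissibleRegion γ T S)
    (hu : HasSelfSimilarSeries γ T a S U u) {M : ℝ} (hM : 0 < M) {K : Set (ℝ × ℝ)}
    (hK : IsCompact K) (hKM : K ⊆ profileBox M) (hU : ∀ k, ContinuousOn (U k) K) :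
    ∃ x₀ C, 0 < x₀ ∧ (∀ k, ∀ Y ∈ K, |U k Y| * x₀ ^ k ≤ C) ∧
      ∀ᶠ x in scaleFilter γ T S M, 0 < x ∧ x ≤ x₀ / 2 := by
  have := hS.neBot_scaleFilter hγ hM
  have hmem : scaleSet γ T S M ∈ scaleFilter γ T S M := mem_inf_of_right (mem_principal_self _)
  obtain ⟨x₀, hx₀⟩ := Filter.nonempty_of_mem hmem
  obtain ⟨C, hC⟩ := hu.exists_coeff_bound hγ hx₀.1 hK
    (fun Y hY => interior_subset (hx₀.2 Y (hKM hY)))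
    (fun k => (exists_forall_abs_le hK (hU k)).imp fun C h => h.2)
  refine ⟨x₀, C, hx₀.1, hC, ?_⟩
  have h1 : ∀ᶠ x in 𝓝[>] (0 : ℝ), x ≤ x₀ / 2 :=
    (eventually_le_nhds (half_pos hx₀.1)).filter_mono nhdsWithin_le_nhds
  exact ((eventually_mem_nhdsWithin.and h1).filter_mono inf_le_left)

end series

/-! ### Derivatives in physical and similarity variables -/

section derivatives

variable {γ T x lam : ℝ} {u : ℝ × ℝ × ℝ → ℝ} {f : ℝ × ℝ → ℝ} {O : Set (ℝ × ℝ)} {Y : ℝ × ℝ}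

/-- The restriction of a function of `(r, z, t)` to a fixed time. -/
def timeSlice (u : ℝ × ℝ × ℝ → ℝ) (t : ℝ) (y : ℝ × ℝ) : ℝ := u (y.1, y.2, t)

lemma dr_eq_partialR {t : ℝ} {y : ℝ × ℝ} (h : DifferentiableAt ℝ (timeSlice u t) y) :
    dr u (y.1, y.2, t) = partialR (timeSlice u t) y := (hasDerivAt_partialR h).deriv

lemma dz_eq_partialZ {t : ℝ} {y : ℝ × ℝ} (h : DifferentiableAt ℝ (timeSlice u t) y) :
    dz u (y.1, y.2, t) = partialZ (timeSlice u t) y := (hasDerivAt_partialZ h).deriv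

lemma eventuallyEq_of_scalePoint (hO : IsOpen O) (hY : Y ∈ O) (hlam : lam ≠ 0)
    (h : ∀ Y ∈ O, u (scalePoint γ T x Y) = lam * f Y) :
    f =ᶠ[𝓝 Y] fun Y => lam⁻¹ * timeSlice u (T - x ^ (1 / γ)) (dilate x Y) := by
  filter_upwards [hO.mem_nhds hY] with y hy
  have := h y hy
  simp only [timeSlice, dilate]
  rw [scalePoint] at this
  rw [this, inv_mul_cancel_left₀ hlam]

lemma contDiffOn_of_scalePoint {n : WithTop ℕ∞} {G : Set (ℝ × ℝ)} (hlam : lam ≠ 0)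
    (h : ∀ Y ∈ O, u (scalePoint γ T x Y) = lam * f Y)
    (hu : ContDiffOn ℝ n (timeSlice u (T - x ^ (1 / γ))) G) (hG : ∀ Y ∈ O, dilate x Y ∈ G) :
    ContDiffOn ℝ n f O := by
  refine (contDiffOn_const.mul (hu.comp (contDiff_dilate x).contDiffOn hG) :
    ContDiffOn ℝ n (fun Y => lam⁻¹ * timeSlice u (T - x ^ (1 / γ)) (dilate x Y)) O).congr ?_
  intro y hy
  have := h y hy
  simp only [timeSlice, dilate]
  rw [scalePoint] at this
  rw [this, inv_mul_cancel_left₀ hlam]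

lemma dr_scalePoint (hO : IsOpen O) (hY : Y ∈ O) (hlam : lam ≠ 0)
    (h : ∀ Y ∈ O, u (scalePoint γ T x Y) = lam * f Y)
    (hu : DifferentiableAt ℝ (timeSlice u (T - x ^ (1 / γ))) (dilate x Y)) :
    x * dr u (scalePoint γ T x Y) = lam * partialR f Y := by
  have h1 : partialR f Y
      = partialR (fun Y => lam⁻¹ * timeSlice u (T - x ^ (1 / γ)) (dilate x Y)) Y := by
    unfold partialR; rw [(eventuallyEq_of_scalePoint hO hY hlam h).fderiv_eq]
  have hd : DifferentiableAt ℝ (dilate x) Y :=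
    (contDiff_dilate x (n := 1)).differentiable (by norm_num) Y
  have h2 : partialR (fun Y => lam⁻¹ * timeSlice u (T - x ^ (1 / γ)) (dilate x Y)) Y
      = lam⁻¹ * (partialR (timeSlice u (T - x ^ (1 / γ))) (dilate x Y) * x) := by
    refine partialR_eq_of_hasDerivAt ((DifferentiableAt.comp Y hu hd).const_mul _) ?_
    have h3 : HasDerivAt (fun s : ℝ => 1 + x * s) x Y.1 := by
      simpa using ((hasDerivAt_id Y.1).const_mul x).const_add 1
    exact (HasDerivAt.comp Y.1 (h₂ := fun s => timeSlice u (T - x ^ (1 / γ)) (s, x * Y.2))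
      (h := fun s : ℝ => 1 + x * s) (hasDerivAt_partialR hu) h3).const_mul _
  rw [h1, h2, mul_inv_cancel_left₀ hlam, ← dr_eq_partialR hu, mul_comm]
  rfl

lemma dz_scalePoint (hO : IsOpen O) (hY : Y ∈ O) (hlam : lam ≠ 0)
    (h : ∀ Y ∈ O, u (scalePoint γ T x Y) = lam * f Y)
    (hu : DifferentiableAt ℝ (timeSlice u (T - x ^ (1 / γ))) (dilate x Y)) :
    x * dz u (scalePoint γ T x Y) = lam * partialZ f Y := by
  have h1 : partialZ f Y
      = partialZ (fun Y => lam⁻¹ * timeSlice u (T - x ^ (1 / γ)) (dilate x Y)) Y := by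
    unfold partialZ; rw [(eventuallyEq_of_scalePoint hO hY hlam h).fderiv_eq]
  have hd : DifferentiableAt ℝ (dilate x) Y :=
    (contDiff_dilate x (n := 1)).differentiable (by norm_num) Y
  have h2 : partialZ (fun Y => lam⁻¹ * timeSlice u (T - x ^ (1 / γ)) (dilate x Y)) Y
      = lam⁻¹ * (partialZ (timeSlice u (T - x ^ (1 / γ))) (dilate x Y) * x) := by
    refine partialZ_eq_of_hasDerivAt ((DifferentiableAt.comp Y hu hd).const_mul _) ?_
    have h3 : HasDerivAt (fun s : ℝ => x * s) x Y.2 := by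
      simpa using (hasDerivAt_id Y.2).const_mul x
    exact (HasDerivAt.comp Y.2 (h₂ := fun s => timeSlice u (T - x ^ (1 / γ)) (1 + x * Y.1, s))
      (h := fun s : ℝ => x * s) (hasDerivAt_partialZ hu) h3).const_mul _
  rw [h1, h2, mul_inv_cancel_left₀ hlam, ← dz_eq_partialZ hu, mul_comm]
  rfl

lemma fderiv_eq_dr_dz_dt {p : ℝ × ℝ × ℝ} (h : DifferentiableAt ℝ u p) (α β δ : ℝ) :
    fderiv ℝ u p (α, β, δ) = α * dr u p + β * dz u p + δ * dt u p := by
  have h1 : HasDerivAt (fun r => u (r, p.2.1, p.2.2)) (fderiv ℝ u p (1, 0, 0)) p.1 :=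
    HasFDerivAt.comp_hasDerivAt (f := fun r : ℝ => (r, p.2.1, p.2.2)) p.1
      (h.hasFDerivAt : HasFDerivAt u (fderiv ℝ u p) (p.1, p.2.1, p.2.2))
      ((hasDerivAt_id _).prodMk ((hasDerivAt_const _ _).prodMk (hasDerivAt_const _ _)))
  have h2 : HasDerivAt (fun z => u (p.1, z, p.2.2)) (fderiv ℝ u p (0, 1, 0)) p.2.1 :=
    HasFDerivAt.comp_hasDerivAt (f := fun z : ℝ => (p.1, z, p.2.2)) p.2.1
      (h.hasFDerivAt : HasFDerivAt u (fderiv ℝ u p) (p.1, p.2.1, p.2.2))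
      ((hasDerivAt_const _ _).prodMk ((hasDerivAt_id _).prodMk (hasDerivAt_const _ _)))
  have h3 : HasDerivAt (fun t => u (p.1, p.2.1, t)) (fderiv ℝ u p (0, 0, 1)) p.2.2 :=
    HasFDerivAt.comp_hasDerivAt (f := fun t : ℝ => (p.1, p.2.1, t)) p.2.2
      (h.hasFDerivAt : HasFDerivAt u (fderiv ℝ u p) (p.1, p.2.1, p.2.2))
      ((hasDerivAt_const _ _).prodMk ((hasDerivAt_const _ _).prodMk (hasDerivAt_id _)))
  unfold dr dz dt
  rw [h1.deriv, h2.deriv, h3.deriv]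
  have e : ((α, β, δ) : ℝ × ℝ × ℝ) = α • (1, 0, 0) + β • (0, 1, 0) + δ • (0, 0, 1) := by
    ext <;> simp
  rw [e, map_add, map_add, map_smul, map_smul, map_smul]
  simp

/-- The solution is differentiated along the curve of fixed `Y`. On it the series is a power series
in one variable, so the time derivative requires no differentiation of the profiles in `Y`. -/
lemma dt_scalePoint {a : ℝ} {S : Set (ℝ × ℝ × ℝ)} {U : ℕ → ℝ × ℝ → ℝ} (hγ : 0 < γ)
    (hu : HasSelfSimilarSeries γ T a S U u) (hx : 0 < x)
    (hY : scalePoint γ T x Y ∈ interior S)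
    (hd : DifferentiableAt ℝ u (scalePoint γ T x Y)) :
    x ^ (1 / γ) * dt u (scalePoint γ T x Y)
      = γ * (Y.1 * (x * dr u (scalePoint γ T x Y)) + Y.2 * (x * dz u (scalePoint γ T x Y)))
        - (x ^ (1 / γ)) ^ a * (a * profileSeries U x Y + γ * profileSeriesEuler U x Y) := by
  set p := scalePoint γ T x Y with hp
  set τ := x ^ (1 / γ) with hτ
  have hτ0 : 0 < τ := Real.rpow_pos_of_pos hx _
  obtain ⟨x₀, C, hxx, hC⟩ := hu.exists_larger_bound hγ hx hY
  have hrp : HasDerivAt (fun s : ℝ => s ^ (1 / γ)) (1 / γ * x ^ (1 / γ - 1)) x :=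
    Real.hasDerivAt_rpow_const (Or.inl hx.ne')
  -- For `τ = T - t = x^(1/γ)` this is `x dτ/dx = τ / γ`.
  have hdx : x * (1 / γ * x ^ (1 / γ - 1)) = τ / γ := by
    rw [Real.rpow_sub_one hx.ne']
    field_simp
    rw [hτ]
  have hcurve : HasDerivAt (fun s => scalePoint γ T s Y) (Y.1, Y.2, -(1 / γ * x ^ (1 / γ - 1))) x := by
    refine HasDerivAt.prodMk ?_ (HasDerivAt.prodMk ?_ (hrp.const_sub T))
    · simpa using ((hasDerivAt_id x).mul_const Y.1).const_add 1
    · simpa using (hasDerivAt_id x).mul_const Y.2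
  have h1 : HasDerivAt (fun s => u (scalePoint γ T s Y))
      (fderiv ℝ u p (Y.1, Y.2, -(1 / γ * x ^ (1 / γ - 1)))) x :=
    HasFDerivAt.comp_hasDerivAt (f := fun s => scalePoint γ T s Y) x hd.hasFDerivAt hcurve
  have h2 : HasDerivAt (fun s => (s ^ (1 / γ)) ^ a * profileSeries U s Y)
      ((1 / γ * x ^ (1 / γ - 1)) * a * τ ^ (a - 1) * profileSeries U x Y
        + τ ^ a * (x⁻¹ * profileSeriesEuler U x Y)) x :=
    (hrp.rpow_const (Or.inl hτ0.ne')).mul (hasDerivAt_tsum_pow hx hxx hC)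
  have h3 : (fun s => (s ^ (1 / γ)) ^ a * profileSeries U s Y)
      =ᶠ[𝓝 x] fun s => u (scalePoint γ T s Y) := by
    filter_upwards [(continuousAt_scalePoint hx Y).eventually (isOpen_interior.mem_nhds hY),
      Ioi_mem_nhds hx] with s h4 h5 using (hu.eq_profileSeries hγ h5 h4).symm
  have h4 := (h1.congr_of_eventuallyEq h3).unique h2
  rw [fderiv_eq_dr_dz_dt hd, Real.rpow_sub_one hτ0.ne'] at h4
  have h5 : γ * x * (Y.1 * dr u p + Y.2 * dz u p) - γ * (x * (1 / γ * x ^ (1 / γ - 1))) * dt u p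
      = γ * (x * (1 / γ * x ^ (1 / γ - 1))) * a * (τ ^ a / τ) * profileSeries U x Y
        + γ * τ ^ a * (x * x⁻¹) * profileSeriesEuler U x Y := by
    linear_combination γ * x * h4
  rw [hdx, mul_div_cancel₀ _ hγ.ne', mul_inv_cancel₀ hx.ne'] at h5
  have h6 : τ * a * (τ ^ a / τ) = a * τ ^ a := by field_simp
  rw [h6] at h5
  linear_combination -h5

end derivatives

/-! ### Self-similar solutions of the Euler system -/

/-- A classical solution of the Euler system on an admissible region with a self-similar
expansion. -/
structure SelfSimilarSolution (γ T : ℝ) (S : Set (ℝ × ℝ × ℝ)) (u₁ ω₁ ψ₁ : ℝ × ℝ × ℝ → ℝ)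
    (U Ω Ψ : ℕ → ℝ × ℝ → ℝ) : Prop where
  pos : 0 < γ
  region : IsAdmissibleRegion γ T S
  sol : IsClassicalSolution (interior S) u₁ ω₁ ψ₁
  series_u : HasSelfSimilarSeries γ T (-1 + γ / 2) S U u₁
  series_ω : HasSelfSimilarSeries γ T (-1) S Ω ω₁
  series_ψ : HasSelfSimilarSeries γ T (-1 + 2 * γ) S Ψ ψ₁
  contDiffOn_U : ∀ k, ContDiffOn ℝ 1 (U k) leftHalfPlane
  contDiffOn_Ω : ∀ k, ContDiffOn ℝ 1 (Ω k) leftHalfPlane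
  contDiffOn_Ψ : ∀ k, ContDiffOn ℝ 1 (Ψ k) leftHalfPlane
  bc : ∀ k, ∀ Z : ℝ, (profileGrad (Ψ k) (0, Z)).2 = 0

lemma isOpen_timeSlice {G : Set (ℝ × ℝ × ℝ)} (hG : IsOpen G) (t : ℝ) :
    IsOpen {y : ℝ × ℝ | (y.1, y.2, t) ∈ G} :=
  hG.preimage (f := fun y : ℝ × ℝ => (y.1, y.2, t)) (by fun_prop)

lemma ContDiffOn.timeSlice {n : WithTop ℕ∞} {u : ℝ × ℝ × ℝ → ℝ} {G : Set (ℝ × ℝ × ℝ)}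
    (hu : ContDiffOn ℝ n u G) (t : ℝ) :
    ContDiffOn ℝ n (_root_.timeSlice u t) {y : ℝ × ℝ | (y.1, y.2, t) ∈ G} :=
  hu.comp (t := G) (f := fun y : ℝ × ℝ => (y.1, y.2, t))
    (contDiff_fst.prodMk (contDiff_snd.prodMk contDiff_const)).contDiffOn fun _ hy => hy

/-- With `T - t = x^(1/γ)`, the stream function scales like `x² / (T - t)`: each space derivative
costs one factor `x`, and the velocity has size `x / (T - t)`. -/
lemma rpow_stream_exponent {γ x : ℝ} (hγ : 0 < γ) (hx : 0 < x) :
    (x ^ (1 / γ)) ^ (-1 + 2 * γ) = (x ^ (1 / γ))⁻¹ * x ^ 2 := by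
  have h := rpow_one_div_rpow_mul hγ hx 2
  rw [Nat.cast_ofNat] at h
  rw [Real.rpow_add (Real.rpow_pos_of_pos hx _), Real.rpow_neg_one, h]

namespace SelfSimilarSolution

variable {γ T M x : ℝ} {S : Set (ℝ × ℝ × ℝ)} {u₁ ω₁ ψ₁ : ℝ × ℝ × ℝ → ℝ}
  {U Ω Ψ : ℕ → ℝ × ℝ → ℝ} {Y : ℝ × ℝ}

lemma stream_eq_profileSeries (h : SelfSimilarSolution γ T S u₁ ω₁ ψ₁ U Ω Ψ)
    (hx : x ∈ scaleSet γ T S M) (hY : Y ∈ profileBox M) :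
    ψ₁ (scalePoint γ T x Y) = (x ^ (1 / γ))⁻¹ * x ^ 2 * profileSeries Ψ x Y := by
  rw [h.series_ψ.eq_profileSeries h.pos hx.1 (hx.2 Y hY), rpow_stream_exponent h.pos hx.1]

lemma stream_differentiableAt (h : SelfSimilarSolution γ T S u₁ ω₁ ψ₁ U Ω Ψ)
    {t : ℝ} {y : ℝ × ℝ} (hy : (y.1, y.2, t) ∈ interior S) :
    DifferentiableAt ℝ (timeSlice ψ₁ t) y :=
  ((h.sol.contDiffOn_ψ t).contDiffAt ((isOpen_timeSlice isOpen_interior t).mem_nhds hy)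
    ).differentiableAt (by norm_num)

lemma contDiffOn_stream (h : SelfSimilarSolution γ T S u₁ ω₁ ψ₁ U Ω Ψ)
    (hx : x ∈ scaleSet γ T S M) : ContDiffOn ℝ 2 (profileSeries Ψ x) (profileBox M) := by
  have hx0 := hx.1
  exact contDiffOn_of_scalePoint (by positivity) (fun Y hY => h.stream_eq_profileSeries hx hY)
    (h.sol.contDiffOn_ψ _) hx.2

lemma dr_stream (h : SelfSimilarSolution γ T S u₁ ω₁ ψ₁ U Ω Ψ)
    (hx : x ∈ scaleSet γ T S M) (hY : Y ∈ profileBox M) :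
    dr ψ₁ (scalePoint γ T x Y) = (x ^ (1 / γ))⁻¹ * x * partialR (profileSeries Ψ x) Y := by
  have hx0 := hx.1
  have h1 := dr_scalePoint (isOpen_profileBox M) hY (by positivity)
    (fun Y hY => h.stream_eq_profileSeries hx hY) (h.stream_differentiableAt (hx.2 Y hY))
  refine mul_left_cancel₀ hx0.ne' (h1.trans ?_)
  ring

lemma dz_stream (h : SelfSimilarSolution γ T S u₁ ω₁ ψ₁ U Ω Ψ)
    (hx : x ∈ scaleSet γ T S M) (hY : Y ∈ profileBox M) :
    dz ψ₁ (scalePoint γ T x Y) = (x ^ (1 / γ))⁻¹ * x * partialZ (profileSeries Ψ x) Y := by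
  have hx0 := hx.1
  have h1 := dz_scalePoint (isOpen_profileBox M) hY (by positivity)
    (fun Y hY => h.stream_eq_profileSeries hx hY) (h.stream_differentiableAt (hx.2 Y hY))
  refine mul_left_cancel₀ hx0.ne' (h1.trans ?_)
  ring

lemma dr_dr_stream (h : SelfSimilarSolution γ T S u₁ ω₁ ψ₁ U Ω Ψ)
    (hx : x ∈ scaleSet γ T S M) (hY : Y ∈ profileBox M) :
    dr (dr ψ₁) (scalePoint γ T x Y)
      = (x ^ (1 / γ))⁻¹ * partialR (partialR (profileSeries Ψ x)) Y := by
  have hx0 := hx.1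
  have hG := isOpen_timeSlice (isOpen_interior (s := S)) (T - x ^ (1 / γ))
  have hd : DifferentiableAt ℝ (timeSlice (dr ψ₁) (T - x ^ (1 / γ))) (dilate x Y) := by
    have h2 : ContDiffOn ℝ 1 (partialR (timeSlice ψ₁ (T - x ^ (1 / γ)))) _ :=
      ContDiffOn.partialR (n := 2) (m := 1) hG (h.sol.contDiffOn_ψ _) (by norm_num)
    refine ((h2.contDiffAt (hG.mem_nhds (hx.2 Y hY))).differentiableAt
      (by norm_num)).congr_of_eventuallyEq ?_
    filter_upwards [hG.mem_nhds (hx.2 Y hY)] with y hy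
    exact dr_eq_partialR (h.stream_differentiableAt hy)
  have h1 := dr_scalePoint (isOpen_profileBox M) hY (by positivity)
    (fun Y hY => h.dr_stream hx hY) hd
  refine mul_left_cancel₀ hx0.ne' (h1.trans ?_)
  ring

lemma dz_dz_stream (h : SelfSimilarSolution γ T S u₁ ω₁ ψ₁ U Ω Ψ)
    (hx : x ∈ scaleSet γ T S M) (hY : Y ∈ profileBox M) :
    dz (dz ψ₁) (scalePoint γ T x Y)
      = (x ^ (1 / γ))⁻¹ * partialZ (partialZ (profileSeries Ψ x)) Y := by
  have hx0 := hx.1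
  have hG := isOpen_timeSlice (isOpen_interior (s := S)) (T - x ^ (1 / γ))
  have hd : DifferentiableAt ℝ (timeSlice (dz ψ₁) (T - x ^ (1 / γ))) (dilate x Y) := by
    have h2 : ContDiffOn ℝ 1 (partialZ (timeSlice ψ₁ (T - x ^ (1 / γ)))) _ :=
      ContDiffOn.partialZ (n := 2) (m := 1) hG (h.sol.contDiffOn_ψ _) (by norm_num)
    refine ((h2.contDiffAt (hG.mem_nhds (hx.2 Y hY))).differentiableAt
      (by norm_num)).congr_of_eventuallyEq ?_
    filter_upwards [hG.mem_nhds (hx.2 Y hY)] with y hy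
    exact dz_eq_partialZ (h.stream_differentiableAt hy)
  have h1 := dz_scalePoint (isOpen_profileBox M) hY (by positivity)
    (fun Y hY => h.dz_stream hx hY) hd
  refine mul_left_cancel₀ hx0.ne' (h1.trans ?_)
  ring

lemma rescaled_stream_equation (h : SelfSimilarSolution γ T S u₁ ω₁ ψ₁ U Ω Ψ)
    (hx : x ∈ scaleSet γ T S M) (hY : Y ∈ profileBox M) :
    -(partialR (partialR (profileSeries Ψ x)) Y
      + 3 * x / (1 + x * Y.1) * partialR (profileSeries Ψ x) Y
      + partialZ (partialZ (profileSeries Ψ x)) Y) = profileSeries Ω x Y := by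
  have hτ : 0 < x ^ (1 / γ) := Real.rpow_pos_of_pos hx.1 _
  have h1 := h.sol.eq_ψ _ (hx.2 Y hY)
  rw [h.series_ω.eq_profileSeries h.pos hx.1 (hx.2 Y hY), h.dr_dr_stream hx hY,
    h.dz_dz_stream hx hY, h.dr_stream hx hY, Real.rpow_neg_one] at h1
  refine mul_left_cancel₀ (inv_pos.2 hτ).ne' (Eq.trans ?_ h1)
  simp only [scalePoint, div_eq_mul_inv]
  ring

lemma eventually_mem_scaleSet : ∀ᶠ x in scaleFilter γ T S M, x ∈ scaleSet γ T S M :=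
  mem_inf_of_right (mem_principal_self _)

lemma streamFamily (h : SelfSimilarSolution γ T S u₁ ω₁ ψ₁ U Ω Ψ) (hM : 0 < M) :
    StreamFamily (scaleFilter γ T S M) (profileBox M) (profileSeries Ψ) (profileSeries Ω)
      (Ψ 0) where
  isOpen := isOpen_profileBox M
  le_nhds := inf_le_left
  pos := by
    have h1 : ∀ᶠ x in 𝓝[>] (0 : ℝ), x ≤ 1 / (2 * M) :=
      (eventually_le_nhds (by positivity)).filter_mono nhdsWithin_le_nhds
    filter_upwards [(eventually_mem_nhdsWithin.and h1).filter_mono inf_le_left] with x hx Y hY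
    have hx0 : 0 < x := hx.1
    have h2 := hx.2
    rw [le_div_iff₀ (by positivity)] at h2
    have h3 := mul_lt_mul_of_pos_left hY.1.1 hx0
    linarith
  contDiffOn := eventually_mem_scaleSet.mono fun x hx => h.contDiffOn_stream hx
  contDiffOn_limit := (h.contDiffOn_Ψ 0).mono
    ((profileBox_subset M).trans openLeftHalfPlane_subset)
  eq := eventually_mem_scaleSet.mono fun x hx Y hY => h.rescaled_stream_equation hx hY
  near := fun K hKM hK => by
    obtain ⟨x₀, C, hx₀, hC, hev⟩ := h.series_ψ.exists_scale_bound h.pos h.region hM hK hKM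
      fun k => (h.contDiffOn_Ψ k).continuousOn.mono
        (hKM.trans ((profileBox_subset M).trans openLeftHalfPlane_subset))
    obtain ⟨C', hC'⟩ := profileSeries_sub_leading_le hx₀ hC 0 (by simp)
    refine ⟨C', hev.mono fun x hx Y hY => ?_⟩
    simpa using (hC' x hx.1 hx.2 Y hY).1
  bound := fun K hKM hK => by
    have hc := fun k => (h.contDiffOn_Ω k).continuousOn.mono
        (hKM.trans ((profileBox_subset M).trans openLeftHalfPlane_subset))
    obtain ⟨x₀, C, hx₀, hC, hev⟩ := h.series_ω.exists_scale_bound h.pos h.region hM hK hKM hc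
    obtain ⟨C', hC'⟩ := profileSeries_sub_leading_le hx₀ hC 0 (by simp)
    obtain ⟨B, -, hB⟩ := exists_forall_abs_le hK (hc 0)
    refine ⟨B + |C'| * x₀, hev.mono fun x hx Y hY => ?_⟩
    have h1 : |profileSeries Ω x Y - Ω 0 Y| ≤ C' * x := by
      simpa using (hC' x hx.1 hx.2 Y hY).1
    have h2 : C' * x ≤ |C'| * x₀ := by
      have h3 : x ≤ x₀ := by linarith [hx.2]
      have h4 := le_abs_self C'
      have h5 := hx.1.le
      gcongr
    have h3 := abs_sub_abs_le_abs_sub (profileSeries Ω x Y) (Ω 0 Y)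
    have h4 := hB Y hY
    linarith

/-- Common form of both evolution equations, with `β = 2` for `u₁` and `β = 0` for `ω₁` once `u₁ =
0`. The stretching term keeps a factor `x` that the transport terms lose to the space derivative. -/
lemma rescaled_transport_equation (h : SelfSimilarSolution γ T S u₁ ω₁ ψ₁ U Ω Ψ) {a β : ℝ}
    {v : ℝ × ℝ × ℝ → ℝ} {V : ℕ → ℝ × ℝ → ℝ} (hv : HasSelfSimilarSeries γ T a S V v)
    (hvC : ContDiffOn ℝ 1 v (interior S))
    (heq : ∀ p ∈ interior S, dt v p + radialVelocity ψ₁ p * dr v p + axialVelocity ψ₁ p * dz v p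
      = β * v p * dz ψ₁ p)
    (hx : x ∈ scaleSet γ T S M) (hY : Y ∈ profileBox M) :
    γ * (Y.1 * partialR (profileSeries V x) Y + Y.2 * partialZ (profileSeries V x) Y)
      + -(1 + x * Y.1) * partialZ (profileSeries Ψ x) Y * partialR (profileSeries V x) Y
      + (2 * x * profileSeries Ψ x Y + (1 + x * Y.1) * partialR (profileSeries Ψ x) Y)
        * partialZ (profileSeries V x) Y
      = (a * profileSeries V x Y + γ * profileSeriesEuler V x Y)
        + β * x * profileSeries V x Y * partialZ (profileSeries Ψ x) Y := by
  have hp := hx.2 Y hY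
  have hτ : 0 < x ^ (1 / γ) := Real.rpow_pos_of_pos hx.1 _
  have hl : 0 < (x ^ (1 / γ)) ^ a := Real.rpow_pos_of_pos hτ _
  have hd : DifferentiableAt ℝ v (scalePoint γ T x Y) :=
    (hvC.contDiffAt (isOpen_interior.mem_nhds hp)).differentiableAt (by norm_num)
  have hds : DifferentiableAt ℝ (timeSlice v (T - x ^ (1 / γ))) (dilate x Y) :=
    ((hvC.timeSlice _).contDiffAt ((isOpen_timeSlice isOpen_interior _).mem_nhds hp)
      ).differentiableAt (by norm_num)
  have hrep : ∀ Y ∈ profileBox M, v (scalePoint γ T x Y)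
      = (x ^ (1 / γ)) ^ a * profileSeries V x Y := fun Y hY =>
    hv.eq_profileSeries h.pos hx.1 (hx.2 Y hY)
  have e1 := heq _ hp
  have e2 := dt_scalePoint h.pos hv hx.1 hp hd
  have e3 := dr_scalePoint (isOpen_profileBox M) hY hl.ne' hrep hds
  have e4 := dz_scalePoint (isOpen_profileBox M) hY hl.ne' hrep hds
  rw [radialVelocity, axialVelocity, h.dz_stream hx hY, h.dr_stream hx hY,
    h.stream_eq_profileSeries hx hY, hrep Y hY] at e1
  rw [e3, e4] at e2
  have e5 : (scalePoint γ T x Y).1 = 1 + x * Y.1 := rfl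
  rw [e5] at e1
  set τ := x ^ (1 / γ)
  set lam := τ ^ a
  set p := scalePoint γ T x Y
  have hi : τ * τ⁻¹ = 1 := mul_inv_cancel₀ hτ.ne'
  have e6 : τ * dt v p + (τ * τ⁻¹) * (-(1 + x * Y.1) * partialZ (profileSeries Ψ x) Y * (x * dr v p)
      + (2 * x * profileSeries Ψ x Y + (1 + x * Y.1) * partialR (profileSeries Ψ x) Y) * (x * dz v p))
      = (τ * τ⁻¹) * (β * (lam * profileSeries V x Y) * x * partialZ (profileSeries Ψ x) Y) := by
    linear_combination τ * e1
  rw [hi, e2, e3, e4] at e6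
  refine mul_left_cancel₀ hl.ne' ?_
  linear_combination e6

lemma partialR_const_mul {f : ℝ × ℝ → ℝ} (hf : DifferentiableAt ℝ f Y) (c : ℝ) :
    partialR (fun Y => c * f Y) Y = c * partialR f Y :=
  partialR_eq_of_hasDerivAt (hf.const_mul c) ((hasDerivAt_partialR hf).const_mul c)

lemma partialZ_const_mul {f : ℝ × ℝ → ℝ} (hf : DifferentiableAt ℝ f Y) (c : ℝ) :
    partialZ (fun Y => c * f Y) Y = c * partialZ f Y :=
  partialZ_eq_of_hasDerivAt (hf.const_mul c) ((hasDerivAt_partialZ hf).const_mul c)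

/-- Strong induction: once the profiles below `k` vanish, the series divided by `x^k` converges to
`V k`, and its Euler derivative to `k V k`. Hence `V k` solves the limit equation with `σ = a + γ
k`. -/
theorem profiles_eq_zero (h : SelfSimilarSolution γ T S u₁ ω₁ ψ₁ U Ω Ψ) {a β : ℝ}
    {v : ℝ × ℝ × ℝ → ℝ} {V : ℕ → ℝ × ℝ → ℝ} (hv : HasSelfSimilarSeries γ T a S V v)
    (hvC : ContDiffOn ℝ 1 v (interior S))
    (heq : ∀ p ∈ interior S, dt v p + radialVelocity ψ₁ p * dr v p + axialVelocity ψ₁ p * dz v p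
      = β * v p * dz ψ₁ p)
    (hV : ∀ k, ContDiffOn ℝ 1 (V k) leftHalfPlane)
    (hdecay : ∀ k, Tendsto (V k) profileInfinity (𝓝 0)) (k : ℕ) :
    ∀ Y ∈ openLeftHalfPlane, V k Y = 0 := by
  induction k using Nat.strong_induction_on with
  | _ k ih =>
  refine transport_liouville (σ := a + γ * k) h.pos (hV k) (h.contDiffOn_Ψ 0) (hdecay k) (h.bc 0) ?_
  intro Φ hΦ χ hχ hχc hχO
  obtain ⟨M, hM, hχM⟩ := exists_subset_profileBox hχc.isCompact hχO
  have := h.region.neBot_scaleFilter h.pos hM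
  have hsub := (profileBox_subset M).trans openLeftHalfPlane_subset
  have key : ∀ K ⊆ profileBox M, IsCompact K → ∃ C, 0 ≤ C ∧ ∀ᶠ x in scaleFilter γ T S M,
      0 < x ∧ ∀ Y ∈ K, |profileSeries V x Y - x ^ k * V k Y| ≤ C * x ^ (k + 1) ∧
        |profileSeriesEuler V x Y - x ^ k * (k * V k Y)| ≤ C * x ^ (k + 1) := by
    intro K hKM hK
    obtain ⟨x₀, C, hx₀, hC, hev⟩ := hv.exists_scale_bound h.pos h.region hM hK hKM
      fun k => (hV k).continuousOn.mono (hKM.trans hsub)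
    obtain ⟨C', hC'⟩ := profileSeries_sub_leading_le hx₀ hC k
      fun j hj Y hY => ih j hj Y (profileBox_subset M (hKM hY))
    refine ⟨|C'|, abs_nonneg _, hev.mono fun x hx => ⟨hx.1, fun Y hY => ?_⟩⟩
    have h1 := hC' x hx.1 hx.2 Y hY
    have h2 : C' * x ^ (k + 1) ≤ |C'| * x ^ (k + 1) :=
      mul_le_mul_of_nonneg_right (le_abs_self _) (pow_nonneg hx.1.le _)
    exact ⟨h1.1.trans h2, h1.2.trans h2⟩
  have hscale : ∀ {x e C : ℝ}, 0 < x → |e| ≤ C * x ^ (k + 1) → |(x ^ k)⁻¹ * e| ≤ C * x := by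
    intro x e C hx he
    have hp := pow_pos hx k
    rw [abs_mul, abs_of_pos (inv_pos.2 hp), inv_mul_le_iff₀ hp]
    calc |e| ≤ C * x ^ (k + 1) := he
      _ = _ := by ring
  have hcont : ∀ x ∈ scaleSet γ T S M, ContDiffOn ℝ 1 (profileSeries V x) (profileBox M) := by
    intro x hx
    have hl : 0 < (x ^ (1 / γ)) ^ a := Real.rpow_pos_of_pos (Real.rpow_pos_of_pos hx.1 _) _
    exact contDiffOn_of_scalePoint hl.ne'
      (fun Y hY => hv.eq_profileSeries h.pos hx.1 (hx.2 Y hY)) (hvC.timeSlice _) hx.2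
  refine (h.streamFamily hM).transport_weak_limit (β := β)
    (g := fun x Y => (x ^ k)⁻¹ * profileSeries V x Y)
    (s := fun x Y => (x ^ k)⁻¹ * (a * profileSeries V x Y + γ * profileSeriesEuler V x Y))
    ((hV k).mono hsub) ?_ ?_ ?_ ?_ hΦ hχ hχc hχM
  · exact eventually_mem_scaleSet.mono fun x hx => contDiffOn_const.mul (hcont x hx)
  · intro K hKM hK
    obtain ⟨C, -, hC⟩ := key K hKM hK
    refine ⟨C, hC.mono fun x hx Y hY => ?_⟩
    have hp := pow_pos hx.1 k
    have h1 := hscale hx.1 (hx.2 Y hY).1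
    rwa [mul_sub, inv_mul_cancel_left₀ hp.ne'] at h1
  · intro K hKM hK
    obtain ⟨C, hC0, hC⟩ := key K hKM hK
    refine ⟨|a| * C + |γ| * C, hC.mono fun x hx Y hY => ?_⟩
    have hp := pow_pos hx.1 k
    have h1 := hscale hx.1 (hx.2 Y hY).1
    have h2 := hscale hx.1 (hx.2 Y hY).2
    rw [mul_sub, inv_mul_cancel_left₀ hp.ne'] at h1 h2
    calc |(x ^ k)⁻¹ * (a * profileSeries V x Y + γ * profileSeriesEuler V x Y)
          - (a + γ * k) * V k Y|
        = |a * ((x ^ k)⁻¹ * profileSeries V x Y - V k Y)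
          + γ * ((x ^ k)⁻¹ * profileSeriesEuler V x Y - k * V k Y)| := by ring_nf
      _ ≤ |a| * (C * x) + |γ| * (C * x) := by
          refine (abs_add_le _ _).trans ?_
          rw [abs_mul, abs_mul]
          gcongr
      _ = _ := by ring
  · refine eventually_mem_scaleSet.mono fun x hx Y hY => ?_
    have hd : DifferentiableAt ℝ (profileSeries V x) Y :=
      ((hcont x hx).contDiffAt ((isOpen_profileBox M).mem_nhds hY)).differentiableAt (by norm_num)
    rw [partialR_const_mul hd, partialZ_const_mul hd]
    linear_combination (x ^ k)⁻¹ * h.rescaled_transport_equation hv hvC heq hx hY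

/-- The stream function profiles are constant if the vorticity vanishes. -/
theorem stream_profiles_const (h : SelfSimilarSolution γ T S u₁ ω₁ ψ₁ U Ω Ψ)
    (hΩ : ∀ k, ∀ Y ∈ openLeftHalfPlane, Ω k Y = 0)
    (hgrad : ∀ k, (fun Y => euclNorm (profileGrad (Ψ k) Y)) =o[profileInfinity] euclNorm) :
    ∃ d : ℕ → ℝ, ∀ k, ∀ Y ∈ openLeftHalfPlane, Ψ k Y = d k := by
  -- The inductive step: if the orders below `k` sum to a constant plus `B(x) R` with `x B = c x^k`,
  -- then the equation at order `k` gives `c = 0` and an affine profile.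
  have step : ∀ (k : ℕ) (d : ℕ → ℝ) (c : ℝ) (B : ℝ → ℝ), (∀ x, x * B x = c * x ^ k) →
      (∀ x, ∀ Y ∈ openLeftHalfPlane, ∑ j ∈ Finset.range k, x ^ j * Ψ j Y
        = ∑ j ∈ Finset.range k, x ^ j * d j + B x * Y.1) →
      c = 0 ∧ ∃ A e, ∀ Y ∈ openLeftHalfPlane, Ψ k Y = A * Y.1 + e := by
    intro k d c B hB hsum
    refine elliptic_liouville (h.contDiffOn_Ψ k) (hgrad k) (h.bc k) ?_
    intro χ hχ hχc hχO
    obtain ⟨M, hM, hχM⟩ := exists_subset_profileBox hχc.isCompact hχO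
    have := h.region.neBot_scaleFilter h.pos hM
    have hsub := (profileBox_subset M).trans openLeftHalfPlane_subset
    refine (h.streamFamily hM).stream_weak_limit
      (A := fun x => ∑ j ∈ Finset.range k, x ^ j * d j) ?_
      ((h.contDiffOn_Ψ k).continuousOn.mono hsub) (Eventually.of_forall hB) ?_ hχ hχc hχM
    · refine Eventually.of_forall fun x Y hY => ?_
      simp [profileSeries, hΩ _ Y (profileBox_subset M hY)]
    · intro K hKM hK
      obtain ⟨x₀, C, hx₀, hC, hev⟩ := h.series_ψ.exists_scale_bound h.pos h.region hM hK hKM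
        fun k => (h.contDiffOn_Ψ k).continuousOn.mono (hKM.trans hsub)
      -- With the first `k` profiles replaced by zero, the remainder estimate for a series starting
      -- at order `k` applies; the removed terms are the finite sum controlled by `hsum`.
      let V : ℕ → ℝ × ℝ → ℝ := fun j Y => if j < k then 0 else Ψ j Y
      have hVC : ∀ j, ∀ Y ∈ K, |V j Y| * x₀ ^ j ≤ C := fun j Y hY => by
        have h1 := hC j Y hY
        simp only [V]
        split_ifs
        · rw [abs_zero, zero_mul]
          exact (by positivity : 0 ≤ |Ψ j Y| * x₀ ^ j).trans h1
        · exact h1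
      obtain ⟨C', hC'⟩ := profileSeries_sub_leading_le hx₀ hVC k fun j hj Y _ => if_pos hj
      refine ⟨C', hev.mono fun x hx Y hY => ?_⟩
      have h1 := (hC' x hx.1 hx.2 Y hY).1
      have hYo := profileBox_subset M (hKM hY)
      have h2 : profileSeries Ψ x Y
          = ∑ j ∈ Finset.range k, x ^ j * Ψ j Y + profileSeries V x Y := by
        have hs : Summable fun j => x ^ j * V j Y :=
          summable_pow_mul_of_bound hx.1 (by linarith [hx.2]) fun j => hVC j Y hY
        have hf : HasSum (fun j => if j < k then x ^ j * Ψ j Y else 0)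
            (∑ j ∈ Finset.range k, x ^ j * Ψ j Y) := by
          rw [← Finset.sum_congr rfl fun j hj => if_pos (Finset.mem_range.1 hj)]
          exact hasSum_sum_of_ne_finset_zero fun j hj => if_neg (by simpa using hj)
        refine Eq.trans ?_ (hf.add hs.hasSum).tsum_eq
        refine tsum_congr fun j => ?_
        simp only [V]
        split_ifs <;> ring
      have h3 : V k Y = Ψ k Y := if_neg (lt_irrefl k)
      rw [h3] at h1
      rw [h2, hsum x Y hYo, add_sub_cancel_left]
      exact h1
  -- The induction carries one profile that is affine but not yet known to be constant; its slope is
  -- shown to vanish at the next order.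
  have main : ∀ k, ∃ d : ℕ → ℝ, (∀ j < k, ∀ Y ∈ openLeftHalfPlane, Ψ j Y = d j) ∧
      ∃ c, ∀ Y ∈ openLeftHalfPlane, Ψ k Y = c * Y.1 + d k := by
    intro k
    induction k with
    | zero =>
      obtain ⟨-, A, e, hA⟩ := step 0 (fun _ => 0) 0 (fun _ => 0) (by simp) (by simp)
      exact ⟨fun _ => e, by simp, A, hA⟩
    | succ k ih =>
      obtain ⟨d, hd, c, hc⟩ := ih
      obtain ⟨hc0, A, e, hA⟩ := step (k + 1) d c (fun x => c * x ^ k) (fun x => by ring)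
        (fun x Y hY => by
          rw [Finset.sum_range_succ, Finset.sum_range_succ, hc Y hY,
            Finset.sum_congr rfl fun j hj => by rw [hd j (Finset.mem_range.1 hj) Y hY]]
          ring)
      refine ⟨fun j => if j < k + 1 then d j else e, fun j hj Y hY => ?_, A, fun Y hY => ?_⟩
      · beta_reduce
        rw [if_pos hj]
        rcases Nat.lt_succ_iff_lt_or_eq.1 hj with h1 | rfl
        · exact hd j h1 Y hY
        · rw [hc Y hY, hc0]; ring
      · beta_reduce
        rw [if_neg (lt_irrefl _), hA Y hY]
  -- The constants from `main` depend on the chosen order, so a sample value of each profile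
  -- replaces them.
  refine ⟨fun k => Ψ k (-1, 0), fun k Y hY => ?_⟩
  obtain ⟨d, hd, -⟩ := main (k + 1)
  beta_reduce
  rw [hd k (Nat.lt_succ_self k) Y hY, hd k (Nat.lt_succ_self k) (-1, 0) (by
    show (-1 : ℝ) < 0
    norm_num)]

end SelfSimilarSolution

/-! ### Conclusion for the Euler system. -/

lemma HasSelfSimilarSeries.hasFDerivAt_slice {γ T a : ℝ} {S : Set (ℝ × ℝ × ℝ)}
    {Ψ : ℕ → ℝ × ℝ → ℝ} {ψ : ℝ × ℝ × ℝ → ℝ} (hS : IsAdmissibleRegion γ T S)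
    (hψ : HasSelfSimilarSeries γ T a S Ψ ψ) {d : ℕ → ℝ}
    (hd : ∀ k, ∀ Y ∈ openLeftHalfPlane, Ψ k Y = d k) {r z t : ℝ} (h : (r, z, t) ∈ S) :
    HasFDerivAt (fun y : ℝ × ℝ => ψ (y.1, y.2, t)) (0 : ℝ × ℝ →L[ℝ] ℝ) (r, z) := by
  -- With constant profiles the partial sums depend on `t` alone, so `ψ` is locally constant in the
  -- slice, at every point of `S`.
  refine (hasFDerivAt_const (ψ (r, z, t)) (r, z)).congr_of_eventuallyEq ?_
  filter_upwards [(hS.isOpen_slice t).mem_nhds h] with y hy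
  have h1 := hψ.tendsto_at hy
  have h2 := hψ.tendsto_at h
  simp only [hd _ _ (hS.similarityVar_mem hy)] at h1
  simp only [hd _ _ (hS.similarityVar_mem h)] at h2
  exact tendsto_nhds_unique h1 h2

end

theorem theorem2 (γ T : ℝ) (hγ : 0 < γ)
    (S : Set (ℝ × ℝ × ℝ)) (hS : IsAdmissibleRegion γ T S)
    (u₁ ω₁ ψ₁ : ℝ × ℝ × ℝ → ℝ)
    (hsol : IsClassicalSolution (interior S) u₁ ω₁ ψ₁)
    (U Ω Ψ : ℕ → ℝ × ℝ → ℝ)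
    (hu : HasSelfSimilarSeries γ T (-1 + γ / 2) S U u₁)
    (hω : HasSelfSimilarSeries γ T (-1) S Ω ω₁)
    (hψ : HasSelfSimilarSeries γ T (-1 + 2 * γ) S Ψ ψ₁)
    (hC1 : ∀ k, ContDiffOn ℝ 1 (U k) leftHalfPlane ∧ ContDiffOn ℝ 1 (Ω k) leftHalfPlane ∧
      ContDiffOn ℝ 1 (Ψ k) leftHalfPlane)
    (hdecay : ∀ k, Tendsto (fun Y => |U k Y| + |Ω k Y|) profileInfinity (𝓝 0))
    (hgrad : ∀ k, (fun Y => euclNorm (profileGrad (Ψ k) Y)) =o[profileInfinity] euclNorm)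
    (hbc : ∀ k, ∀ Z : ℝ, (profileGrad (Ψ k) (0, Z)).2 = 0)
    (p : ℕ) (hp : 0 < p) (hpe : Even p)
    (hint : ∀ k : ℕ, (k : ℝ) ≤ 1 / γ →
      Tendsto (fun ρ : ℝ => ∫ Y in halfAnnulus ρ, (U k Y ^ p + Ω k Y ^ p)) atTop (𝓝 0)) :
    ∀ r z t : ℝ, (r, z, t) ∈ S →
      u₁ (r, z, t) = 0 ∧ ω₁ (r, z, t) = 0 ∧
      HasFDerivAt (fun y : ℝ × ℝ => ψ₁ (y.1, y.2, t)) (0 : ℝ × ℝ →L[ℝ] ℝ) (r, z) := by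
  have h : SelfSimilarSolution γ T S u₁ ω₁ ψ₁ U Ω Ψ :=
    ⟨hγ, hS, hsol, hu, hω, hψ, fun k => (hC1 k).1, fun k => (hC1 k).2.1, fun k => (hC1 k).2.2, hbc⟩
  -- The equation of `u₁` comes first: its right-hand side is linear in `u₁`, whereas that of `ω₁`
  -- contains `∂_z(u₁²)`.
  have hU0 := h.profiles_eq_zero (β := 2) h.series_u hsol.contDiffOn_u hsol.eq_u h.contDiffOn_U
    fun k => squeeze_zero_norm (fun Y => le_add_of_nonneg_right (abs_nonneg _)) (hdecay k)
  have hu0 : ∀ y ∈ S, u₁ y = 0 := fun y hy => hu.eq_zero hS hU0 hy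
  have hsq : ∀ y ∈ interior S, dz (fun y => u₁ y ^ 2) y = 0 := by
    intro y hy
    have h1 : (fun z => u₁ (y.1, z, y.2.2) ^ 2) =ᶠ[𝓝 y.2.1] fun _ => 0 := by
      have hc : Continuous fun z : ℝ => (y.1, z, y.2.2) := by fun_prop
      filter_upwards [(isOpen_interior.preimage hc).mem_nhds (show y.2.1 ∈ _ from hy)] with z hz
      rw [hu0 _ (interior_subset hz)]
      norm_num
    unfold dz
    rw [h1.deriv_eq, deriv_const]
  have hΩ0 := h.profiles_eq_zero (β := 0) h.series_ω hsol.contDiffOn_ω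
    (fun y hy => by rw [hsol.eq_ω y hy, hsq y hy]; ring) h.contDiffOn_Ω
    fun k => squeeze_zero_norm (fun Y => le_add_of_nonneg_left (abs_nonneg _)) (hdecay k)
  obtain ⟨d, hd⟩ := h.stream_profiles_const hΩ0 hgrad
  exact fun r z t hy => ⟨hu0 _ hy, hω.eq_zero hS hΩ0 hy, hψ.hasFDerivAt_slice hS hd hy⟩
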